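/- **Setting.** Let $N,d\ge 1$ be integers and consider one of the following random $d$-regular graphs on $\{1,\dots,N\}$, given through its adjacency matrix $A$ (a loop counts twice on the diagonal). * *Uniform model* ($Nd$ even): $A$ is uniformly distributed over the symmetric $\{0,1\}$-matrices with zero diagonal and all row sums equal to $d$; $D:=\min\{d,N^2/d^3\}$. * *Permutation model* ($d$ even): $A_{ij}=\sum_{\mu=1}^{d/2}(\mathbf 1(j=\sigma_\mu(i))+\mathbf 1(i=\sigma_\mu(j)))$ with $\sigma_1,\dots,\sigma_{d/2}$ independent uniform permutations of $\{1,\dots,N\}$; $D:=\min\{d,N^2/d\}$. * *Matching model* ($N$ even): $A_{ij}=\sum_{\mu=1}^{d}\mathbf 1(j=\sigma_\mu(i))$ with $\sigma_1,\dots,\sigma_d$ independent uniform perfect matchings, i.e. permutations all of whose cycles have length two; $D:=\min\{d,N^2/d\}$. Assume $D\ge 1$ and that $N$ is larger than some absolute constant. Let $\Delta_{xy}$ be the matrix with entries $(\Delta_{xy})_{kl}=\delta_{xk}\delta_{yl}+\delta_{xl}\delta_{yk}$. A *parametrization* is a finite probability space $\Theta\times U_1\times\cdots\times U_d$, with points $(\theta,u_1,\dots,u_d)$,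 such that $u_1,\dots,u_d$ are independent conditioned on $\theta$. Its *augmentation* is $\tilde\Omega=\Theta\times U_1\times\cdots\times U_d\times U_1\times\cdots\times U_d$, with points $(\theta,u_1,\dots,u_d,\tilde u_1,\dots,\tilde u_d)$, where, conditioned on $\theta$, all of $u_1,\dots,u_d,\tilde u_1,\dots,\tilde u_d$ are independent and $\tilde u_\mu$ has the same law as $u_\mu$. On $\tilde\Omega$ put $\mathcal F_k=\sigma(\theta,u_1,\dots,u_k)$ for $0\le k\le d$, and $\mathcal G_\mu=\sigma(\theta,u_1,\dots,u_{\mu-1},u_{\mu+1},\dots,u_d)$. For a random variable $X$ on $\tilde\Omega$, let $\tilde X^\mu$ be obtained from $X$ by exchanging the arguments $u_\mu$ and $\tilde u_\mu$; write $\tilde a_\mu:=\tilde a_\mu^\mu$. For a $\sigma$-algebra $\mathcal G$, "conditioned on $\mathcal G$, $B$ holds with probability at least $p$" means $\mathbb P(B\mid\mathcal G)\ge p$ almost surely; "conditioned on $\mathcal G$, the random vertex $x$ is approximately uniform" means $\sum_{i=1}^N|\mathbb P(x=i\mid\mathcal G)-\frac1N|=O(1/\sqrt{dD})$ almost surely.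 Identities between random variables are understood almost surely. All implied constants, and the words "bounded number", refer to absolute constants, which do not depend on $N$, $d$, $\mu$ or the model. **Proposition (local resampling parametrization).** For each of the three models there are a parametrization and $\mathcal F_d$-measurable random variables $a_1,\dots,a_d,\alpha_1,\dots,\alpha_d\in\{1,\dots,N\}$ and $A=(A_{ij})_{1\le i,j\le N}$ on its augmentation such that the following holds. (i) $A$ has the law of the adjacency matrix of the model, and $(\alpha_1,\dots,\alpha_d)$ enumerates the neighbours of the vertex $1$: $A_{1i}=\sum_{\mu=1}^d\mathbf 1(i=\alpha_\mu)$ for all $i$. (ii) For every $\mu\in\{1,\dots,d\}$: (1) conditioned on $\mathcal G_\mu$, $a_\mu$ is approximately uniform; (2) conditioned on $\mathcal F_0$, $\alpha_\mu=a_\mu$ holds with probability $1-O(1/\sqrt{dD})$. (iii) For every $\mu\in\{1,\dots,d\}$: (1) $\tilde A^\mu-A$ is the sum of a bounded (possibly random) number of terms $\pm\Delta_{xy}$, where $x$ and $y$ are random variables in $\{1,\dots,N\}$. Conditioned on $\mathcal G_\mu$, with probability $1-O(1/\sqrt{dD})$ the number of terms is constant, i.e. equal to a $\mathcal G_\mu$-measurable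 random variable. Conditioned on $\mathcal G_\mu$, for each term $\pm\Delta_{xy}$ at least one of $x$ and $y$ is approximately uniform. (More precisely, the signs and the random variables $x$, $y$ are given as finite lists of fixed, absolutely bounded length with deterministic signs, whose first $n$ entries are the terms, where $n$ is the random number of terms; the approximate uniformity of $x$ or of $y$ holds for every entry of the lists.) (2) Conditioned on $\mathcal F_0$, with probability $1-O(1/\sqrt{dD})$, $$\tilde A^\mu-A=\Delta_{1\tilde a_\mu}-\Delta_{1a_\mu}+X,$$ where $X$ is a sum of a bounded, deterministic number of terms $\pm\Delta_{xy}$ with deterministic signs and random variables $x,y$ in $\{1,\dots,N\}$, each of which satisfies (a) or (b): (a) conditioned on $\mathcal G_\mu$, $x$ and $y$ are both approximately uniform; (b) conditioned on $\mathcal G_\mu,a_\mu,\tilde a_\mu$ (the $\sigma$-algebra generated by these), at least one of $x$ and $y$ is approximately uniform. -/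

import Mathlib

open MeasureTheory ProbabilityTheory

noncomputable section

/-! ### Matrices and permutations carry the discrete `σ`-algebra -/

instance instMeasurableSpaceIntMatrix (N : ℕ) :
    MeasurableSpace (Matrix (Fin N) (Fin N) ℤ) := ⊤

instance instMeasurableSpacePermFin (N : ℕ) : MeasurableSpace (Equiv.Perm (Fin N)) := ⊤

/-! ### The three models of random regular graphs

The vertex set `{1, …, N}` is `Fin N`, so the distinguished vertex `1` is `(0 : Fin N)`. -/

/-- The three standard models of random `d`-regular graphs. -/
inductive RegularGraphModel
  | uniform
  | permutation
  | matching

/-- Adjacency matrices of simple `d`-regular graphs on `Fin N`. -/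
def simpleRegularMatrices (N d : ℕ) : Set (Matrix (Fin N) (Fin N) ℤ) :=
  {B | B.IsSymm ∧ (∀ i j, B i j = 0 ∨ B i j = 1) ∧ (∀ i, B i i = 0) ∧ ∀ i, ∑ j, B i j = d}

/-- Perfect matchings of `Fin N`: permutations all of whose cycles have length two. -/
def perfectMatchings (N : ℕ) : Set (Equiv.Perm (Fin N)) :=
  {σ | ∀ i, σ (σ i) = i ∧ σ i ≠ i}

/-- Adjacency matrix of the graph with an edge `{i, σ_μ i}` for all `i` and `μ`, where a loop
counts twice on the diagonal. -/
def permutationAdjacency {N k : ℕ} (σ : Fin k → Equiv.Perm (Fin N)) :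
    Matrix (Fin N) (Fin N) ℤ :=
  Matrix.of fun i j => ∑ μ, ((if j = σ μ i then 1 else 0) + (if i = σ μ j then 1 else 0))

/-- Adjacency matrix of the superposition of the perfect matchings `σ_μ`. -/
def matchingAdjacency {N k : ℕ} (σ : Fin k → Equiv.Perm (Fin N)) :
    Matrix (Fin N) (Fin N) ℤ :=
  Matrix.of fun i j => ∑ μ, (if j = σ μ i then 1 else 0)

namespace RegularGraphModel

/-- The parity conditions on the number of vertices `N` and the degree `d`. -/
def Admissible : RegularGraphModel → ℕ → ℕ → Prop
  | uniform, N, d => Even (N * d)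
  | permutation, _, d => Even d
  | matching, N, _ => Even N

/-- The parameter `D`. -/
def D : RegularGraphModel → ℕ → ℕ → ℝ
  | uniform, N, d => min (d : ℝ) ((N : ℝ) ^ 2 / (d : ℝ) ^ 3)
  | permutation, N, d => min (d : ℝ) ((N : ℝ) ^ 2 / (d : ℝ))
  | matching, N, d => min (d : ℝ) ((N : ℝ) ^ 2 / (d : ℝ))

/-- The law of the adjacency matrix of the model: the uniform measure on simple `d`-regular
graphs, respectively the law of the adjacency matrix built from `d / 2` independent uniform
permutations, respectively from `d` independent uniform perfect matchings. -/
def law (M : RegularGraphModel) (N d : ℕ) : Measure (Matrix (Fin N) (Fin N) ℤ) :=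
  match M with
  | uniform => uniformOn (simpleRegularMatrices N d)
  | permutation =>
      (Measure.pi fun _ : Fin (d / 2) => uniformOn (Set.univ : Set (Equiv.Perm (Fin N)))).map
        permutationAdjacency
  | matching =>
      (Measure.pi fun _ : Fin d => uniformOn (perfectMatchings N)).map matchingAdjacency

end RegularGraphModel

/-- The adjacency matrix `Δ_{ij}` of the graph whose only edge joins `i` and `j`. -/
def edgeMatrix {N : ℕ} (i j : Fin N) : Matrix (Fin N) (Fin N) ℤ :=
  Matrix.of fun k l =>
    (if i = k then 1 else 0) * (if j = l then 1 else 0) +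
      (if i = l then 1 else 0) * (if j = k then 1 else 0)

/-! ### Parametrizations of the probability space -/

/-- A finite probability space `Θ × U_1 × ⋯ × U_d` such that `u_1, …, u_d` are independent
conditioned on `θ`, given by the law of `θ` and by the conditional laws of the `u_μ` given `θ`. -/
structure Parametrization (d : ℕ) where
  Θ : Type
  U : Fin d → Type
  [fintypeΘ : Fintype Θ]
  [fintypeU : ∀ μ, Fintype (U μ)]
  thetaLaw : PMF Θ
  condLaw : ∀ μ, Θ → PMF (U μ)

namespace Parametrization

variable {d : ℕ} (P : Parametrization d)

attribute [instance] Parametrization.fintypeΘ Parametrization.fintypeU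

/-- The augmented space `Θ × U_1 × ⋯ × U_d × U_1 × ⋯ × U_d` of points `(θ, u, ũ)`. -/
structure Augmented where
  θ : P.Θ
  u : ∀ μ, P.U μ
  u' : ∀ μ, P.U μ

/-- The augmented space as a product. -/
def augmentedEquiv : P.Augmented ≃ P.Θ × (∀ μ, P.U μ) × (∀ μ, P.U μ) where
  toFun ω := (ω.θ, ω.u, ω.u')
  invFun p := ⟨p.1, p.2.1, p.2.2⟩
  left_inv _ := rfl
  right_inv _ := rfl

instance : Fintype P.Augmented := Fintype.ofEquiv _ P.augmentedEquiv.symm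

instance : MeasurableSpace P.Augmented := ⊤

/-- The probability of a point `(θ, u, ũ)`: given `θ`, all the variables `u_μ`, `ũ_μ` are
independent, and both `u_μ` and `ũ_μ` have law `condLaw μ θ`. -/
def weight (ω : P.Augmented) : ENNReal :=
  P.thetaLaw ω.θ * ((∏ μ, P.condLaw μ ω.θ (ω.u μ)) * ∏ μ, P.condLaw μ ω.θ (ω.u' μ))

theorem sum_prod_condLaw (θ : P.Θ) :
    ∑ u : ∀ μ, P.U μ, ∏ μ, P.condLaw μ θ (u μ) = 1 := by
  have h : ∀ μ, ∑ v : P.U μ, P.condLaw μ θ v = 1 := fun μ => by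
    simpa [tsum_fintype] using (P.condLaw μ θ).tsum_coe
  rw [← Fintype.prod_sum]
  simp [h]

theorem sum_weight : ∑ ω, P.weight ω = 1 := by
  rw [← P.augmentedEquiv.symm.sum_comp]
  rw [Fintype.sum_prod_type]
  have h : ∀ θ : P.Θ, ∑ p : (∀ μ, P.U μ) × (∀ μ, P.U μ),
      P.weight (P.augmentedEquiv.symm (θ, p)) = P.thetaLaw θ := fun θ => by
    rw [Fintype.sum_prod_type]
    simp only [weight, augmentedEquiv, Equiv.coe_fn_symm_mk, ← Finset.mul_sum,
      P.sum_prod_condLaw, mul_one]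
  rw [Finset.sum_congr rfl fun θ _ => h θ]
  simpa [tsum_fintype] using P.thetaLaw.tsum_coe

/-- The probability measure of the augmented space. -/
def prob : Measure P.Augmented := (PMF.ofFintype P.weight P.sum_weight).toMeasure

instance : IsProbabilityMeasure P.prob := by unfold prob; infer_instance

/-- The `σ`-algebra `ℱ_k = σ(θ, u_1, …, u_k)`. -/
abbrev sigmaF (k : ℕ) : MeasurableSpace P.Augmented :=
  MeasurableSpace.comap
    (fun ω => (ω.θ, fun ν : {ν : Fin d // (ν : ℕ) < k} => ω.u ν.1)) ⊤

/-- The `σ`-algebra `𝒢_μ` generated by `θ` and all `u_ν` with `ν ≠ μ`. -/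
abbrev sigmaG (μ : Fin d) : MeasurableSpace P.Augmented :=
  MeasurableSpace.comap (fun ω => (ω.θ, fun ν : {ν : Fin d // ν ≠ μ} => ω.u ν.1)) ⊤

/-- Exchange `u_μ` and `ũ_μ`. -/
def exchange (μ : Fin d) (ω : P.Augmented) : P.Augmented :=
  ⟨ω.θ, Function.update ω.u μ (ω.u' μ), Function.update ω.u' μ (ω.u μ)⟩

/-- The version `X̃^μ` of a random variable `X`. -/
def resample {S : Type*} (μ : Fin d) (X : P.Augmented → S) : P.Augmented → S :=
  fun ω => X (P.exchange μ ω)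

end Parametrization

/-! ### Conditional statements -/

/-- Conditioned on `𝒢`, the event `B` holds with probability at least `p`. -/
def HoldsWithCondProb {Ω : Type*} [MeasurableSpace Ω] (P : Measure Ω) (𝒢 : MeasurableSpace Ω)
    (p : ℝ) (B : Set Ω) : Prop :=
  ∀ᵐ ω ∂P, p ≤ (P⟦B | 𝒢⟧) ω

/-- Conditioned on `𝒢`, the random vertex `x` is uniform up to an error `ε`. -/
def CondApproxUniform {Ω : Type*} [MeasurableSpace Ω] (P : Measure Ω) (𝒢 : MeasurableSpace Ω)
    (ε : ℝ) {N : ℕ} (x : Ω → Fin N) : Prop :=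
  ∀ᵐ ω ∂P, ∑ i : Fin N, |(P⟦{ω' | x ω' = i} | 𝒢⟧) ω - 1 / (N : ℝ)| ≤ ε

end

/-! The law of each model is invariant under suitable randomized switchings. Let θ be a sample of
the model (in the uniform model together with a uniform enumeration of the neighbours of the vertex
`0`). Given θ, let `u_1, …, u_d` be independent, each a pair of uniform vertices or of uniform
directed edges of θ. Generically, the switch `μ` exchanges the `μ`-th edge at `0` with two further
edges chosen by `u_μ`, so that `0` is joined to the first vertex `a_μ` of `u_μ`. Sending (θ, u) to
the switched sample and the data that undo the switches is a bijection of the support. All points of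
the support are equally likely, so the switched graph `A` has the law of the model
(`prob_real_preimage_of_equiv`).

Three edges are needed. A switch of two edges would join the old neighbour of `0` to a vertex
determined by `a_μ`, and neither end would be uniform given `𝒢_μ`, `a_μ`, `ã_μ`. The second
component of `u_μ` supplies a vertex that is still uniform given all of these.

Conditioned on `𝒢_μ` the vertices involved are exactly uniform (`UniformCoordinate.condUniform`).
Union bounds (`CondUniform.mem_le`) show that the switch or its resampled version degenerates with
probability `O(1/N)`, or `O(d/N)` in the uniform model, where a switch has to avoid the `O(d)`
vertices of the others. Both are `O(1/√(dD))`. Off this bad event the change of `A` is an explicit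
sum of edges; on it the change is still bounded. `LocalResampling` records this, and
`LocalResampling.conclusion` derives the claims: altering vertices on an event of conditional
probability `ε` moves their conditional law by at most `2ε`.

In the matching model the switches act on separate matchings. In the permutation model the edges
leaving and entering `0` are switched one after the other, and their interaction has to be followed.
In the uniform model all switches act simultaneously on one graph; a switch is performed only if it
is admissible and its vertices other than `0` meet no other switch. Reversal does not affect this
criterion (`ValidData.switchSet_switched`), so the simultaneous switch is an involution. -/

noncomputable section

/-! ### Conditional probabilities on a finite probability space -/

section Conditional

set_option linter.unusedSectionVars false

variable {Ω : Type*} {𝒢 𝒢' : MeasurableSpace Ω} [m₀ : MeasurableSpace Ω]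
  [DiscreteMeasurableSpace Ω] [Finite Ω] {P : Measure Ω} [IsProbabilityMeasure P] {N : ℕ}

/-- Conditioned on `𝒢`, the random vertex `x` is exactly uniform. -/
def CondUniform (P : Measure Ω) (𝒢 : MeasurableSpace Ω) (x : Ω → Fin N) : Prop :=
  ∀ S, MeasurableSet[𝒢] S → ∀ i, N * P.real (S ∩ {ω | x ω = i}) = P.real S

/-- Conditioned on `𝒢`, the event `B` holds with probability at most `ε`. -/
def CondProbLE (P : Measure Ω) (𝒢 : MeasurableSpace Ω) (ε : ℝ) (B : Set Ω) : Prop :=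
  ∀ S, MeasurableSet[𝒢] S → P.real (S ∩ B) ≤ ε * P.real S

theorem le_of_discrete : 𝒢 ≤ m₀ := fun _ _ => MeasurableSet.of_discrete

theorem CondUniform.mono {x : Ω → Fin N} (h : CondUniform P 𝒢' x) (hle : 𝒢 ≤ 𝒢') :
    CondUniform P 𝒢 x := fun S hS => h S (hle S hS)

theorem CondProbLE.mono {ε : ℝ} {B : Set Ω} (h : CondProbLE P 𝒢' ε B) (hle : 𝒢 ≤ 𝒢') :
    CondProbLE P 𝒢 ε B := fun S hS => h S (hle S hS)

theorem CondProbLE.subset {ε ε' : ℝ} {B B' : Set Ω} (h : CondProbLE P 𝒢 ε B) (hB : B' ⊆ B)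
    (hε : ε ≤ ε') : CondProbLE P 𝒢 ε' B' := fun S hS =>
  (measureReal_mono (Set.inter_subset_inter_right S hB)).trans
    ((h S hS).trans (mul_le_mul_of_nonneg_right hε measureReal_nonneg))

theorem CondProbLE.union {ε ε' : ℝ} {B B' : Set Ω} (h : CondProbLE P 𝒢 ε B)
    (h' : CondProbLE P 𝒢 ε' B') : CondProbLE P 𝒢 (ε + ε') (B ∪ B') := fun S hS => by
  rw [Set.inter_union_distrib_left, add_mul]
  exact (measureReal_union_le _ _).trans (add_le_add (h S hS) (h' S hS))

theorem CondProbLE.biUnion {ι : Type*} (s : Finset ι) {ε : ℝ} {B : ι → Set Ω}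
    (h : ∀ i ∈ s, CondProbLE P 𝒢 ε (B i)) :
    CondProbLE P 𝒢 (s.card * ε) {ω | ∃ i ∈ s, ω ∈ B i} := fun S hS => by
  have : S ∩ {ω | ∃ i ∈ s, ω ∈ B i} = ⋃ i ∈ s, S ∩ B i := by
    ext ω; simp
  rw [this]
  refine (measureReal_biUnion_finset_le _ _).trans ?_
  refine (Finset.sum_le_sum fun i hi => h i hi S hS).trans ?_
  simp [mul_assoc]

theorem CondProbLE.of_null {B : Set Ω} (h : ∀ᵐ ω ∂P, ω ∉ B) : CondProbLE P 𝒢 0 B :=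
  fun S _ => by
    have : P B = 0 := by simpa [ae_iff] using h
    simp [measureReal_def, measure_mono_null Set.inter_subset_right this]

/-- Summing over the vertices gives the expected size of `T` divided by `N`. The set `T` may be
random as long as it is `𝒢`-measurable, so a vertex can be asked to avoid others that were drawn
independently of it. -/
theorem CondUniform.mem_le {x : Ω → Fin N} (h : CondUniform P 𝒢 x) (T : Ω → Finset (Fin N))
    (hT : ∀ i, MeasurableSet[𝒢] {ω | i ∈ T ω}) {t : ℕ} (ht : ∀ ω, (T ω).card ≤ t) :
    CondProbLE P 𝒢 (t / N) {ω | x ω ∈ T ω} := fun S hS => by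
  classical
  rcases Nat.eq_zero_or_pos N with rfl | hN
  · have : S ∩ {ω | x ω ∈ T ω} = ∅ := by ext ω; exact (x ω).elim0
    simp [this]
  have hN' : (0 : ℝ) < N := by exact_mod_cast hN
  have h1 : S ∩ {ω | x ω ∈ T ω} = ⋃ i : Fin N, (S ∩ {ω | i ∈ T ω}) ∩ {ω | x ω = i} := by
    ext ω; simp
  have h2 : P.real (S ∩ {ω | x ω ∈ T ω}) ≤ ∑ i : Fin N, P.real (S ∩ {ω | i ∈ T ω}) / N := by
    rw [h1]
    refine (measureReal_iUnion_fintype_le _).trans (Finset.sum_le_sum fun i _ => ?_)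
    rw [le_div_iff₀ hN', mul_comm]
    exact (h _ (hS.inter (hT i)) i).le
  have h3 : ∑ i : Fin N, P.real (S ∩ {ω | i ∈ T ω}) ≤ t * P.real S := by
    have : ∀ i : Fin N, P.real (S ∩ {ω | i ∈ T ω})
        = ∫ ω in S, (if i ∈ T ω then (1 : ℝ) else 0) ∂P := fun i => by
      have : (fun ω => if i ∈ T ω then (1 : ℝ) else 0)
          = Set.indicator {ω | i ∈ T ω} (fun _ => (1 : ℝ)) := by
        ext ω; simp [Set.indicator]
      rw [this, integral_indicator MeasurableSet.of_discrete]
      simp [measureReal_def, Measure.restrict_apply (MeasurableSet.of_discrete), Set.inter_comm]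
    simp only [this]
    rw [← integral_finsetSum _ fun i _ => Integrable.of_finite]
    have h4 : ∫ ω in S, (t : ℝ) ∂P = t * P.real S := by simp [mul_comm]
    rw [← h4]
    refine integral_mono Integrable.of_finite Integrable.of_finite fun ω => ?_
    simp only [Finset.sum_ite_mem, Finset.univ_inter, Finset.sum_const, nsmul_eq_mul, mul_one]
    exact_mod_cast ht ω
  calc _ ≤ _ := h2
    _ = (∑ i : Fin N, P.real (S ∩ {ω | i ∈ T ω})) / N := by rw [Finset.sum_div]
    _ ≤ t * P.real S / N := by gcongr
    _ = _ := by ring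

open Classical in
-- Test on `S ∩ E` and `S \ E` separately. This allows a resampled vertex to be replaced by the
-- original one wherever a switch is known, given `𝒢`, not to take place.
theorem CondUniform.ite {x y : Ω → Fin N} (hx : CondUniform P 𝒢 x) (hy : CondUniform P 𝒢 y)
    {E : Set Ω} (hE : MeasurableSet[𝒢] E) :
    CondUniform P 𝒢 (fun ω => if ω ∈ E then x ω else y ω) := fun S hS i => by
  have hd : ∀ T : Set Ω, P.real T = P.real (T ∩ E) + P.real (T \ E) := fun T =>
    (measureReal_inter_add_sdiff₀ (MeasurableSet.of_discrete.nullMeasurableSet)).symm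
  have h1 := hx _ (hS.inter hE) i
  have h2 := hy _ (hS.diff hE) i
  rw [hd S, hd (S ∩ _), mul_add, ← h1, ← h2]
  congr 3
  · ext ω
    by_cases hω : ω ∈ E <;> simp [hω]
  · ext ω
    by_cases hω : ω ∈ E <;> simp [hω]

theorem setIntegral_condProb (B : Set Ω) {S : Set Ω}
    (hS : MeasurableSet[𝒢] S) : ∫ ω in S, (P⟦B | 𝒢⟧) ω ∂P = P.real (S ∩ B) := by
  rw [setIntegral_condExp (le_of_discrete) Integrable.of_finite hS,
    integral_indicator MeasurableSet.of_discrete]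
  simp [measureReal_def, Measure.restrict_apply (MeasurableSet.of_discrete), Set.inter_comm]

/-- Both sides are `𝒢`-measurable, so comparing their integrals over all `𝒢`-measurable sets, for
the trimmed measure, suffices. -/
theorem CondProbLE.condProb_le {ε : ℝ} {B : Set Ω} (h : CondProbLE P 𝒢 ε B) :
    ∀ᵐ ω ∂P, (P⟦B | 𝒢⟧) ω ≤ ε := by
  have hle : 𝒢 ≤ m₀ := le_of_discrete
  refine ae_of_ae_trim hle ?_
  refine ae_le_of_forall_setIntegral_le (Integrable.trim hle integrable_condExp
    stronglyMeasurable_condExp) (integrable_const ε) fun S hS _ => ?_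
  rw [← setIntegral_trim hle stronglyMeasurable_condExp hS, setIntegral_condProb B hS]
  refine (h S hS).trans (le_of_eq ?_)
  rw [← setIntegral_trim hle stronglyMeasurable_const hS]
  simp [mul_comm]

theorem CondProbLE.holdsWithCondProb {ε p : ℝ} {B : Set Ω} (h : CondProbLE P 𝒢 ε Bᶜ)
    (hp : p ≤ 1 - ε) : HoldsWithCondProb P 𝒢 p B := by
  have h1 : P⟦B | 𝒢⟧ + P⟦Bᶜ | 𝒢⟧ =ᵐ[P] fun _ => 1 := by
    refine (condExp_add (Integrable.of_finite) (Integrable.of_finite) 𝒢).symm.trans ?_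
    have : (B.indicator fun _ => (1 : ℝ)) + (Bᶜ.indicator fun _ => (1 : ℝ)) = fun _ => 1 := by
      rw [Set.indicator_self_add_compl]
    rw [this, condExp_const (le_of_discrete)]
  filter_upwards [h1, h.condProb_le] with ω h1 h2
  simp only [Pi.add_apply] at h1
  linarith

theorem CondUniform.condProb_eq {x : Ω → Fin N} (h : CondUniform P 𝒢 x) (i : Fin N) :
    ∀ᵐ ω ∂P, (P⟦{ω' | x ω' = i} | 𝒢⟧) ω = 1 / N := by
  have hN : (0 : ℝ) < N := by exact_mod_cast i.pos
  refine Filter.EventuallyEq.symm (ae_eq_condExp_of_forall_setIntegral_eq (le_of_discrete)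
    (g := fun _ => 1 / (N : ℝ)) Integrable.of_finite
    (fun _ _ _ => Integrable.of_finite) (fun S hS _ => ?_)
    stronglyMeasurable_const.aestronglyMeasurable)
  rw [integral_indicator MeasurableSet.of_discrete]
  have := h S hS i
  rw [Set.inter_comm] at this
  simp only [integral_const, MeasurableSet.of_discrete, measureReal_restrict_apply, Set.univ_inter,
    smul_eq_mul, mul_one]
  rw [← this]
  field_simp

/-- The point probabilities of `x` and `y` differ only through `B ∩ {x = i}` and `B ∩ {y = i}`.
Summed over `i`, each of these contributes at most the conditional probability of `B`, whence the
factor `2`. -/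
theorem CondUniform.approx {x y : Ω → Fin N} (h : CondUniform P 𝒢 x) {B : Set Ω} {ε ε' : ℝ}
    (hB : CondProbLE P 𝒢 ε B) (hy : ∀ ω, ω ∉ B → y ω = x ω) (hε : 2 * ε ≤ ε') :
    CondApproxUniform P 𝒢 ε' y := by
  classical
  have key : ∀ z : Ω → Fin N, ∀ᵐ ω ∂P,
      ∑ i, (P⟦B ∩ {ω' | z ω' = i} | 𝒢⟧) ω ≤ (P⟦B | 𝒢⟧) ω := fun z => by
    have h1 := condExp_finsetSum (μ := P) (s := Finset.univ)
      (f := fun i : Fin N => (B ∩ {ω' | z ω' = i}).indicator fun _ => (1 : ℝ))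
      (fun _ _ => Integrable.of_finite) 𝒢
    have h2 : ∑ i : Fin N, ((B ∩ {ω' | z ω' = i}).indicator fun _ => (1 : ℝ))
        = B.indicator fun _ => (1 : ℝ) := by
      ext ω
      by_cases hω : ω ∈ B <;> simp [Set.indicator, hω]
    rw [h2] at h1
    filter_upwards [h1] with ω h1
    rw [h1]; simp
  have hdiff : ∀ i : Fin N, ∀ᵐ ω ∂P,
      |(P⟦{ω' | y ω' = i} | 𝒢⟧) ω - (P⟦{ω' | x ω' = i} | 𝒢⟧) ω|
        ≤ (P⟦B ∩ {ω' | y ω' = i} | 𝒢⟧) ω + (P⟦B ∩ {ω' | x ω' = i} | 𝒢⟧) ω := fun i => by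
    have mono : ∀ z w : Ω → Fin N, (∀ ω, ω ∉ B → z ω = w ω) → ∀ᵐ ω ∂P,
        (P⟦{ω' | z ω' = i} | 𝒢⟧) ω ≤
          (P⟦{ω' | w ω' = i} | 𝒢⟧) ω + (P⟦B ∩ {ω' | z ω' = i} | 𝒢⟧) ω := fun z w hzw => by
      have h1 := condExp_add (μ := P)
        (f := ({ω' | w ω' = i}).indicator fun _ => (1 : ℝ))
        (g := (B ∩ {ω' | z ω' = i}).indicator fun _ => (1 : ℝ))
        (Integrable.of_finite) (Integrable.of_finite) 𝒢
      have h2 := condExp_mono (μ := P) (m := 𝒢)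
        (f := ({ω' | z ω' = i}).indicator fun _ => (1 : ℝ))
        (g := (({ω' | w ω' = i}).indicator fun _ => (1 : ℝ)) +
          ((B ∩ {ω' | z ω' = i}).indicator fun _ => (1 : ℝ)))
        (Integrable.of_finite) (Integrable.of_finite) (Filter.Eventually.of_forall fun ω => by
          by_cases hω : ω ∈ B
          · by_cases h' : z ω = i <;> by_cases h'' : w ω = i <;>
              simp [Set.indicator, hω, h', h'']
          · simp [Set.indicator, hω, hzw ω hω])
      filter_upwards [h1, h2] with ω h1 h2
      exact h2.trans (le_of_eq h1)
    have nonneg : ∀ z : Ω → Fin N, ∀ᵐ ω ∂P, 0 ≤ (P⟦B ∩ {ω' | z ω' = i} | 𝒢⟧) ω := fun z =>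
      condExp_nonneg (Filter.Eventually.of_forall fun ω => Set.indicator_nonneg (by simp) ω)
    filter_upwards [mono y x hy, mono x y fun ω hω => (hy ω hω).symm, nonneg x, nonneg y]
      with ω h1 h2 h3 h4
    rw [abs_le]; constructor <;> linarith
  filter_upwards [key x, key y, ae_all_iff.2 hdiff, ae_all_iff.2 h.condProb_eq, hB.condProb_le]
    with ω h1 h2 h3 h4 h5
  calc _ ≤ ∑ i : Fin N, ((P⟦B ∩ {ω' | y ω' = i} | 𝒢⟧) ω + (P⟦B ∩ {ω' | x ω' = i} | 𝒢⟧) ω) :=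
        Finset.sum_le_sum fun i _ => by rw [← h4 i]; exact h3 i
    _ ≤ ε' := by rw [Finset.sum_add_distrib]; linarith

theorem CondUniform.condApproxUniform {x : Ω → Fin N} (h : CondUniform P 𝒢 x) {ε : ℝ}
    (hε : 0 ≤ ε) : CondApproxUniform P 𝒢 ε x :=
  h.approx (B := ∅) (ε := 0) (CondProbLE.of_null (by simp)) (fun _ _ => rfl) (by simpa using hε)

end Conditional

/-! ### Refreshing one coordinate of a finite probability space -/

/-- A coordinate `get` of a weighted finite space which, given the others, is uniform on `κ`. -/
structure UniformCoordinate {Ω V : Type*} (w : Ω → ℝ) (κ : Ω → Finset V) where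
  get : Ω → V
  put : V → Ω → Ω
  get_put : ∀ v ω, get (put v ω) = v
  put_get : ∀ ω, put (get ω) ω = ω
  put_put : ∀ v v' ω, put v (put v' ω) = put v ω
  range_put : ∀ v ω, κ (put v ω) = κ ω
  weight_put : ∀ v ω, get ω ∈ κ ω → v ∈ κ ω → w (put v ω) = w ω
  weight_eq_zero : ∀ ω, get ω ∉ κ ω → w ω = 0

/-- The sets that do not depend on the refreshed coordinate. -/
@[reducible]
def invSigma {Ω V : Type*} (put : V → Ω → Ω) : MeasurableSpace Ω where
  MeasurableSet' S := ∀ v ω, put v ω ∈ S ↔ ω ∈ S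
  measurableSet_empty := by simp
  measurableSet_compl S h v ω := not_congr (h v ω)
  measurableSet_iUnion S h v ω := by simp [h]

theorem comap_le_invSigma {Ω V S : Type*} {put : V → Ω → Ω} {f : Ω → S}
    (h : ∀ v ω, f (put v ω) = f ω) : MeasurableSpace.comap f ⊤ ≤ invSigma put := by
  rintro _ ⟨t, -, rfl⟩ v ω
  simp [h]

namespace UniformCoordinate

variable {Ω V : Type*} [Fintype Ω] [Fintype V] {w : Ω → ℝ} {κ : Ω → Finset V}

/-- Drawing a fresh value of the coordinate does not change the law. The involution `e` of `Ω × V`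
exchanges the stored value with the fresh one, and it preserves the weight when both lie in the
range. -/
theorem sum_refresh (c : UniformCoordinate w κ) (hκ : ∀ ω, (κ ω).Nonempty) (F : Ω → ℝ) :
    ∑ ω, w ω * F ω = ∑ ω, w ω * ((∑ v ∈ κ ω, F (c.put v ω)) / (κ ω).card) := by
  classical
  let e : Ω × V ≃ Ω × V :=
    { toFun := fun p => (c.put p.2 p.1, c.get p.1)
      invFun := fun p => (c.put p.2 p.1, c.get p.1)
      left_inv := fun p => by simp [c.put_put, c.put_get, c.get_put]
      right_inv := fun p => by simp [c.put_put, c.put_get, c.get_put] }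
  have h := e.sum_comp fun p : Ω × V =>
    if p.2 ∈ κ p.1 then w p.1 * F p.1 / (κ p.1).card else 0
  rw [Fintype.sum_prod_type, Fintype.sum_prod_type] at h
  calc _ = ∑ ω, ∑ v, if v ∈ κ ω then w ω * F ω / (κ ω).card else 0 :=
        Finset.sum_congr rfl fun ω _ => by
          have : ((κ ω).card : ℝ) ≠ 0 := by exact_mod_cast (hκ ω).card_pos.ne'
          simp only [Finset.sum_ite_mem, Finset.univ_inter, Finset.sum_const, nsmul_eq_mul]
          field_simp
    _ = _ := h.symm
    _ = _ := Finset.sum_congr rfl fun ω _ => by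
          rw [Finset.sum_div, Finset.mul_sum, ← Finset.sum_subset (Finset.subset_univ (κ ω))]
          · refine Finset.sum_congr rfl fun v hv => ?_
            simp only [e, Equiv.coe_fn_mk, c.range_put]
            by_cases hg : c.get ω ∈ κ ω
            · simp only [hg, if_true, c.weight_put v ω hg hv]; ring
            · simp [hg, c.weight_eq_zero ω hg]
          · intro v _ hv
            simp only [e, Equiv.coe_fn_mk, c.range_put]
            by_cases hg : c.get ω ∈ κ ω
            · have : w (c.put v ω) = 0 := c.weight_eq_zero _ (by rwa [c.get_put, c.range_put])
              simp [hg, this]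
            · simp [hg]

/-- By `sum_refresh` the coordinate may be averaged out. Membership in `S` does not feel this, while
`x` takes each value on exactly one `N`-th of the range. -/
theorem condUniform [MeasurableSpace Ω] {P : Measure Ω}
    (hP : ∀ S : Set Ω, P.real S = ∑ ω, w ω * S.indicator (fun _ => (1 : ℝ)) ω)
    (c : UniformCoordinate w κ) (hκ : ∀ ω, (κ ω).Nonempty) {N : ℕ} {x : Ω → Fin N}
    (hx : ∀ ω i, N * ((κ ω).filter fun v => x (c.put v ω) = i).card = (κ ω).card) :
    CondUniform P (invSigma c.put) x := fun S hS i => by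
  classical
  rw [hP, hP, c.sum_refresh hκ, Finset.mul_sum]
  refine Finset.sum_congr rfl fun ω _ => ?_
  have h0 : ((κ ω).card : ℝ) ≠ 0 := by exact_mod_cast (hκ ω).card_pos.ne'
  by_cases hω : ω ∈ S
  · have : ∑ v ∈ κ ω, (S ∩ {ω | x ω = i}).indicator (fun _ => (1 : ℝ)) (c.put v ω)
        = ((κ ω).filter fun v => x (c.put v ω) = i).card := by
      rw [Finset.card_filter]
      push_cast
      refine Finset.sum_congr rfl fun v _ => ?_
      simp [Set.indicator, hS v ω, hω]
    rw [this, Set.indicator_of_mem hω, ← hx ω i]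
    have h1 : ((N * ((κ ω).filter fun v => x (c.put v ω) = i).card : ℕ) : ℝ) ≠ 0 := by
      rw [hx ω i]; exact h0
    push_cast at h1 ⊢
    rw [mul_one, ← mul_assoc, mul_comm (N : ℝ), mul_assoc, ← mul_div_assoc, div_self h1, mul_one]
  · have : ∀ v, (S ∩ {ω | x ω = i}).indicator (fun _ => (1 : ℝ)) (c.put v ω) = 0 := fun v =>
      Set.indicator_of_notMem (fun h => hω ((hS v ω).1 h.1)) _
    simp [this, Set.indicator_of_notMem hω]

end UniformCoordinate

/-! ### Parametrizations by pairs -/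

instance {d : ℕ} (P : Parametrization d) : DiscreteMeasurableSpace P.Augmented :=
  ⟨fun _ => trivial⟩

/-- `θ` is uniform on `Θ` and, given `θ`, each `u_μ` consists of two independent uniform elements
of `κ θ`. -/
abbrev pairParam (d : ℕ) {Θ V : Type} [Fintype Θ] [Nonempty Θ] [Fintype V] (κ : Θ → Finset V)
    (hκ : ∀ θ, (κ θ).Nonempty) : Parametrization d where
  Θ := Θ
  U _ := V × V
  thetaLaw := PMF.uniformOfFintype Θ
  condLaw _ θ := PMF.uniformOfFinset (κ θ ×ˢ κ θ) ((hκ θ).product (hκ θ))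

section PairParam

set_option linter.unusedSectionVars false

variable {d : ℕ} {Θ V : Type} [Fintype Θ] [Nonempty Θ] [Fintype V] {κ : Θ → Finset V}
  {hκ : ∀ θ, (κ θ).Nonempty}

/-- The points `u` that are charged given `θ`. -/
def Supported (κ : Θ → Finset V) (θ : Θ) (u : Fin d → V × V) : Prop :=
  ∀ μ, (u μ).1 ∈ κ θ ∧ (u μ).2 ∈ κ θ

open Classical in
/-- The density of `u_μ` given `θ`. -/
def pairDensity (κ : Θ → Finset V) (θ : Θ) (z : V × V) : ℝ :=
  if z.1 ∈ κ θ ∧ z.2 ∈ κ θ then ((κ θ ×ˢ κ θ).card : ℝ)⁻¹ else 0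

theorem pairDensity_congr {θ : Θ} {z z' : V × V} (h₁ : z.1 ∈ κ θ ↔ z'.1 ∈ κ θ)
    (h₂ : z.2 ∈ κ θ ↔ z'.2 ∈ κ θ) : pairDensity κ θ z = pairDensity κ θ z' := by
  have h := and_congr h₁ h₂
  by_cases hz : z.1 ∈ κ θ ∧ z.2 ∈ κ θ
  · rw [pairDensity, pairDensity, if_pos hz, if_pos (h.1 hz)]
  · rw [pairDensity, pairDensity, if_neg hz, if_neg fun h' => hz (h.2 h')]

theorem weight_toReal (ω : (pairParam d κ hκ).Augmented) :
    ((pairParam d κ hκ).weight ω).toReal = (Fintype.card Θ : ℝ)⁻¹ *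
      ((∏ μ, pairDensity κ ω.θ (ω.u μ)) * ∏ μ, pairDensity κ ω.θ (ω.u' μ)) := by
  classical
  have h : ∀ (θ : Θ) (z : V × V),
      (PMF.uniformOfFinset (κ θ ×ˢ κ θ) ((hκ θ).product (hκ θ)) z).toReal
        = pairDensity κ θ z := fun θ z => by
    rw [PMF.uniformOfFinset_apply, pairDensity]
    simp only [Finset.mem_product]
    split_ifs <;> simp
  simp only [Parametrization.weight, ENNReal.toReal_mul, ENNReal.toReal_prod, h,
    PMF.uniformOfFintype_apply, ENNReal.toReal_inv, ENNReal.toReal_natCast]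

theorem prob_real (S : Set (pairParam d κ hκ).Augmented) :
    (pairParam d κ hκ).prob.real S = ∑ ω, ((pairParam d κ hκ).weight ω).toReal *
      S.indicator (fun _ => (1 : ℝ)) ω := by
  rw [measureReal_def, Parametrization.prob, PMF.toMeasure_apply_fintype, ENNReal.toReal_sum]
  · refine Finset.sum_congr rfl fun ω _ => ?_
    by_cases h : ω ∈ S <;> simp [h]
  · intro ω _
    by_cases h : ω ∈ S
    · simpa [h] using PMF.apply_ne_top (PMF.ofFintype _ (pairParam d κ hκ).sum_weight) ω
    · simp [h]

theorem prod_pairDensity_update (θ : Θ) (u : Fin d → V × V) (μ : Fin d) (z : V × V)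
    (h : pairDensity κ θ z = pairDensity κ θ (u μ)) :
    ∏ ν, pairDensity κ θ (Function.update u μ z ν) = ∏ ν, pairDensity κ θ (u ν) := by
  refine Finset.prod_congr rfl fun ν _ => ?_
  rcases eq_or_ne ν μ with rfl | hν
  · simpa using h
  · simp [hν]

theorem weight_eq_zero_of_not (ω : (pairParam d κ hκ).Augmented) (μ : Fin d)
    (h : ¬ ((ω.u μ).1 ∈ κ ω.θ ∧ (ω.u μ).2 ∈ κ ω.θ) ∨
      ¬ ((ω.u' μ).1 ∈ κ ω.θ ∧ (ω.u' μ).2 ∈ κ ω.θ)) :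
    ((pairParam d κ hκ).weight ω).toReal = 0 := by
  rw [weight_toReal]
  rcases h with h | h
  · rw [Finset.prod_eq_zero (Finset.mem_univ μ) (by rw [pairDensity, if_neg h])]; simp
  · rw [Finset.prod_eq_zero (i := μ) (f := fun μ => pairDensity κ ω.θ (ω.u' μ))
      (Finset.mem_univ μ) (by rw [pairDensity, if_neg h])]; simp

theorem ae_supported : ∀ᵐ ω ∂(pairParam d κ hκ).prob,
    Supported κ ω.θ ω.u ∧ Supported κ ω.θ ω.u' := by
  classical
  rw [ae_iff, ← measureReal_eq_zero_iff, prob_real]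
  refine Finset.sum_eq_zero fun ω _ => ?_
  by_cases h : Supported κ ω.θ ω.u ∧ Supported κ ω.θ ω.u'
  · rw [Set.indicator_of_notMem (by simpa using h), mul_zero]
  · rw [not_and_or, Supported, Supported, not_forall, not_forall] at h
    rcases h with ⟨μ, h⟩ | ⟨μ, h⟩
    · rw [weight_eq_zero_of_not ω μ (Or.inl h), zero_mul]
    · rw [weight_eq_zero_of_not ω μ (Or.inr h), zero_mul]

variable (hκ) in
/-- The first component of `u_μ`. -/
def coordFst (μ : Fin d) : UniformCoordinate
    (fun ω : (pairParam d κ hκ).Augmented => ((pairParam d κ hκ).weight ω).toReal)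
    (fun ω => κ ω.θ) where
  get ω := (ω.u μ).1
  put v ω := ⟨ω.θ, Function.update ω.u μ (v, (ω.u μ).2), ω.u'⟩
  get_put v ω := by simp
  put_get ω := by simp
  put_put v v' ω := by simp
  range_put v ω := rfl
  weight_put v ω h h' := by
    rw [weight_toReal, weight_toReal, prod_pairDensity_update]
    exact pairDensity_congr (iff_of_true h' h) Iff.rfl
  weight_eq_zero ω h := weight_eq_zero_of_not ω μ (Or.inl fun h' => h h'.1)

variable (hκ) in
/-- The second component of `u_μ`. -/
def coordSnd (μ : Fin d) : UniformCoordinate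
    (fun ω : (pairParam d κ hκ).Augmented => ((pairParam d κ hκ).weight ω).toReal)
    (fun ω => κ ω.θ) where
  get ω := (ω.u μ).2
  put v ω := ⟨ω.θ, Function.update ω.u μ ((ω.u μ).1, v), ω.u'⟩
  get_put v ω := by simp
  put_get ω := by simp
  put_put v v' ω := by simp
  range_put v ω := rfl
  weight_put v ω h h' := by
    rw [weight_toReal, weight_toReal, prod_pairDensity_update]
    exact pairDensity_congr Iff.rfl (iff_of_true h' h)
  weight_eq_zero ω h := weight_eq_zero_of_not ω μ (Or.inl fun h' => h h'.2)

variable (hκ) in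
/-- The first component of `ũ_μ`. -/
def coordFst' (μ : Fin d) : UniformCoordinate
    (fun ω : (pairParam d κ hκ).Augmented => ((pairParam d κ hκ).weight ω).toReal)
    (fun ω => κ ω.θ) where
  get ω := (ω.u' μ).1
  put v ω := ⟨ω.θ, ω.u, Function.update ω.u' μ (v, (ω.u' μ).2)⟩
  get_put v ω := by simp
  put_get ω := by simp
  put_put v v' ω := by simp
  range_put v ω := rfl
  weight_put v ω h h' := by
    rw [weight_toReal, weight_toReal, prod_pairDensity_update]
    exact pairDensity_congr (iff_of_true h' h) Iff.rfl
  weight_eq_zero ω h := weight_eq_zero_of_not ω μ (Or.inr fun h' => h h'.1)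

variable (hκ) in
/-- The second component of `ũ_μ`. -/
def coordSnd' (μ : Fin d) : UniformCoordinate
    (fun ω : (pairParam d κ hκ).Augmented => ((pairParam d κ hκ).weight ω).toReal)
    (fun ω => κ ω.θ) where
  get ω := (ω.u' μ).2
  put v ω := ⟨ω.θ, ω.u, Function.update ω.u' μ ((ω.u' μ).1, v)⟩
  get_put v ω := by simp
  put_get ω := by simp
  put_put v v' ω := by simp
  range_put v ω := rfl
  weight_put v ω h h' := by
    rw [weight_toReal, weight_toReal, prod_pairDensity_update]
    exact pairDensity_congr Iff.rfl (iff_of_true h' h)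
  weight_eq_zero ω h := weight_eq_zero_of_not ω μ (Or.inr fun h' => h h'.2)

theorem prod_pairDensity (hcard : ∀ θ θ' : Θ, (κ θ).card = (κ θ').card) {θ θ' : Θ}
    {u u' : Fin d → V × V} (h : Supported κ θ u ↔ Supported κ θ' u') :
    ∏ μ, pairDensity κ θ (u μ) = ∏ μ, pairDensity κ θ' (u' μ) := by
  classical
  by_cases hu : Supported κ θ u
  · have hu' := h.1 hu
    refine Finset.prod_congr rfl fun μ _ => ?_
    rw [pairDensity, pairDensity, if_pos (hu μ), if_pos (hu' μ), Finset.card_product,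
      Finset.card_product, hcard θ θ']
  · have hu' : ¬ Supported κ θ' u' := fun h' => hu (h.2 h')
    rw [Supported, not_forall] at hu hu'
    obtain ⟨μ, hμ⟩ := hu
    obtain ⟨μ', hμ'⟩ := hu'
    rw [Finset.prod_eq_zero (Finset.mem_univ μ) (by rw [pairDensity, if_neg hμ]),
      Finset.prod_eq_zero (Finset.mem_univ μ') (by rw [pairDensity, if_neg hμ'])]

theorem sum_prod_pairDensity (hκ : ∀ θ, (κ θ).Nonempty) (θ : Θ) :
    ∑ u : Fin d → V × V, ∏ μ, pairDensity κ θ (u μ) = 1 := by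
  classical
  rw [← Fintype.prod_sum]
  refine Finset.prod_eq_one fun μ _ => ?_
  have : ∀ z, pairDensity κ θ z = if z ∈ κ θ ×ˢ κ θ then ((κ θ ×ˢ κ θ).card : ℝ)⁻¹ else 0 :=
    fun z => by simp [pairDensity]
  simp only [this, Finset.sum_ite_mem, Finset.univ_inter, Finset.sum_const, nsmul_eq_mul]
  exact mul_inv_cancel₀ (by exact_mod_cast ((hκ θ).product (hκ θ)).card_pos.ne')

/-- A bijection that preserves the support preserves the law. -/
theorem prob_real_preimage_of_equiv (hcard : ∀ θ θ' : Θ, (κ θ).card = (κ θ').card)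
    (e : Equiv.Perm (Θ × (Fin d → V × V)))
    (he : ∀ x, Supported κ (e x).1 (e x).2 ↔ Supported κ x.1 x.2)
    {Y : Type*} (F : Θ → Y) (A : (pairParam d κ hκ).Augmented → Y)
    (hA : ∀ ω, Supported κ ω.θ ω.u → A ω = F (e (ω.θ, ω.u)).1) (S : Set Y) :
    (pairParam d κ hκ).prob.real (A ⁻¹' S) =
      (Fintype.card Θ : ℝ)⁻¹ * ∑ θ, S.indicator (fun _ => (1 : ℝ)) (F θ) := by
  classical
  have h1 : ∀ ω : (pairParam d κ hκ).Augmented,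
      ((pairParam d κ hκ).weight ω).toReal * (A ⁻¹' S).indicator (fun _ => (1 : ℝ)) ω
        = (Fintype.card Θ : ℝ)⁻¹ * ((∏ μ, pairDensity κ ω.θ (ω.u μ)) *
          S.indicator (fun _ => (1 : ℝ)) (F (e (ω.θ, ω.u)).1) *
            ∏ μ, pairDensity κ ω.θ (ω.u' μ)) := fun ω => by
    by_cases h : Supported κ ω.θ ω.u
    · have : (A ⁻¹' S).indicator (fun _ => (1 : ℝ)) ω
          = S.indicator (fun _ => (1 : ℝ)) (F (e (ω.θ, ω.u)).1) := by
        simp [Set.indicator, hA ω h]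
      rw [weight_toReal, this]; ring
    · rw [Supported, not_forall] at h
      obtain ⟨μ, hμ⟩ := h
      rw [weight_eq_zero_of_not ω μ (Or.inl hμ),
        Finset.prod_eq_zero (Finset.mem_univ μ) (by rw [pairDensity, if_neg hμ])]
      simp
  rw [prob_real, Finset.sum_congr rfl fun ω _ => h1 ω, ← Finset.mul_sum,
    ← (pairParam d κ hκ).augmentedEquiv.symm.sum_comp]
  congr 1
  rw [Fintype.sum_prod_type]
  have h2 : ∀ θ : Θ, ∑ p : (Fin d → V × V) × (Fin d → V × V),
      ((∏ μ, pairDensity κ θ (p.1 μ)) *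
          S.indicator (fun _ => (1 : ℝ)) (F (e (θ, p.1)).1) *
            ∏ μ, pairDensity κ θ (p.2 μ))
      = ∑ u : Fin d → V × V, (∏ μ, pairDensity κ θ (u μ)) *
          S.indicator (fun _ => (1 : ℝ)) (F (e (θ, u)).1) := fun θ => by
    rw [Fintype.sum_prod_type]
    simp only [← Finset.mul_sum, sum_prod_pairDensity hκ, mul_one]
  refine (Finset.sum_congr rfl fun θ _ => h2 θ).trans ?_
  rw [← Fintype.sum_prod_type' (f := fun θ (u : Fin d → V × V) =>
    (∏ μ, pairDensity κ θ (u μ)) * S.indicator (fun _ => (1 : ℝ)) (F (e (θ, u)).1))]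
  -- All `κ θ` have the same size, so the density depends only on membership in the support and
  -- agrees at `x` and `e x`. Reindexing by `e` then removes the bijection.
  let G : Θ × (Fin d → V × V) → ℝ := fun y =>
    (∏ μ, pairDensity κ y.1 (y.2 μ)) * S.indicator (fun _ => (1 : ℝ)) (F y.1)
  have h3 : ∀ x : Θ × (Fin d → V × V), (∏ μ, pairDensity κ x.1 (x.2 μ)) *
      S.indicator (fun _ => (1 : ℝ)) (F (e (x.1, x.2)).1) = G (e x) := fun x => by
    simp only [Prod.mk.eta, G]
    rw [prod_pairDensity hcard (he x).symm]
  refine (Finset.sum_congr rfl fun x _ => h3 x).trans ((Equiv.sum_comp e G).trans ?_)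
  rw [Fintype.sum_prod_type]
  simp only [G, ← Finset.sum_mul, sum_prod_pairDensity hκ, one_mul]

end PairParam

/-! ### Differences of edge matrices -/

/-- `M` is the difference of two sums of `L` edge matrices. -/
def IsEdgeDifference {N : ℕ} (L : ℕ) (M : Matrix (Fin N) (Fin N) ℤ) : Prop :=
  ∃ x y z w : Fin L → Fin N, M = ∑ k, (edgeMatrix (x k) (y k) - edgeMatrix (z k) (w k))

namespace IsEdgeDifference

variable {N : ℕ} {L L' : ℕ} {M M' : Matrix (Fin N) (Fin N) ℤ}

theorem zero [NeZero N] (L : ℕ) : IsEdgeDifference L (0 : Matrix (Fin N) (Fin N) ℤ) :=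
  ⟨fun _ => 0, fun _ => 0, fun _ => 0, fun _ => 0, by simp⟩

theorem add (h : IsEdgeDifference L M) (h' : IsEdgeDifference L' M') :
    IsEdgeDifference (L + L') (M + M') := by
  obtain ⟨x, y, z, w, rfl⟩ := h
  obtain ⟨x', y', z', w', rfl⟩ := h'
  exact ⟨Fin.append x x', Fin.append y y', Fin.append z z', Fin.append w w', by
    simp [Fin.sum_univ_add]
    abel⟩

theorem mono [NeZero N] (h : IsEdgeDifference L M) (hL : L ≤ L') : IsEdgeDifference L' M := by
  obtain ⟨k, rfl⟩ := Nat.exists_eq_add_of_le hL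
  simpa using h.add (zero k)

theorem neg (h : IsEdgeDifference L M) : IsEdgeDifference L (-M) := by
  obtain ⟨x, y, z, w, rfl⟩ := h
  exact ⟨z, w, x, y, by rw [← Finset.sum_neg_distrib]; simp⟩

theorem sub (h : IsEdgeDifference L M) (h' : IsEdgeDifference L' M') :
    IsEdgeDifference (L + L') (M - M') := by
  rw [sub_eq_add_neg]
  exact h.add h'.neg

theorem single (x y z w : Fin N) :
    IsEdgeDifference 1 (edgeMatrix x y - edgeMatrix z w) :=
  ⟨fun _ => x, fun _ => y, fun _ => z, fun _ => w, by simp⟩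

theorem sum [NeZero N] {ι : Type*} (s : Finset ι) (f : ι → Matrix (Fin N) (Fin N) ℤ)
    (h : ∀ i ∈ s, IsEdgeDifference L (f i)) : IsEdgeDifference (s.card * L) (∑ i ∈ s, f i) := by
  classical
  induction s using Finset.induction_on with
  | empty => simpa using zero 0
  | insert i s hi ih =>
    rw [Finset.sum_insert hi, Finset.card_insert_of_notMem hi, add_mul, one_mul, add_comm (f i)]
    exact (ih fun j hj => h j (Finset.mem_insert_of_mem hj)).add (h i (Finset.mem_insert_self i s))

end IsEdgeDifference

theorem edgeMatrix_comm {N : ℕ} (x y : Fin N) : edgeMatrix x y = edgeMatrix y x := by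
  ext k l
  simp only [edgeMatrix, Matrix.of_apply]
  ring

/-! ### Local resampling -/

section Local

set_option linter.unusedSectionVars false

variable {d N : ℕ} [NeZero N] (P : Parametrization d)

/-- The `σ`-algebra generated by `𝒢_μ`, `b` and the resampled version of `b`. -/
abbrev sigmaGWith (μ : Fin d) (b : P.Augmented → Fin N) : MeasurableSpace P.Augmented :=
  P.sigmaG μ ⊔ MeasurableSpace.comap b ⊤ ⊔ MeasurableSpace.comap (P.resample μ b) ⊤

/-- The edge `{x, y}` has two uniform ends given `𝒢_μ`, or one uniform end given `𝒢_μ`, `b` and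
the resampled version of `b`. -/
def UniformEdge (μ : Fin d) (b x y : P.Augmented → Fin N) : Prop :=
  (CondUniform P.prob (P.sigmaG μ) x ∧ CondUniform P.prob (P.sigmaG μ) y) ∨
    (CondUniform P.prob (sigmaGWith P μ b) x ∨ CondUniform P.prob (sigmaGWith P μ b) y)

variable {P} in
-- Uniformity given a larger `σ`-algebra implies uniformity given `𝒢_μ`.
theorem UniformEdge.or {μ : Fin d} {b x y : P.Augmented → Fin N} (h : UniformEdge P μ b x y) :
    CondUniform P.prob (P.sigmaG μ) x ∨ CondUniform P.prob (P.sigmaG μ) y := by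
  have hle : P.sigmaG μ ≤ sigmaGWith P μ b := le_sup_of_le_left le_sup_left
  rcases h with h | h | h
  · exact Or.inl h.1
  · exact Or.inl (h.mono hle)
  · exact Or.inr (h.mono hle)

/-- The effect of resampling `u_μ`, up to an event `B` that is rare given `𝒢_μ`; the vertex `b'`
stands for the resampled version of `b` and differs from it only outside the event `g`. -/
structure LocalResampling (A : P.Augmented → Matrix (Fin N) (Fin N) ℤ)
    (b c : P.Augmented → Fin N) (μ : Fin d) (ε : ℝ) (L : ℕ) where
  B : Set P.Augmented
  g : Set P.Augmented
  m : ℕ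
  b' : P.Augmented → Fin N
  x : Fin m → P.Augmented → Fin N
  y : Fin m → P.Augmented → Fin N
  z : Fin m → P.Augmented → Fin N
  w : Fin m → P.Augmented → Fin N
  -- A strict inequality leaves room for the edges `{0, b'}` and `{0, b}` in lists of length `L`.
  m_lt : m < L
  prob_B : CondProbLE P.prob (P.sigmaG μ) ε B
  -- Only `ℱ_0` can be used here: in the uniform model, and for the edge entering `0` in the
  -- permutation model, `g` is determined by `𝒢_μ` and may fail outright given it.
  prob_g : CondProbLE P.prob (P.sigmaF 0) ε gᶜ
  uniform_b : CondUniform P.prob (P.sigmaG μ) b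
  uniform_b' : CondUniform P.prob (P.sigmaG μ) b'
  uniform_xy : ∀ k, UniformEdge P μ b (x k) (y k)
  uniform_zw : ∀ k, UniformEdge P μ b (z k) (w k)
  difference : ∀ ω, ω ∉ B → P.resample μ A ω - A ω =
    edgeMatrix 0 (b' ω) - edgeMatrix 0 (b ω) +
      ∑ k, (edgeMatrix (x k ω) (y k ω) - edgeMatrix (z k ω) (w k ω))
  typical : ∀ ω, ω ∉ B → ω ∈ g → b' ω = P.resample μ b ω ∧ c ω = b ω
  bounded : ∀ᵐ ω ∂P.prob, IsEdgeDifference L (P.resample μ A ω - A ω)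

theorem sigmaF_zero_le_sigmaG (μ : Fin d) : P.sigmaF 0 ≤ P.sigmaG μ := by
  rintro _ ⟨t, -, rfl⟩
  refine ⟨{p | (p.1, fun ν : {ν : Fin d // (ν : ℕ) < 0} => (Nat.not_lt_zero _ ν.2).elim) ∈ t},
    trivial, ?_⟩
  ext ω
  simp only [Set.mem_preimage, Set.mem_ofPred_eq]
  rw [iff_iff_eq]
  congr 2
  funext ν
  exact (Nat.not_lt_zero _ ν.2).elim

theorem measurable_sigmaF_of_factor {S : Type*} [MeasurableSpace S] {X : P.Augmented → S}
    (h : ∀ ω ω', ω.θ = ω'.θ → ω.u = ω'.u → X ω = X ω') : Measurable[P.sigmaF d] X := by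
  intro t _
  refine ⟨(fun ω => (ω.θ, fun ν : {ν : Fin d // (ν : ℕ) < d} => ω.u ν.1)) '' (X ⁻¹' t),
    trivial, ?_⟩
  ext ω
  constructor
  · rintro ⟨ω', h1, h2⟩
    simp only [Prod.mk.injEq] at h2
    have : X ω' = X ω := h _ _ h2.1 (funext fun ν => congr_fun h2.2 ⟨ν, ν.2⟩)
    simpa [← this] using h1
  · intro h1
    exact ⟨ω, h1, rfl⟩

theorem measurableSet_sigmaG_of_factor {μ : Fin d} {S : Set P.Augmented}
    (h : ∀ ω ω' : P.Augmented, ω.θ = ω'.θ → (∀ ν, ν ≠ μ → ω.u ν = ω'.u ν) → ω ∈ S → ω' ∈ S) :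
    MeasurableSet[P.sigmaG μ] S := by
  refine ⟨(fun ω => (ω.θ, fun ν : {ν : Fin d // ν ≠ μ} => ω.u ν.1)) '' S, trivial, ?_⟩
  ext ω
  constructor
  · rintro ⟨ω', h1, h2⟩
    simp only [Prod.mk.injEq] at h2
    exact h _ _ h2.1 (fun ν hν => congr_fun h2.2 ⟨ν, hν⟩) h1
  · intro h1
    exact ⟨ω, h1, rfl⟩

variable {P}

/-- The full list is the typical one off `B` and an arbitrary bounded representation on `B`; as `B`
is rare given `𝒢_μ`, its vertices stay approximately uniform. The expansion around `{0, a_μ}` needs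
`g` as well, and `B ∪ gᶜ` has probability at most `2ε` given `ℱ_0`. -/
theorem LocalResampling.conclusion {A : P.Augmented → Matrix (Fin N) (Fin N) ℤ}
    {b c : P.Augmented → Fin N} {μ : Fin d} {ε δ : ℝ} {L : ℕ}
    (h : LocalResampling P A b c μ ε L) (hδ : 0 ≤ δ) (hε : 2 * ε ≤ δ) :
    CondApproxUniform P.prob (P.sigmaG μ) δ b ∧
    HoldsWithCondProb P.prob (P.sigmaF 0) (1 - δ) {ω | c ω = b ω} ∧
    (∃ (s : Fin (L + L) → ℤˣ) (x y : Fin (L + L) → P.Augmented → Fin N) (n : P.Augmented → ℕ),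
      (∀ ω, n ω ≤ L + L) ∧
      (∀ᵐ ω ∂P.prob, P.resample μ A ω - A ω = ∑ k : Fin (L + L),
        if (k : ℕ) < n ω then (s k : ℤ) • edgeMatrix (x k ω) (y k ω) else 0) ∧
      (∃ n₀ : P.Augmented → ℕ, Measurable[P.sigmaG μ] n₀ ∧
        HoldsWithCondProb P.prob (P.sigmaG μ) (1 - δ) {ω | n ω = n₀ ω}) ∧
      ∀ k, CondApproxUniform P.prob (P.sigmaG μ) δ (x k) ∨
        CondApproxUniform P.prob (P.sigmaG μ) δ (y k)) ∧
    ∃ (m : ℕ) (s : Fin m → ℤˣ) (x y : Fin m → P.Augmented → Fin N),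
      m ≤ L + L ∧
      HoldsWithCondProb P.prob (P.sigmaF 0) (1 - δ)
        {ω | P.resample μ A ω - A ω =
          edgeMatrix 0 (P.resample μ b ω) - edgeMatrix 0 (b ω) +
            ∑ k, (s k : ℤ) • edgeMatrix (x k ω) (y k ω)} ∧
      ∀ k, (CondApproxUniform P.prob (P.sigmaG μ) δ (x k) ∧
          CondApproxUniform P.prob (P.sigmaG μ) δ (y k)) ∨
        (CondApproxUniform P.prob (P.sigmaG μ ⊔ MeasurableSpace.comap b ⊤ ⊔
            MeasurableSpace.comap (P.resample μ b) ⊤) δ (x k) ∨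
          CondApproxUniform P.prob (P.sigmaG μ ⊔ MeasurableSpace.comap b ⊤ ⊔
            MeasurableSpace.comap (P.resample μ b) ⊤) δ (y k)) := by
  classical
  have hBg : CondProbLE P.prob (P.sigmaF 0) (2 * ε) (h.B ∪ h.gᶜ) := by
    rw [two_mul]
    exact (h.prob_B.mono (sigmaF_zero_le_sigmaG P μ)).union h.prob_g
  refine ⟨h.uniform_b.condApproxUniform hδ, ?_, ?_, ?_⟩
  · refine (hBg.subset ?_ hε).holdsWithCondProb le_rfl
    intro ω hω
    by_contra hcon
    simp only [Set.mem_union, Set.mem_compl_iff, not_or, not_not] at hcon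
    exact hω (h.typical ω hcon.1 hcon.2).2
  · have hb : ∀ ω, ∃ x y z w : Fin L → Fin N,
        IsEdgeDifference L (P.resample μ A ω - A ω) → P.resample μ A ω - A ω =
          ∑ k, (edgeMatrix (x k) (y k) - edgeMatrix (z k) (w k)) := fun ω => by
      by_cases hω : IsEdgeDifference L (P.resample μ A ω - A ω)
      · obtain ⟨x, y, z, w, hxy⟩ := hω
        exact ⟨x, y, z, w, fun _ => hxy⟩
      · exact ⟨fun _ => 0, fun _ => 0, fun _ => 0, fun _ => 0, fun h => absurd h hω⟩
    choose bx byy bz bw hb using hb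
    -- The typical list has `1 + m` pairs of edges. It is padded by `r` cancelling pairs of edges
    -- `{b, b}`, whose ends are uniform, so that both lists have length `L`.
    obtain ⟨r, hr⟩ := Nat.exists_eq_add_of_lt h.m_lt
    have hL : L = 1 + h.m + r := by omega
    -- the typical lists
    let nx : Fin (1 + h.m + r) → P.Augmented → Fin N :=
      Fin.append (Fin.append (fun _ : Fin 1 => fun _ => 0) h.x) (fun _ => b)
    let ny : Fin (1 + h.m + r) → P.Augmented → Fin N :=
      Fin.append (Fin.append (fun _ : Fin 1 => h.b') h.y) (fun _ => b)
    let nz : Fin (1 + h.m + r) → P.Augmented → Fin N :=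
      Fin.append (Fin.append (fun _ : Fin 1 => fun _ => 0) h.z) (fun _ => b)
    let nw : Fin (1 + h.m + r) → P.Augmented → Fin N :=
      Fin.append (Fin.append (fun _ : Fin 1 => b) h.w) (fun _ => b)
    have hsum : ∀ ω, ω ∉ h.B → P.resample μ A ω - A ω =
        ∑ k, (edgeMatrix (nx k ω) (ny k ω) - edgeMatrix (nz k ω) (nw k ω)) := fun ω hω => by
      rw [h.difference ω hω]
      simp [nx, ny, nz, nw, Fin.sum_univ_add]
      abel
    have hxy : ∀ k, CondUniform P.prob (P.sigmaG μ) (nx k) ∨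
        CondUniform P.prob (P.sigmaG μ) (ny k) := fun k => by
      refine Fin.addCases (fun k => ?_) (fun k => ?_) k
      · refine Fin.addCases (fun k => ?_) (fun k => ?_) k
        · right; simpa [ny] using h.uniform_b'
        · simpa [nx, ny] using (h.uniform_xy k).or
      · right; simpa [ny] using h.uniform_b
    have hzw : ∀ k, CondUniform P.prob (P.sigmaG μ) (nz k) ∨
        CondUniform P.prob (P.sigmaG μ) (nw k) := fun k => by
      refine Fin.addCases (fun k => ?_) (fun k => ?_) k
      · refine Fin.addCases (fun k => ?_) (fun k => ?_) k
        · right; simpa [nw] using h.uniform_b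
        · simpa [nz, nw] using (h.uniform_zw k).or
      · right; simpa [nw] using h.uniform_b
    let e : Fin L → Fin (1 + h.m + r) := Fin.cast hL
    have hsum' : ∀ ω, ω ∉ h.B → P.resample μ A ω - A ω =
        ∑ k, (edgeMatrix (nx (e k) ω) (ny (e k) ω) - edgeMatrix (nz (e k) ω) (nw (e k) ω)) :=
      fun ω hω => by
        rw [hsum ω hω]
        exact ((finCongr hL).sum_comp fun k =>
          (edgeMatrix (nx k ω) (ny k ω) - edgeMatrix (nz k ω) (nw k ω))).symm
    have hmod : ∀ {v v' : P.Augmented → Fin N}, CondUniform P.prob (P.sigmaG μ) v →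
        CondApproxUniform P.prob (P.sigmaG μ) δ (fun ω => if ω ∈ h.B then v' ω else v ω) :=
      fun hv => hv.approx h.prob_B (fun ω hω => by simp [hω]) hε
    refine ⟨Fin.addCases (fun _ => 1) (fun _ => -1),
      Fin.append (fun k ω => if ω ∈ h.B then bx ω k else nx (e k) ω)
        (fun k ω => if ω ∈ h.B then bz ω k else nz (e k) ω),
      Fin.append (fun k ω => if ω ∈ h.B then byy ω k else ny (e k) ω)
        (fun k ω => if ω ∈ h.B then bw ω k else nw (e k) ω),
      -- Because of the padding, the number of terms is constant everywhere and not only off the bad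
      -- event.
      fun _ => L + L, fun _ => le_rfl, ?_, ⟨fun _ => L + L, measurable_const, ?_⟩, ?_⟩
    · filter_upwards [h.bounded] with ω hω
      simp only [Fin.is_lt, if_true]
      rw [Fin.sum_univ_add]
      simp only [Fin.addCases_left, Fin.addCases_right, Fin.append_left, Fin.append_right,
        Units.val_one, one_smul, Units.val_neg, neg_smul]
      rw [← Finset.sum_add_distrib]
      simp only [← sub_eq_add_neg]
      by_cases hB : ω ∈ h.B
      · simpa [hB] using hb ω hω
      · simpa [hB] using hsum' ω hB
    · refine (CondProbLE.of_null (B := {ω | L + L = L + L}ᶜ) (by simp)).holdsWithCondProb ?_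
      linarith
    · intro k
      refine Fin.addCases (fun k => ?_) (fun k => ?_) k
      · simp only [Fin.append_left]
        exact (hxy (e k)).imp hmod hmod
      · simp only [Fin.append_right]
        exact (hzw (e k)).imp hmod hmod
  · refine ⟨h.m + h.m, Fin.addCases (fun _ => 1) (fun _ => -1), Fin.append h.x h.z,
      Fin.append h.y h.w, by have := h.m_lt; omega, ?_, ?_⟩
    · refine (hBg.subset ?_ hε).holdsWithCondProb le_rfl
      intro ω hω
      by_contra hcon
      simp only [Set.mem_union, Set.mem_compl_iff, not_or, not_not] at hcon
      refine hω ?_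
      rw [Set.mem_ofPred_eq, h.difference ω hcon.1, (h.typical ω hcon.1 hcon.2).1,
        Fin.sum_univ_add]
      simp only [Fin.addCases_left, Fin.addCases_right, Fin.append_left, Fin.append_right,
        Units.val_one, one_smul, Units.val_neg, neg_smul]
      rw [← Finset.sum_add_distrib]
      simp only [← sub_eq_add_neg]
    · have key : ∀ {v v' : P.Augmented → Fin N}, UniformEdge P μ b v v' →
          (CondApproxUniform P.prob (P.sigmaG μ) δ v ∧
            CondApproxUniform P.prob (P.sigmaG μ) δ v') ∨
          (CondApproxUniform P.prob (sigmaGWith P μ b) δ v ∨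
            CondApproxUniform P.prob (sigmaGWith P μ b) δ v') := fun hv =>
        hv.imp
          (And.imp (fun h => h.condApproxUniform hδ) (fun h => h.condApproxUniform hδ))
          (Or.imp (fun h => h.condApproxUniform hδ) (fun h => h.condApproxUniform hδ))
      intro k
      refine Fin.addCases (fun k => ?_) (fun k => ?_) k
      · simpa only [Fin.append_left] using key (h.uniform_xy k)
      · simpa only [Fin.append_right] using key (h.uniform_zw k)

end Local

/-! ### The coordinates of a pair and the `σ`-algebras that leave them free -/

section Coordinates

variable {d : ℕ} {Θ V : Type} [Fintype Θ] [Nonempty Θ] [Fintype V] {κ : Θ → Finset V}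
  {hκ : ∀ θ, (κ θ).Nonempty}

theorem sigmaG_le_coordFst (μ : Fin d) :
    (pairParam d κ hκ).sigmaG μ ≤ invSigma (coordFst hκ μ).put :=
  comap_le_invSigma fun v ω => by
    refine Prod.ext rfl (funext fun ν => ?_)
    exact Function.update_of_ne ν.2 _ _

theorem sigmaG_le_coordSnd (μ : Fin d) :
    (pairParam d κ hκ).sigmaG μ ≤ invSigma (coordSnd hκ μ).put :=
  comap_le_invSigma fun v ω => by
    refine Prod.ext rfl (funext fun ν => ?_)
    exact Function.update_of_ne ν.2 _ _

theorem sigmaG_le_coordFst' (μ : Fin d) :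
    (pairParam d κ hκ).sigmaG μ ≤ invSigma (coordFst' hκ μ).put :=
  comap_le_invSigma fun _ _ => rfl

theorem sigmaG_le_coordSnd' (μ : Fin d) :
    (pairParam d κ hκ).sigmaG μ ≤ invSigma (coordSnd' hκ μ).put :=
  comap_le_invSigma fun _ _ => rfl

/-- Since `b` depends only on the first component of `u_μ`, the second component remains free given
`𝒢_μ`, `b` and the resampled `b`. All edges with a single uniform end rely on this. -/
theorem sigmaGWith_le_coordSnd {N : ℕ} (μ : Fin d) {b : (pairParam d κ hκ).Augmented → Fin N}
    (f : V → Fin N) (hb : ∀ ω, b ω = f (ω.u μ).1) :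
    sigmaGWith _ μ b ≤ invSigma (coordSnd hκ μ).put := by
  refine sup_le (sup_le (sigmaG_le_coordSnd μ) ?_) ?_
  · exact comap_le_invSigma fun v ω => by rw [hb, hb]; simp [coordSnd]
  · exact comap_le_invSigma fun v ω => by
      simp [coordSnd, Parametrization.resample, Parametrization.exchange, hb]

theorem sigmaGWith_le_coordSnd' {N : ℕ} (μ : Fin d) {b : (pairParam d κ hκ).Augmented → Fin N}
    (f : V → Fin N) (hb : ∀ ω, b ω = f (ω.u μ).1) :
    sigmaGWith _ μ b ≤ invSigma (coordSnd' hκ μ).put := by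
  refine sup_le (sup_le (sigmaG_le_coordSnd' μ) ?_) ?_
  · exact comap_le_invSigma fun v ω => by rw [hb, hb]; simp [coordSnd']
  · exact comap_le_invSigma fun v ω => by
      simp [coordSnd', Parametrization.resample, Parametrization.exchange, hb]

theorem pairParam_condUniform {N : ℕ} (c : UniformCoordinate
      (fun ω : (pairParam d κ hκ).Augmented => ((pairParam d κ hκ).weight ω).toReal)
      (fun ω => κ ω.θ)) {x : (pairParam d κ hκ).Augmented → Fin N}
    (hx : ∀ ω i, N * ((κ ω.θ).filter fun v => x (c.put v ω) = i).card = (κ ω.θ).card) :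
    CondUniform (pairParam d κ hκ).prob (invSigma c.put) x :=
  c.condUniform prob_real (fun ω => hκ ω.θ) hx

theorem condProbLE_of_mem {N : ℕ} {put : V → (pairParam d κ hκ).Augmented →
      (pairParam d κ hκ).Augmented} {μ : Fin d}
    (h𝒢 : (pairParam d κ hκ).sigmaG μ ≤ invSigma put) {x : (pairParam d κ hκ).Augmented → Fin N}
    (hx : CondUniform (pairParam d κ hκ).prob (invSigma put) x)
    (T : (pairParam d κ hκ).Augmented → Finset (Fin N)) (hT : ∀ v ω, T (put v ω) = T ω)
    {t : ℕ} (ht : ∀ ω, (T ω).card ≤ t) :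
    CondProbLE (pairParam d κ hκ).prob ((pairParam d κ hκ).sigmaG μ) (t / N) {ω | x ω ∈ T ω} :=
  (hx.mem_le T (fun i v ω => by simp [hT]) ht).mono h𝒢

theorem prob_map_eq {Y : Type*} [MeasurableSpace Y] (A : (pairParam d κ hκ).Augmented → Y)
    (ν : Measure Y) [IsFiniteMeasure ν]
    (h : ∀ S, (pairParam d κ hκ).prob.real (A ⁻¹' S) = ν.real S) :
    (pairParam d κ hκ).prob.map A = ν := by
  ext S hS
  rw [Measure.map_apply (measurable_of_finite A) hS]
  have := h S
  rw [measureReal_def, measureReal_def,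
    ENNReal.toReal_eq_toReal_iff' (measure_ne_top _ _) (measure_ne_top _ _)] at this
  exact this

end Coordinates

/-! ### Vertex-valued coordinates -/

section Vertex

theorem univ_nonempty_fin {N : ℕ} {Θ : Type} [NeZero N] (_ : Θ) :
    (Finset.univ : Finset (Fin N)).Nonempty :=
  Finset.univ_nonempty

/-- The parametrization by pairs of uniform vertices. -/
abbrev vertexParam (d N : ℕ) (Θ : Type) [Fintype Θ] [Nonempty Θ] [NeZero N] : Parametrization d :=
  pairParam d (fun _ : Θ => (Finset.univ : Finset (Fin N))) univ_nonempty_fin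

/-- An injective self-map of `Fin N` is a bijection, so every value has exactly one preimage. -/
theorem vertexParam_condUniform {d N : ℕ} {Θ : Type} [Fintype Θ] [Nonempty Θ] [NeZero N]
    (c : UniformCoordinate
      (fun ω : (vertexParam d N Θ).Augmented => ((vertexParam d N Θ).weight ω).toReal)
      (fun _ => (Finset.univ : Finset (Fin N)))) {x : (vertexParam d N Θ).Augmented → Fin N}
    (hx : ∀ ω, Function.Injective fun v => x (c.put v ω)) :
    CondUniform (vertexParam d N Θ).prob (invSigma c.put) x :=
  pairParam_condUniform c fun ω i => by
    obtain ⟨v, hv⟩ := (Finite.injective_iff_surjective.1 (hx ω)) i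
    have : (Finset.univ.filter fun v => x (c.put v ω) = i) = {v} := by
      ext v'
      simp only [Finset.mem_filter, Finset.mem_univ, true_and, Finset.mem_singleton]
      exact ⟨fun h => hx ω (h.trans hv.symm), fun h => h ▸ hv⟩
    rw [this]
    simp

end Vertex

/-! ### Products of uniform laws on permutations -/

/-- Expand the product measure over its atoms; those outside the range of `f` carry no mass. The law
thereby becomes an average over the parameter space, the form that `prob_real_preimage_of_equiv`
produces. -/
theorem pi_uniformOn_real {k N : ℕ} {X : Type} [Fintype X] [Nonempty X]
    (f : X → Equiv.Perm (Fin N)) (hf : Function.Injective f) {Y : Type*} [MeasurableSpace Y]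
    [DiscreteMeasurableSpace Y] (G : (Fin k → Equiv.Perm (Fin N)) → Y) (S : Set Y) :
    ((Measure.pi fun _ : Fin k => uniformOn (Set.range f)).map G).real S =
      (Fintype.card (Fin k → X) : ℝ)⁻¹ *
        ∑ θ : Fin k → X, S.indicator (fun _ => (1 : ℝ)) (G fun i => f (θ i)) := by
  classical
  have : IsProbabilityMeasure (uniformOn (Set.range f)) :=
    isProbabilityMeasure_uniformOn (Set.toFinite _) (Set.range_nonempty f)
  rw [map_measureReal_apply (measurable_of_finite G) (MeasurableSet.of_discrete)]
  have h1 : ∀ T : Set (Fin k → Equiv.Perm (Fin N)),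
      (Measure.pi fun _ : Fin k => uniformOn (Set.range f)).real T = ∑ y,
        (Measure.pi fun _ : Fin k => uniformOn (Set.range f)).real {y} *
          T.indicator (fun _ => (1 : ℝ)) y := fun T => by
    have : T = ⋃ y ∈ (Finset.univ.filter fun y => y ∈ T), {y} := by ext; simp
    conv_lhs => rw [this]
    rw [measureReal_biUnion_finset (by
      intro a _ b _ hab
      simpa using hab) (fun _ _ => measurableSet_singleton _), Finset.sum_filter]
    refine Finset.sum_congr rfl fun y _ => ?_
    by_cases hy : y ∈ T <;> simp [hy]
  have h2 : ∀ σ : Equiv.Perm (Fin N), (uniformOn (Set.range f)).real {σ} =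
      if σ ∈ Set.range f then (Fintype.card X : ℝ)⁻¹ else 0 := fun σ => by
    rw [measureReal_def, uniformOn, cond_apply (Set.toFinite _).measurableSet,
      Measure.count_apply_finite _ (Set.toFinite _)]
    have hc : (Set.toFinite (Set.range f)).toFinset.card = Fintype.card X := by
      rw [← Set.ncard_eq_toFinset_card _ _, Set.ncard_eq_toFinset_card', Set.toFinset_range,
        Finset.card_image_of_injective _ hf, Finset.card_univ]
    rw [hc]
    split_ifs with h
    · have : Set.range f ∩ {σ} = {σ} := by simpa using h
      rw [this]; simp
    · have : Set.range f ∩ {σ} = ∅ := by simpa using h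
      rw [this]; simp
  have h3 : ∀ y : Fin k → Equiv.Perm (Fin N),
      (Measure.pi fun _ : Fin k => uniformOn (Set.range f)).real {y} =
        ∏ i, if y i ∈ Set.range f then (Fintype.card X : ℝ)⁻¹ else 0 := fun y => by
    rw [measureReal_def, Measure.pi_singleton, ENNReal.toReal_prod]
    exact Finset.prod_congr rfl fun i _ => h2 (y i)
  rw [h1, Finset.mul_sum]
  symm
  refine Fintype.sum_of_injective (fun θ : Fin k → X => fun i => f (θ i)) ?_ _ _ ?_ ?_
  · intro θ θ' h
    exact funext fun i => hf (congr_fun h i)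
  · intro y hy
    have : ∃ i, y i ∉ Set.range f := by
      by_contra hcon
      push Not at hcon
      choose θ hθ using hcon
      exact hy ⟨θ, funext hθ⟩
    obtain ⟨i, hi⟩ := this
    rw [h3, Finset.prod_eq_zero (Finset.mem_univ i) (if_neg hi), zero_mul]
  · intro θ
    rw [h3]
    congr 1
    · simp

/-! ### The matching model -/

theorem sum_sub_sum_eq_of_eq_off {ι R : Type*} [Fintype ι] [AddCommGroup R] (s : Finset ι)
    (f g : ι → R) (h : ∀ i, i ∉ s → f i = g i) :
    ∑ i, f i - ∑ i, g i = ∑ i ∈ s, f i - ∑ i ∈ s, g i := by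
  classical
  rw [← Finset.sum_sub_distrib, ← Finset.sum_sub_distrib]
  symm
  refine Finset.sum_subset (Finset.subset_univ s) fun i _ hi => ?_
  rw [h i hi, sub_self]

theorem edgeMatrix_eq_single {N : ℕ} (x y : Fin N) :
    edgeMatrix x y = Matrix.single x y (1 : ℤ) + Matrix.single y x 1 := by
  ext k l
  simp only [edgeMatrix, Matrix.of_apply, Matrix.add_apply, Matrix.single_apply]
  by_cases h1 : x = k <;> by_cases h2 : y = l <;> by_cases h3 : x = l <;> by_cases h4 : y = k <;>
    simp_all

section Matching

variable {N : ℕ}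

/-- The adjacency matrix of one perfect matching. -/
def pairingMatrix (σ : Equiv.Perm (Fin N)) : Matrix (Fin N) (Fin N) ℤ :=
  ∑ i, Matrix.single i (σ i) 1

theorem matchingAdjacency_eq_sum {k : ℕ} (σ : Fin k → Equiv.Perm (Fin N)) :
    matchingAdjacency σ = ∑ μ, pairingMatrix (σ μ) := by
  ext i j
  simp only [matchingAdjacency, pairingMatrix, Matrix.of_apply, Matrix.sum_apply,
    Matrix.single_apply]
  refine Finset.sum_congr rfl fun μ _ => ?_
  rw [Finset.sum_eq_single i]
  · simp [eq_comm]
  · intro b _ hb; simp [hb]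
  · simp

variable [NeZero N]

/-- Switch the edges of the matching `σ` at the vertices `0` and `b`. -/
def matchingStep (b : Fin N) (σ : Equiv.Perm (Fin N)) : Equiv.Perm (Fin N) :=
  if b = 0 then σ else Equiv.swap (σ 0) b * σ * Equiv.swap (σ 0) b

variable {σ : Equiv.Perm (Fin N)} {b : Fin N}

theorem matchingStep_zero : matchingStep 0 σ = σ := by simp [matchingStep]

theorem matchingStep_mem (hσ : σ ∈ perfectMatchings N) (b : Fin N) :
    matchingStep b σ ∈ perfectMatchings N := by
  unfold matchingStep
  split_ifs
  · exact hσ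
  · intro i
    refine ⟨by simp [(hσ _).1], fun h => (hσ (Equiv.swap (σ 0) b i)).2 ?_⟩
    simp only [Equiv.Perm.coe_mul, Function.comp_apply] at h
    exact Equiv.swap_apply_eq_iff.1 h

theorem matchingStep_apply_zero (hσ : σ ∈ perfectMatchings N) (hb : b ≠ 0) :
    matchingStep b σ 0 = b := by
  have h := (hσ 0).2
  simp [matchingStep, hb, Equiv.swap_apply_of_ne_of_ne h.symm hb.symm]

/-- After the step `b` is the partner of `0`, so stepping with the old partner conjugates by the
same transposition again. -/
theorem matchingStep_matchingStep (hσ : σ ∈ perfectMatchings N) (hb : b ≠ 0) :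
    matchingStep (σ 0) (matchingStep b σ) = σ := by
  have h0 := matchingStep_apply_zero hσ hb
  rw [matchingStep, if_neg (hσ 0).2, h0, matchingStep, if_neg hb, Equiv.swap_comm b]
  simp [mul_assoc]

theorem matchingStep_apply (hb : b ≠ 0) {i : Fin N} (h1 : i ≠ σ 0) (h2 : i ≠ b)
    (h3 : σ i ≠ σ 0) (h4 : σ i ≠ b) : matchingStep b σ i = σ i := by
  simp [matchingStep, hb, Equiv.swap_apply_of_ne_of_ne h1 h2, Equiv.swap_apply_of_ne_of_ne h3 h4]

/-- Only `0`, `b` and their partners change partner. If `b` is already the partner of `0`, the step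
is trivial and the right-hand side cancels. -/
theorem pairingMatrix_matchingStep (hσ : σ ∈ perfectMatchings N) (hb : b ≠ 0) :
    pairingMatrix (matchingStep b σ) - pairingMatrix σ =
      edgeMatrix 0 b + edgeMatrix (σ 0) (σ b) - edgeMatrix 0 (σ 0) - edgeMatrix b (σ b) := by
  have h0 := (hσ 0).2
  rcases eq_or_ne b (σ 0) with rfl | hb'
  · have : matchingStep (σ 0) σ = σ := by ext i; simp [matchingStep, h0]
    simp [this, (hσ 0).1, edgeMatrix_comm (σ 0) 0]
  have hbb := (hσ b).2
  have h1 : σ b ≠ 0 := fun h => hb' (by rw [← h, (hσ b).1])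
  have h2 : σ b ≠ σ 0 := fun h => hb (σ.injective h)
  have e0 : matchingStep b σ 0 = b := matchingStep_apply_zero hσ hb
  have eb : matchingStep b σ b = 0 := by
    have := (matchingStep_mem hσ b 0).1
    rwa [e0] at this
  have e1 : matchingStep b σ (σ b) = σ 0 := by
    simp [matchingStep, hb, Equiv.swap_apply_of_ne_of_ne h2 hbb, (hσ b).1]
  have e2 : matchingStep b σ (σ 0) = σ b := by
    have := (matchingStep_mem hσ b (σ b)).1
    rwa [e1] at this
  rw [pairingMatrix, pairingMatrix, sum_sub_sum_eq_of_eq_off {0, b, σ 0, σ b}]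
  · rw [Finset.sum_insert (by simp [hb.symm, h0.symm, h1.symm]),
      Finset.sum_insert (by simp [hb', hbb.symm]), Finset.sum_insert (by simp [h2.symm]),
      Finset.sum_singleton, Finset.sum_insert (by simp [hb.symm, h0.symm, h1.symm]),
      Finset.sum_insert (by simp [hb', hbb.symm]), Finset.sum_insert (by simp [h2.symm]),
      Finset.sum_singleton, e0, eb, e1, e2, (hσ 0).1, (hσ b).1]
    simp only [edgeMatrix_eq_single]
    abel
  · intro i hi
    simp only [Finset.mem_insert, Finset.mem_singleton, not_or] at hi
    rw [matchingStep_apply hb hi.2.2.1 hi.2.1 (fun h => hi.1 (σ.injective h))]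
    exact fun h => hi.2.2.2 (by rw [← h, (hσ i).1])

theorem pairingMatrix_matchingStep_isEdgeDifference (hσ : σ ∈ perfectMatchings N) (b : Fin N) :
    IsEdgeDifference 2 (pairingMatrix (matchingStep b σ) - pairingMatrix σ) := by
  rcases eq_or_ne b 0 with rfl | hb
  · rw [matchingStep_zero, sub_self]; exact IsEdgeDifference.zero 2
  · rw [pairingMatrix_matchingStep hσ hb]
    convert (IsEdgeDifference.single (σ 0) (σ b) 0 (σ 0)).add
      (IsEdgeDifference.single 0 b b (σ b)) using 1
    abel

/-- The double switch of the matching `σ` with the vertices `z.1` and `z.2`. -/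
def matchingSwitch (z : Fin N × Fin N) (σ : Equiv.Perm (Fin N)) : Equiv.Perm (Fin N) :=
  matchingStep z.1 (matchingStep z.2 σ)

theorem matchingSwitch_isEdgeDifference (hσ : σ ∈ perfectMatchings N) (z : Fin N × Fin N) :
    IsEdgeDifference 4 (pairingMatrix (matchingSwitch z σ) - pairingMatrix σ) := by
  convert (pairingMatrix_matchingStep_isEdgeDifference (matchingStep_mem hσ z.2) z.1).add
    (pairingMatrix_matchingStep_isEdgeDifference hσ z.2) using 1
  simp [matchingSwitch]

theorem matchingSwitch_apply_zero (hσ : σ ∈ perfectMatchings N) {z : Fin N × Fin N}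
    (h : z.1 ≠ 0) : matchingSwitch z σ 0 = z.1 :=
  matchingStep_apply_zero (matchingStep_mem hσ _) h

/-- The pairs for which the double switch involves three distinct edges. -/
def MatchingGeneric (σ : Equiv.Perm (Fin N)) (z : Fin N × Fin N) : Prop :=
  z.2 ≠ 0 ∧ z.1 ∉ ({0, z.2, σ 0, σ z.2} : Finset (Fin N))

/-- This is the reason for switching twice. The old partner `σ 0` is joined to `σ z.2`, which is
independent of the new partner `z.1`; a single step with `z.1` would join it to `σ z.1`. -/
theorem pairingMatrix_matchingSwitch (hσ : σ ∈ perfectMatchings N) {z : Fin N × Fin N}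
    (hz : MatchingGeneric σ z) :
    pairingMatrix (matchingSwitch z σ) - pairingMatrix σ =
      edgeMatrix (σ 0) (σ z.2) - edgeMatrix 0 (σ 0) - edgeMatrix z.2 (σ z.2) +
      edgeMatrix 0 z.1 + edgeMatrix z.2 (σ z.1) - edgeMatrix z.1 (σ z.1) := by
  obtain ⟨h2, h1⟩ := hz
  simp only [Finset.mem_insert, Finset.mem_singleton, not_or] at h1
  have e : matchingStep z.2 σ z.1 = σ z.1 := by
    refine matchingStep_apply h2 h1.2.2.1 h1.2.1 (fun h => h1.1 (σ.injective h)) fun h => ?_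
    exact h1.2.2.2 (by rw [← h, (hσ _).1])
  have := pairingMatrix_matchingStep (matchingStep_mem hσ z.2) h1.1
  rw [e, matchingStep_apply_zero hσ h2] at this
  rw [matchingSwitch, ← sub_add_sub_cancel _ (pairingMatrix (matchingStep z.2 σ)), this,
    pairingMatrix_matchingStep hσ h2]
  abel

/-- The type of perfect matchings. -/
abbrev Pairing (N : ℕ) : Type := {σ : Equiv.Perm (Fin N) // σ ∈ perfectMatchings N}

instance (N : ℕ) : Fintype (Pairing N) := Fintype.ofFinite _

/-- The switch of a matching as a bijection. -/
def matchingStepEquiv : Equiv.Perm (Pairing N × Fin N) :=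
  Function.Involutive.toPerm
    -- The old partner of `0` is what is needed to undo the step; for `b = 0` the step does nothing
    -- and `b` is kept.
    (fun p => (⟨matchingStep p.2 p.1, matchingStep_mem p.1.2 p.2⟩,
      if p.2 = 0 then 0 else p.1.1 0)) fun p => by
    obtain ⟨⟨σ, hσ⟩, b⟩ := p
    by_cases hb : b = 0
    · simp [hb, matchingStep_zero]
    · simp [hb, (hσ 0).2, matchingStep_matchingStep hσ hb, matchingStep_apply_zero hσ hb]

end Matching

/-- Apply `J` to the state and the second component, then `J'` to the state and the first
component. -/
def pairLift {X V : Type} (J J' : Equiv.Perm (X × V)) : Equiv.Perm (X × V × V) where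
  toFun p := ((J' ((J (p.1, p.2.2)).1, p.2.1)).1, (J' ((J (p.1, p.2.2)).1, p.2.1)).2,
    (J (p.1, p.2.2)).2)
  invFun p := ((J.symm ((J'.symm (p.1, p.2.1)).1, p.2.2)).1, (J'.symm (p.1, p.2.1)).2,
    (J.symm ((J'.symm (p.1, p.2.1)).1, p.2.2)).2)
  left_inv p := by simp
  right_inv p := by simp

/-- Apply a bijection in every coordinate. -/
def coordinatewise {d : ℕ} {X W : Type} (J : Equiv.Perm (X × W)) :
    Equiv.Perm ((Fin d → X) × (Fin d → W)) :=
  (Equiv.arrowProdEquivProdArrow (Fin d) (fun _ => X) (fun _ => W)).symm.trans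
    ((Equiv.piCongrRight fun _ => J).trans
      (Equiv.arrowProdEquivProdArrow (Fin d) (fun _ => X) (fun _ => W)))

theorem pairing_nonempty {N : ℕ} (hN : Even N) : Nonempty (Pairing N) := by
  obtain ⟨k, rfl⟩ := hN
  let f : Fin (k + k) → Fin (k + k) := fun i =>
    if h : (i : ℕ) < k then ⟨i + k, by omega⟩ else ⟨i - k, by omega⟩
  have hf : ∀ i, f (f i) = i := fun i => by
    by_cases h : (i : ℕ) < k
    · simp [f, h]
    · have h' : (i : ℕ) - k < k := by omega
      simp only [f, h, dite_false, h', dite_true]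
      ext; simp only; omega
  refine ⟨⟨Function.Involutive.toPerm f hf, fun i => ⟨hf i, fun h => ?_⟩⟩⟩
  have h : ((f i : Fin (k + k)) : ℕ) = i := congr_arg Fin.val h
  simp only [f] at h
  split_ifs at h <;> simp only at h <;> omega

/-- The model has a parametrization in which every `u_μ` can be resampled locally, with
errors `ε`. -/
def HasLocalResampling (M : RegularGraphModel) (N d : ℕ) [NeZero N] (ε : ℝ) (L : ℕ) : Prop :=
  ∃ (P : Parametrization d) (a α : Fin d → P.Augmented → Fin N)
    (A : P.Augmented → Matrix (Fin N) (Fin N) ℤ),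
    (∀ μ, Measurable[P.sigmaF d] (a μ)) ∧ (∀ μ, Measurable[P.sigmaF d] (α μ)) ∧
    Measurable[P.sigmaF d] A ∧ P.prob.map A = M.law N d ∧
    (∀ᵐ ω ∂P.prob, ∀ i, A ω 0 i = ∑ μ, if i = α μ ω then 1 else 0) ∧
    ∀ μ, Nonempty (LocalResampling P A (a μ) (α μ) μ ε L)

theorem exchange_u_self {d : ℕ} (P : Parametrization d) (μ : Fin d) (ω : P.Augmented) :
    (P.exchange μ ω).u μ = ω.u' μ := by simp [Parametrization.exchange]

theorem exchange_u_of_ne {d : ℕ} (P : Parametrization d) {μ ν : Fin d} (h : ν ≠ μ)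
    (ω : P.Augmented) : (P.exchange μ ω).u ν = ω.u ν := by simp [Parametrization.exchange, h]

section VertexUniform

variable {d N : ℕ} {Θ : Type} [Fintype Θ] [Nonempty Θ] [NeZero N]

theorem uniform_fst (μ : Fin d) (f : Θ → Fin N → Fin N) (hf : ∀ θ, Function.Injective (f θ)) :
    CondUniform (vertexParam d N Θ).prob
      (invSigma (coordFst (κ := fun _ : Θ => (Finset.univ : Finset (Fin N)))
        univ_nonempty_fin μ).put) (fun ω => f ω.θ (ω.u μ).1) :=
  vertexParam_condUniform _ fun ω v v' h => hf ω.θ (by simpa [coordFst] using h)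

theorem uniform_snd (μ : Fin d) (f : Θ → Fin N → Fin N) (hf : ∀ θ, Function.Injective (f θ)) :
    CondUniform (vertexParam d N Θ).prob
      (invSigma (coordSnd (κ := fun _ : Θ => (Finset.univ : Finset (Fin N)))
        univ_nonempty_fin μ).put) (fun ω => f ω.θ (ω.u μ).2) :=
  vertexParam_condUniform _ fun ω v v' h => hf ω.θ (by simpa [coordSnd] using h)

theorem uniform_fst' (μ : Fin d) (f : Θ → Fin N → Fin N) (hf : ∀ θ, Function.Injective (f θ)) :
    CondUniform (vertexParam d N Θ).prob
      (invSigma (coordFst' (κ := fun _ : Θ => (Finset.univ : Finset (Fin N)))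
        univ_nonempty_fin μ).put) (fun ω => f ω.θ (ω.u' μ).1) :=
  vertexParam_condUniform _ fun ω v v' h => hf ω.θ (by simpa [coordFst'] using h)

theorem uniform_snd' (μ : Fin d) (f : Θ → Fin N → Fin N) (hf : ∀ θ, Function.Injective (f θ)) :
    CondUniform (vertexParam d N Θ).prob
      (invSigma (coordSnd' (κ := fun _ : Θ => (Finset.univ : Finset (Fin N)))
        univ_nonempty_fin μ).put) (fun ω => f ω.θ (ω.u' μ).2) :=
  vertexParam_condUniform _ fun ω v v' h => hf ω.θ (by simpa [coordSnd'] using h)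

end VertexUniform

/-! ### Law and resampling in the matching model -/

section MatchingModel

variable {N d : ℕ} [NeZero N] [Nonempty (Pairing N)]

/-- The parametrization of the matching model. -/
abbrev matchingParam (d N : ℕ) [NeZero N] [Nonempty (Pairing N)] : Parametrization d :=
  vertexParam d N (Fin d → Pairing N)

/-- The adjacency matrix after all switches. -/
def matchingFinal (ω : (matchingParam d N).Augmented) : Matrix (Fin N) (Fin N) ℤ :=
  matchingAdjacency fun μ => matchingSwitch (ω.u μ) (ω.θ μ).1

theorem matchingFinal_resample (μ : Fin d) (ω : (matchingParam d N).Augmented) :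
    (matchingParam d N).resample μ matchingFinal ω - matchingFinal ω =
      (pairingMatrix (matchingSwitch (ω.u' μ) (ω.θ μ).1) - pairingMatrix (ω.θ μ).1) -
      (pairingMatrix (matchingSwitch (ω.u μ) (ω.θ μ).1) - pairingMatrix (ω.θ μ).1) := by
  simp only [Parametrization.resample, matchingFinal, matchingAdjacency_eq_sum]
  rw [sum_sub_sum_eq_of_eq_off {μ}]
  · simp only [Finset.sum_singleton, exchange_u_self]
    simp [Parametrization.exchange]
  · intro ν hν
    rw [exchange_u_of_ne _ (by simpa using hν)]
    rfl

/-- The two steps of each switch, with the old partners remembered, form a bijection of all pairs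
(θ, u), and every such pair is equally likely. -/
theorem matchingFinal_law :
    (matchingParam d N).prob.map matchingFinal = RegularGraphModel.matching.law N d := by
  have hr : Set.range (Subtype.val : Pairing N → Equiv.Perm (Fin N)) = perfectMatchings N :=
    Subtype.range_val
  have hprob : IsProbabilityMeasure (uniformOn (perfectMatchings N)) := by
    rw [← hr]
    exact isProbabilityMeasure_uniformOn (Set.toFinite _) (Set.range_nonempty _)
  have : IsFiniteMeasure (RegularGraphModel.matching.law N d) := by
    unfold RegularGraphModel.law; infer_instance
  refine prob_map_eq (hκ := univ_nonempty_fin) _ _ fun S => ?_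
  rw [prob_real_preimage_of_equiv (fun _ _ => rfl)
    (coordinatewise (pairLift matchingStepEquiv matchingStepEquiv)) (by simp [Supported])
    (fun θ : Fin d → Pairing N => matchingAdjacency fun μ => (θ μ).1)]
  · simp only [RegularGraphModel.law, ← hr]
    rw [pi_uniformOn_real _ Subtype.val_injective]
  · intro ω _
    rfl

/-- The event that the switch or the resampled switch degenerates. -/
def matchingBad (μ : Fin d) : Set (matchingParam d N).Augmented :=
  {ω | ¬ (MatchingGeneric (ω.θ μ).1 (ω.u μ) ∧ MatchingGeneric (ω.θ μ).1 (ω.u' μ))}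

/-- The second vertex avoids one point and the first avoids four, for the switch and for its
resampled version: `10 = 2 · (1 + 4)`. -/
theorem matchingBad_prob (μ : Fin d) : CondProbLE (matchingParam d N).prob
    ((matchingParam d N).sigmaG μ) (10 / N) (matchingBad μ) := by
  have h1 := condProbLE_of_mem (sigmaG_le_coordSnd μ)
    (uniform_snd (N := N) (Θ := Fin d → Pairing N) μ (fun _ v => v) fun _ _ _ h => h)
    (fun _ => {0}) (fun _ _ => rfl) (t := 1) (by simp)
  have h2 := condProbLE_of_mem (sigmaG_le_coordSnd' μ)
    (uniform_snd' (N := N) (Θ := Fin d → Pairing N) μ (fun _ v => v) fun _ _ _ h => h)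
    (fun _ => {0}) (fun _ _ => rfl) (t := 1) (by simp)
  have h3 := condProbLE_of_mem (sigmaG_le_coordFst μ)
    (uniform_fst (N := N) (Θ := Fin d → Pairing N) μ (fun _ v => v) fun _ _ _ h => h)
    (fun ω => {0, (ω.u μ).2, (ω.θ μ).1 0, (ω.θ μ).1 (ω.u μ).2})
    (fun _ _ => by simp [coordFst]) (t := 4) (fun _ => Finset.card_le_four)
  have h4 := condProbLE_of_mem (sigmaG_le_coordFst' μ)
    (uniform_fst' (N := N) (Θ := Fin d → Pairing N) μ (fun _ v => v) fun _ _ _ h => h)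
    (fun ω => {0, (ω.u' μ).2, (ω.θ μ).1 0, (ω.θ μ).1 (ω.u' μ).2})
    (fun _ _ => by simp [coordFst']) (t := 4) (fun _ => Finset.card_le_four)
  refine ((h1.union h2).union (h3.union h4)).subset ?_ (le_of_eq (by push_cast; ring))
  intro ω hω
  simp only [matchingBad, MatchingGeneric, Set.mem_ofPred_eq] at hω
  simp only [Set.mem_union, Set.mem_ofPred_eq, Finset.mem_singleton]
  tauto

end MatchingModel

theorem matching_hasLocalResampling {N d : ℕ} [NeZero N] (hN : Even N) :
    HasLocalResampling .matching N d (10 / N) 10 := by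
  have hne := pairing_nonempty hN
  have hinj : ∀ (μ : Fin d) (θ : Fin d → Pairing N), Function.Injective (θ μ).1 :=
    fun μ θ => (θ μ).1.injective
  refine ⟨matchingParam d N, fun μ ω => (ω.u μ).1, fun μ ω => matchingSwitch (ω.u μ) (ω.θ μ).1 0,
    matchingFinal, fun μ => ?_, fun μ => ?_, ?_, matchingFinal_law, ?_, fun μ => ⟨?_⟩⟩
  · exact measurable_sigmaF_of_factor _ fun ω ω' _ h => by beta_reduce; rw [h]
  · exact measurable_sigmaF_of_factor _ fun ω ω' h h' => by
      beta_reduce; rw [h, h']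
  · exact measurable_sigmaF_of_factor _ fun ω ω' h h' => by
      simp only [matchingFinal]; rw [h, h']
  · exact Filter.Eventually.of_forall fun ω i => rfl
  have fp := uniform_fst (N := N) (Θ := Fin d → Pairing N) μ (fun _ v => v) fun _ _ _ h => h
  have fp' := uniform_fst' (N := N) (Θ := Fin d → Pairing N) μ (fun _ v => v) fun _ _ _ h => h
  have fq := uniform_snd (N := N) (Θ := Fin d → Pairing N) μ (fun _ v => v) fun _ _ _ h => h
  have fq' := uniform_snd' (N := N) (Θ := Fin d → Pairing N) μ (fun _ v => v) fun _ _ _ h => h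
  have sp := uniform_fst (N := N) μ (fun (θ : Fin d → Pairing N) v => (θ μ).1 v) (hinj μ)
  have sp' := uniform_fst' (N := N) μ (fun (θ : Fin d → Pairing N) v => (θ μ).1 v) (hinj μ)
  have sq := uniform_snd (N := N) μ (fun (θ : Fin d → Pairing N) v => (θ μ).1 v) (hinj μ)
  have sq' := uniform_snd' (N := N) μ (fun (θ : Fin d → Pairing N) v => (θ μ).1 v) (hinj μ)
  exact
    { B := matchingBad μ
      g := Set.univ
      m := 4
      b' := fun ω => (ω.u' μ).1
      x := ![fun ω => (ω.θ μ).1 0, fun ω => (ω.u μ).2, fun ω => (ω.u' μ).2, fun ω => (ω.u μ).1]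
      y := ![fun ω => (ω.θ μ).1 (ω.u' μ).2, fun ω => (ω.θ μ).1 (ω.u μ).2,
        fun ω => (ω.θ μ).1 (ω.u' μ).1, fun ω => (ω.θ μ).1 (ω.u μ).1]
      z := ![fun ω => (ω.θ μ).1 0, fun ω => (ω.u' μ).2, fun ω => (ω.u μ).2, fun ω => (ω.u' μ).1]
      w := ![fun ω => (ω.θ μ).1 (ω.u μ).2, fun ω => (ω.θ μ).1 (ω.u' μ).2,
        fun ω => (ω.θ μ).1 (ω.u μ).1, fun ω => (ω.θ μ).1 (ω.u' μ).1]
      m_lt := by norm_num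
      prob_B := matchingBad_prob μ
      prob_g := (CondProbLE.of_null (by simp)).subset subset_rfl (by positivity)
      uniform_b := fp.mono (sigmaG_le_coordFst μ)
      uniform_b' := fp'.mono (sigmaG_le_coordFst' μ)
      uniform_xy := fun k => by
        fin_cases k
        -- The end `σ 0` is fixed by `θ`. The other end is the image of the second component of
        -- `ũ_μ`, which is free given both first components.
        · exact Or.inr (Or.inr (sq'.mono (sigmaGWith_le_coordSnd' μ id fun _ => rfl)))
        · exact Or.inl ⟨fq.mono (sigmaG_le_coordSnd μ), sq.mono (sigmaG_le_coordSnd μ)⟩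
        · exact Or.inl ⟨fq'.mono (sigmaG_le_coordSnd' μ), sp'.mono (sigmaG_le_coordFst' μ)⟩
        · exact Or.inl ⟨fp.mono (sigmaG_le_coordFst μ), sp.mono (sigmaG_le_coordFst μ)⟩
      uniform_zw := fun k => by
        fin_cases k
        · exact Or.inr (Or.inr (sq.mono (sigmaGWith_le_coordSnd μ id fun _ => rfl)))
        · exact Or.inl ⟨fq'.mono (sigmaG_le_coordSnd' μ), sq'.mono (sigmaG_le_coordSnd' μ)⟩
        · exact Or.inl ⟨fq.mono (sigmaG_le_coordSnd μ), sp.mono (sigmaG_le_coordFst μ)⟩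
        · exact Or.inl ⟨fp'.mono (sigmaG_le_coordFst' μ), sp'.mono (sigmaG_le_coordFst' μ)⟩
      difference := fun ω hω => by
        simp only [matchingBad, Set.mem_ofPred_eq, not_not] at hω
        rw [matchingFinal_resample, pairingMatrix_matchingSwitch (ω.θ μ).2 hω.1,
          pairingMatrix_matchingSwitch (ω.θ μ).2 hω.2]
        simp only [Fin.sum_univ_four, Matrix.cons_val]
        abel
      typical := fun ω hω _ => by
        simp only [matchingBad, Set.mem_ofPred_eq, not_not] at hω
        refine ⟨by simp [Parametrization.resample, exchange_u_self],
          matchingSwitch_apply_zero (ω.θ μ).2 fun h => hω.1.2 (by simp [h])⟩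
      bounded := Filter.Eventually.of_forall fun ω => by
        rw [matchingFinal_resample]
        exact ((matchingSwitch_isEdgeDifference (ω.θ μ).2 _).sub
          (matchingSwitch_isEdgeDifference (ω.θ μ).2 _)).mono (by norm_num) }

/-! ### The permutation model -/

section Permutation

variable {N : ℕ}

theorem perm_apply_inv (σ : Equiv.Perm (Fin N)) (i : Fin N) : σ (σ⁻¹ i) = i := by simp

theorem perm_inv_apply (σ : Equiv.Perm (Fin N)) (i : Fin N) : σ⁻¹ (σ i) = i := by simp

/-- The adjacency matrix of one permutation. -/
def permMatrix (σ : Equiv.Perm (Fin N)) : Matrix (Fin N) (Fin N) ℤ := ∑ i, edgeMatrix i (σ i)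

theorem permutationAdjacency_eq_sum {k : ℕ} (σ : Fin k → Equiv.Perm (Fin N)) :
    permutationAdjacency σ = ∑ μ, permMatrix (σ μ) := by
  ext i j
  simp only [permutationAdjacency, permMatrix, Matrix.of_apply, Matrix.sum_apply, edgeMatrix]
  refine Finset.sum_congr rfl fun μ _ => ?_
  rw [Finset.sum_add_distrib, Finset.sum_eq_single i, Finset.sum_eq_single j]
  · simp [eq_comm]
  · intro b _ hb; simp [hb]
  · simp
  · intro b _ hb; simp [hb]
  · simp

theorem permMatrix_inv (σ : Equiv.Perm (Fin N)) : permMatrix σ⁻¹ = permMatrix σ := by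
  rw [permMatrix, ← Equiv.sum_comp σ, permMatrix]
  refine Finset.sum_congr rfl fun i _ => ?_
  rw [edgeMatrix_comm]
  simp

variable [NeZero N]

/-- The pairs for which the switch at the edge leaving `0` involves three distinct edges. -/
def OutGeneric (σ : Equiv.Perm (Fin N)) (z : Fin N × Fin N) : Prop :=
  z.1 ≠ z.2 ∧ σ 0 ≠ z.1 ∧ σ 0 ≠ z.2

open Classical in
/-- Exchange the targets of three directed edges of `σ`, so that `0` is sent to `z.1`. -/
def outSwitch (z : Fin N × Fin N) (σ : Equiv.Perm (Fin N)) : Equiv.Perm (Fin N) :=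
  if OutGeneric σ z then Equiv.swap (σ 0) z.1 * Equiv.swap z.1 z.2 * σ else σ

variable {σ : Equiv.Perm (Fin N)} {z : Fin N × Fin N}

theorem outSwitch_zero (h : OutGeneric σ z) : outSwitch z σ 0 = z.1 := by
  simp [outSwitch, h, Equiv.swap_apply_of_ne_of_ne h.2.1 h.2.2]

theorem outSwitch_fst (h : OutGeneric σ z) : outSwitch z σ (σ⁻¹ z.1) = z.2 := by
  simp [outSwitch, h, Equiv.swap_apply_of_ne_of_ne h.2.2.symm h.1.symm]

theorem outSwitch_snd (h : OutGeneric σ z) : outSwitch z σ (σ⁻¹ z.2) = σ 0 := by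
  simp [outSwitch, h]

theorem outSwitch_of_ne {i : Fin N} (h0 : σ i ≠ σ 0) (h1 : σ i ≠ z.1) (h2 : σ i ≠ z.2) :
    outSwitch z σ i = σ i := by
  unfold outSwitch
  split_ifs
  · simp [Equiv.swap_apply_of_ne_of_ne h1 h2, Equiv.swap_apply_of_ne_of_ne h0 h1]
  · rfl

/-- The targets `σ 0`, `z.1`, `z.2` move in a cycle. With a transposition of two targets, `σ 0`
would be hit from `σ⁻¹ z.1`, a function of the new neighbour; here it is hit from `σ⁻¹ z.2`. -/
theorem permMatrix_outSwitch (h : OutGeneric σ z) :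
    permMatrix (outSwitch z σ) - permMatrix σ =
      edgeMatrix 0 z.1 + edgeMatrix (σ⁻¹ z.1) z.2 + edgeMatrix (σ⁻¹ z.2) (σ 0)
        - edgeMatrix 0 (σ 0) - edgeMatrix (σ⁻¹ z.1) z.1 - edgeMatrix (σ⁻¹ z.2) z.2 := by
  have h01 : (0 : Fin N) ≠ σ⁻¹ z.1 := fun e => h.2.1 (by rw [e]; simp)
  have h02 : (0 : Fin N) ≠ σ⁻¹ z.2 := fun e => h.2.2 (by rw [e]; simp)
  have h12 : σ⁻¹ z.1 ≠ σ⁻¹ z.2 := fun e => h.1 (σ⁻¹.injective e)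
  rw [permMatrix, permMatrix, sum_sub_sum_eq_of_eq_off {0, σ⁻¹ z.1, σ⁻¹ z.2}]
  · rw [Finset.sum_insert (by simp only [Finset.mem_insert, Finset.mem_singleton]; tauto),
      Finset.sum_insert (by simpa only [Finset.mem_singleton] using h12), Finset.sum_singleton,
      Finset.sum_insert (by simp only [Finset.mem_insert, Finset.mem_singleton]; tauto),
      Finset.sum_insert (by simpa only [Finset.mem_singleton] using h12), Finset.sum_singleton,
      outSwitch_zero h, outSwitch_fst h, outSwitch_snd h]
    simp only [perm_apply_inv]
    abel
  · intro i hi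
    simp only [Finset.mem_insert, Finset.mem_singleton, not_or] at hi
    rw [outSwitch_of_ne (fun e => hi.1 (σ.injective e)) (fun e => hi.2.1 (by simp [← e]))
      (fun e => hi.2.2 (by simp [← e]))]

theorem permMatrix_outSwitch_isEdgeDifference (σ : Equiv.Perm (Fin N)) (z : Fin N × Fin N) :
    IsEdgeDifference 3 (permMatrix (outSwitch z σ) - permMatrix σ) := by
  by_cases h : OutGeneric σ z
  · rw [permMatrix_outSwitch h]
    convert ((IsEdgeDifference.single 0 z.1 0 (σ 0)).add (IsEdgeDifference.single
      (σ⁻¹ z.1) z.2 (σ⁻¹ z.1) z.1)).add (IsEdgeDifference.single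
      (σ⁻¹ z.2) (σ 0) (σ⁻¹ z.2) z.2) using 1
    abel
  · rw [outSwitch, if_neg h, sub_self]; exact IsEdgeDifference.zero 3

/-- After the switch `0` is sent to `z.1`, and the three-cycle built from `z.1`, `σ 0`, `z.2` is the
inverse of the one applied before. -/
theorem outSwitch_outSwitch (h : OutGeneric σ z) :
    outSwitch (σ 0, z.2) (outSwitch z σ) = σ := by
  have h' : OutGeneric (outSwitch z σ) (σ 0, z.2) := by
    rw [OutGeneric, outSwitch_zero h]
    exact ⟨h.2.2, h.2.1.symm, h.1⟩
  rw [outSwitch, if_pos h', outSwitch_zero h, outSwitch, if_pos h]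
  ext i
  simp only [Equiv.Perm.coe_mul, Function.comp_apply, Equiv.swap_apply_def]
  obtain ⟨h1, h2, h3⟩ := h
  congr 1
  split_ifs <;> simp_all

open Classical in
/-- The switch at the edge leaving `0` as a bijection. -/
def outSwitchEquiv : Equiv.Perm (Equiv.Perm (Fin N) × Fin N × Fin N) :=
  Function.Involutive.toPerm
    (fun p => (outSwitch p.2 p.1, if OutGeneric p.1 p.2 then (p.1 0, p.2.2) else p.2)) fun p => by
    obtain ⟨σ, z⟩ := p
    by_cases h : OutGeneric σ z
    · have h' : OutGeneric (outSwitch z σ) (σ 0, z.2) := by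
        rw [OutGeneric, outSwitch_zero h]
        exact ⟨h.2.2, h.2.1.symm, h.1⟩
      simp [h, h', outSwitch_outSwitch h, outSwitch_zero h]
    · have : outSwitch z σ = σ := if_neg h
      simp [h, this]

/-- The pairs for which the switch at the edge entering `0` is performed. -/
def InGeneric (σ : Equiv.Perm (Fin N)) (z : Fin N × Fin N) : Prop :=
  (z.1 ≠ 0 ∧ z.2 ≠ 0 ∧ σ 0 ≠ 0) ∧ OutGeneric σ⁻¹ z

open Classical in
/-- Exchange the sources of three directed edges of `σ`, so that `z.1` is sent to `0`. -/
def inSwitch (z : Fin N × Fin N) (σ : Equiv.Perm (Fin N)) : Equiv.Perm (Fin N) :=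
  if InGeneric σ z then (outSwitch z σ⁻¹)⁻¹ else σ

theorem inv_zero_ne (h : σ 0 ≠ 0) : σ⁻¹ 0 ≠ 0 := fun e => h (by
  rw [Equiv.Perm.inv_eq_iff_eq] at e; exact e.symm)

/-- The switch moves the edges with sources `σ⁻¹ 0`, `z.1`, `z.2`. Excluding `0` from these keeps
the edge leaving `0`, so the second switch does not undo the result of the first. -/
theorem inSwitch_zero (σ : Equiv.Perm (Fin N)) (z : Fin N × Fin N) :
    inSwitch z σ 0 = σ 0 := by
  unfold inSwitch
  split_ifs with h
  · rw [Equiv.Perm.inv_eq_iff_eq, outSwitch_of_ne] <;> simp only [perm_inv_apply]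
    · exact (inv_zero_ne h.1.2.2).symm
    · exact h.1.1.symm
    · exact h.1.2.1.symm
  · rfl

theorem inSwitch_inv_zero (h : InGeneric σ z) : (inSwitch z σ)⁻¹ 0 = z.1 := by
  rw [inSwitch, if_pos h, inv_inv, outSwitch_zero h.2]

theorem permMatrix_inSwitch (h : InGeneric σ z) :
    permMatrix (inSwitch z σ) - permMatrix σ =
      edgeMatrix 0 z.1 + edgeMatrix (σ z.1) z.2 + edgeMatrix (σ z.2) (σ⁻¹ 0)
        - edgeMatrix 0 (σ⁻¹ 0) - edgeMatrix (σ z.1) z.1 - edgeMatrix (σ z.2) z.2 := by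
  rw [inSwitch, if_pos h, permMatrix_inv, ← permMatrix_inv σ, permMatrix_outSwitch h.2, inv_inv]

theorem permMatrix_inSwitch_isEdgeDifference (σ : Equiv.Perm (Fin N)) (z : Fin N × Fin N) :
    IsEdgeDifference 3 (permMatrix (inSwitch z σ) - permMatrix σ) := by
  unfold inSwitch
  split_ifs with h
  · rw [permMatrix_inv, ← permMatrix_inv σ]
    exact permMatrix_outSwitch_isEdgeDifference _ _
  · rw [sub_self]; exact IsEdgeDifference.zero 3

open Classical in
/-- The switch at the edge entering `0` as a bijection. -/
def inSwitchEquiv : Equiv.Perm (Equiv.Perm (Fin N) × Fin N × Fin N) :=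
  Function.Involutive.toPerm
    (fun p => (inSwitch p.2 p.1, if InGeneric p.1 p.2 then (p.1⁻¹ 0, p.2.2) else p.2)) fun p => by
    obtain ⟨σ, z⟩ := p
    by_cases h : InGeneric σ z
    · have e : (inSwitch z σ)⁻¹ = outSwitch z σ⁻¹ := by rw [inSwitch, if_pos h, inv_inv]
      have h' : InGeneric (inSwitch z σ) (σ⁻¹ 0, z.2) := by
        refine ⟨⟨inv_zero_ne h.1.2.2, h.1.2.1, by rw [inSwitch_zero]; exact h.1.2.2⟩, ?_⟩
        rw [OutGeneric, inSwitch_inv_zero h]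
        exact ⟨h.2.2.2, h.2.2.1.symm, h.2.1⟩
      have e' : inSwitch (σ⁻¹ 0, z.2) (inSwitch z σ) = σ := by
        rw [inSwitch, if_pos h', e, outSwitch_outSwitch h.2, inv_inv]
      simp only [if_pos h, if_pos h', e', inSwitch_inv_zero h]
    · have : inSwitch z σ = σ := if_neg h
      simp [h, this]

/-- The two switches of a permutation. -/
def permSwitch (z z' : Fin N × Fin N) (σ : Equiv.Perm (Fin N)) : Equiv.Perm (Fin N) :=
  inSwitch z' (outSwitch z σ)

theorem permSwitch_isEdgeDifference (z z' : Fin N × Fin N) (σ : Equiv.Perm (Fin N)) :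
    IsEdgeDifference 6 (permMatrix (permSwitch z z' σ) - permMatrix σ) := by
  convert (permMatrix_inSwitch_isEdgeDifference (outSwitch z σ) z').add
    (permMatrix_outSwitch_isEdgeDifference σ z) using 1
  simp [permSwitch]

/-- The conditions on `z` under which its effect on `permSwitch z z' σ` is the typical one. -/
def OutTypical (σ : Equiv.Perm (Fin N)) (z' z : Fin N × Fin N) : Prop :=
  z.1 ∉ ({0, σ 0, z.2, σ z'.1, σ z'.2} : Finset (Fin N)) ∧
    z.2 ∉ ({0, σ 0, σ z'.1, σ z'.2} : Finset (Fin N))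

theorem OutTypical.generic {z' : Fin N × Fin N} (h : OutTypical σ z' z) : OutGeneric σ z := by
  simp only [OutTypical, Finset.mem_insert, Finset.mem_singleton, not_or] at h
  exact ⟨h.1.2.2.1, h.1.2.1 ∘ Eq.symm, h.2.2.1 ∘ Eq.symm⟩

theorem OutTypical.inv_zero {z' : Fin N × Fin N} (h : OutTypical σ z' z) (h0 : σ 0 ≠ 0) :
    (outSwitch z σ)⁻¹ 0 = σ⁻¹ 0 := by
  simp only [OutTypical, Finset.mem_insert, Finset.mem_singleton, not_or] at h
  rw [Equiv.Perm.inv_eq_iff_eq, outSwitch_of_ne] <;> simp only [perm_apply_inv]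
  · exact h0.symm
  · exact fun e => h.1.1 e.symm
  · exact fun e => h.2.1 e.symm

theorem OutTypical.inv_zero' {z' : Fin N × Fin N} (h : OutTypical σ z' z) (h0 : σ 0 = 0) :
    (outSwitch z σ)⁻¹ 0 = σ⁻¹ z.2 := by
  rw [Equiv.Perm.inv_eq_iff_eq, outSwitch_snd h.generic, h0]

theorem OutTypical.apply {z' : Fin N × Fin N} (h : OutTypical σ z' z) :
    (z'.1 ≠ 0 → outSwitch z σ z'.1 = σ z'.1) ∧ (z'.2 ≠ 0 → outSwitch z σ z'.2 = σ z'.2) := by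
  simp only [OutTypical, Finset.mem_insert, Finset.mem_singleton, not_or] at h
  exact ⟨fun e => outSwitch_of_ne (fun e' => e (σ.injective e')) (fun e => h.1.2.2.2.1 e.symm)
      (fun e => h.2.2.2.1 e.symm),
    fun e => outSwitch_of_ne (fun e' => e (σ.injective e')) (fun e => h.1.2.2.2.2 e.symm)
      (fun e => h.2.2.2.2 e.symm)⟩

/-- The cases in which the first switch influences the second one. -/
def Entangled (σ : Equiv.Perm (Fin N)) (z' : Fin N × Fin N) : Prop :=
  σ 0 = 0 ∧ z'.1 ≠ 0 ∧ z'.2 ≠ 0 ∧ z'.1 ≠ z'.2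

theorem OutTypical.outSwitch_zero_ne {z' : Fin N × Fin N} (h : OutTypical σ z' z) :
    outSwitch z σ 0 ≠ 0 := by
  rw [outSwitch_zero h.generic]
  exact fun e => h.1 (by simp [e])

open Classical in
-- If `σ 0 ≠ 0`, typical first switches do not touch the edges seen by the second one, whose effect
-- cancels. If `σ` has a loop at `0`, the first switch opens it and makes `σ⁻¹ z.2` the new preimage
-- of `0`. The second switch, if performed, then depends on `z.2`, which leaves four extra edges.
theorem permMatrix_inSwitch_outSwitch {z' w : Fin N × Fin N} (h : OutTypical σ z' z)
    (hw : OutTypical σ z' w) :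
    (permMatrix (inSwitch z' (outSwitch w σ)) - permMatrix (outSwitch w σ)) -
      (permMatrix (inSwitch z' (outSwitch z σ)) - permMatrix (outSwitch z σ)) =
    if Entangled σ z' then
      edgeMatrix (σ z'.2) (σ⁻¹ w.2) - edgeMatrix (σ z'.2) (σ⁻¹ z.2) +
        (edgeMatrix 0 (σ⁻¹ z.2) - edgeMatrix 0 (σ⁻¹ w.2))
    else 0 := by
  have key : ∀ v, OutTypical σ z' v → (InGeneric (outSwitch v σ) z' ↔
      (z'.1 ≠ 0 ∧ z'.2 ≠ 0 ∧ z'.1 ≠ z'.2) ∧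
        (outSwitch v σ)⁻¹ 0 ≠ z'.1 ∧ (outSwitch v σ)⁻¹ 0 ≠ z'.2) := fun v hv => by
    have := hv.outSwitch_zero_ne
    simp only [InGeneric, OutGeneric]
    tauto
  have hnot : ∀ v, ¬ InGeneric (outSwitch v σ) z' →
      permMatrix (inSwitch z' (outSwitch v σ)) - permMatrix (outSwitch v σ) = 0 := fun v hv => by
    rw [inSwitch, if_neg hv, sub_self]
  by_cases h0 : σ 0 = 0
  · have hne : ∀ v, OutTypical σ z' v →
        (outSwitch v σ)⁻¹ 0 ≠ z'.1 ∧ (outSwitch v σ)⁻¹ 0 ≠ z'.2 := fun v hv => by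
      rw [hv.inv_zero' h0]
      simp only [OutTypical, Finset.mem_insert, Finset.mem_singleton, not_or] at hv
      exact ⟨fun e => hv.2.2.2.1 (by simp [← e]), fun e => hv.2.2.2.2 (by simp [← e])⟩
    by_cases hE : Entangled σ z'
    · rw [if_pos hE, permMatrix_inSwitch ((key w hw).2 ⟨hE.2, hne w hw⟩),
        permMatrix_inSwitch ((key z h).2 ⟨hE.2, hne z h⟩), h.inv_zero' h0, hw.inv_zero' h0,
        h.apply.1 hE.2.1, hw.apply.1 hE.2.1, h.apply.2 hE.2.2.1, hw.apply.2 hE.2.2.1]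
      abel
    · rw [if_neg hE, hnot w fun h' => hE ⟨h0, ((key w hw).1 h').1⟩,
        hnot z fun h' => hE ⟨h0, ((key z h).1 h').1⟩, sub_self]
  · rw [if_neg fun hE => h0 hE.1]
    have hc := h.inv_zero h0
    have hc' := hw.inv_zero h0
    have hiff : InGeneric (outSwitch w σ) z' ↔ InGeneric (outSwitch z σ) z' := by
      rw [key w hw, key z h, hc, hc']
    by_cases hg : InGeneric (outSwitch z σ) z'
    · have h1 := ((key z h).1 hg).1
      rw [permMatrix_inSwitch hg, permMatrix_inSwitch (hiff.2 hg), hc, hc',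
        h.apply.1 h1.1, hw.apply.1 h1.1, h.apply.2 h1.2.1, hw.apply.2 h1.2.1, sub_self]
    · rw [hnot z hg, hnot w fun h' => hg (hiff.1 h'), sub_self]

end Permutation

/-! ### Law of the permutation model, and resampling of outgoing edges -/

section PermutationModel

variable {N k : ℕ} [NeZero N]

/-- The parametrization of the permutation model; the slots `i` and `k + i` belong to the `i`-th
permutation. -/
abbrev permutationParam (k N : ℕ) [NeZero N] : Parametrization (k + k) :=
  vertexParam (k + k) N (Fin k → Equiv.Perm (Fin N))

/-- The permutations after all switches. -/
def permutationFinal (ω : (permutationParam k N).Augmented) (i : Fin k) : Equiv.Perm (Fin N) :=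
  permSwitch (ω.u (Fin.castAdd k i)) (ω.u (Fin.natAdd k i)) (ω.θ i)

theorem castAdd_ne_natAdd (i j : Fin k) : Fin.castAdd k i ≠ Fin.natAdd k j := fun h => by
  have := congr_arg Fin.val h
  simp only [Fin.val_castAdd, Fin.val_natAdd] at this
  omega

theorem permutationFinal_resample_castAdd (i : Fin k) (ω : (permutationParam k N).Augmented) :
    (permutationParam k N).resample (Fin.castAdd k i)
        (fun ω => permutationAdjacency (permutationFinal ω)) ω -
        permutationAdjacency (permutationFinal ω) =
      permMatrix (permSwitch (ω.u' (Fin.castAdd k i)) (ω.u (Fin.natAdd k i)) (ω.θ i)) -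
      permMatrix (permSwitch (ω.u (Fin.castAdd k i)) (ω.u (Fin.natAdd k i)) (ω.θ i)) := by
  simp only [Parametrization.resample, permutationAdjacency_eq_sum, permutationFinal]
  rw [sum_sub_sum_eq_of_eq_off {i}]
  · simp only [Finset.sum_singleton, exchange_u_self,
      exchange_u_of_ne _ (castAdd_ne_natAdd i i).symm]
    rfl
  · intro j hj
    rw [exchange_u_of_ne _ (castAdd_ne_natAdd i j).symm, exchange_u_of_ne]
    · rfl
    · simpa using hj

theorem permutationFinal_resample_natAdd (i : Fin k) (ω : (permutationParam k N).Augmented) :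
    (permutationParam k N).resample (Fin.natAdd k i)
        (fun ω => permutationAdjacency (permutationFinal ω)) ω -
        permutationAdjacency (permutationFinal ω) =
      permMatrix (permSwitch (ω.u (Fin.castAdd k i)) (ω.u' (Fin.natAdd k i)) (ω.θ i)) -
      permMatrix (permSwitch (ω.u (Fin.castAdd k i)) (ω.u (Fin.natAdd k i)) (ω.θ i)) := by
  simp only [Parametrization.resample, permutationAdjacency_eq_sum, permutationFinal]
  rw [sum_sub_sum_eq_of_eq_off {i}]
  · simp only [Finset.sum_singleton, exchange_u_self,
      exchange_u_of_ne _ (castAdd_ne_natAdd i i)]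
    rfl
  · intro j hj
    rw [exchange_u_of_ne _ (castAdd_ne_natAdd j i), exchange_u_of_ne]
    · rfl
    · simpa using hj

/-- Group the two slots of each permutation. -/
def slotEquiv (k : ℕ) (W : Type) : (Fin (k + k) → W) ≃ (Fin k → W × W) where
  -- The slot of the outgoing edge comes second because `pairLift` acts on the second component
  -- first.
  toFun u i := (u (Fin.natAdd k i), u (Fin.castAdd k i))
  invFun f := Fin.append (fun i => (f i).2) (fun i => (f i).1)
  left_inv u := by
    funext μ
    refine Fin.addCases (fun i => ?_) (fun i => ?_) μ <;> simp [-Fin.natAdd_eq_addNat]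
  right_inv f := by
    funext i
    simp [-Fin.natAdd_eq_addNat]

/-- All switches as a bijection. -/
def permutationEquiv (k N : ℕ) [NeZero N] : Equiv.Perm
    ((Fin k → Equiv.Perm (Fin N)) × (Fin (k + k) → Fin N × Fin N)) :=
  ((Equiv.refl _).prodCongr (slotEquiv k _)).trans
    ((coordinatewise (pairLift outSwitchEquiv inSwitchEquiv)).trans
      ((Equiv.refl _).prodCongr (slotEquiv k _).symm))

theorem permutationFinal_law : (permutationParam k N).prob.map
      (fun ω => permutationAdjacency (permutationFinal ω)) =
    RegularGraphModel.permutation.law N (k + k) := by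
  have hr : Set.range (id : Equiv.Perm (Fin N) → Equiv.Perm (Fin N)) = Set.univ := Set.range_id
  have hlaw : RegularGraphModel.permutation.law N (k + k) =
      (Measure.pi fun _ : Fin k => uniformOn (Set.range (id : Equiv.Perm (Fin N) →
        Equiv.Perm (Fin N)))).map permutationAdjacency := by
    have h2 : (k + k) / 2 = k := by omega
    simp only [RegularGraphModel.law, hr]
    rw [h2]
  have hprob : IsProbabilityMeasure (uniformOn (Set.range (id : Equiv.Perm (Fin N) →
      Equiv.Perm (Fin N)))) :=
    isProbabilityMeasure_uniformOn (Set.toFinite _) (Set.range_nonempty _)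
  have : IsFiniteMeasure (RegularGraphModel.permutation.law N (k + k)) := by
    rw [hlaw]; infer_instance
  refine prob_map_eq (hκ := univ_nonempty_fin) _ _ fun S => ?_
  rw [prob_real_preimage_of_equiv (fun _ _ => rfl) (permutationEquiv k N) (by simp [Supported])
    (fun θ : Fin k → Equiv.Perm (Fin N) => permutationAdjacency θ)]
  · rw [hlaw, pi_uniformOn_real _ Function.injective_id]
    rfl
  · intro ω _
    rfl

/-! #### Resampling the edge that leaves the vertex `0` -/

/-- The event that the switch or the resampled switch at the edge leaving `0` is not typical. -/
def outBad (i : Fin k) : Set (permutationParam k N).Augmented :=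
  {ω | ¬ (OutTypical (ω.θ i) (ω.u (Fin.natAdd k i)) (ω.u (Fin.castAdd k i)) ∧
    OutTypical (ω.θ i) (ω.u (Fin.natAdd k i)) (ω.u' (Fin.castAdd k i)))}

/-- Four forbidden values for the second vertex and five for the first, in both versions: `18 = 2 ·
(4 + 5)`. -/
theorem outBad_prob (i : Fin k) : CondProbLE (permutationParam k N).prob
    ((permutationParam k N).sigmaG (Fin.castAdd k i)) (18 / N) (outBad i) := by
  set μ := Fin.castAdd k i with hμ
  have hne : Fin.natAdd k i ≠ μ := (castAdd_ne_natAdd i i).symm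
  have h1 := condProbLE_of_mem (sigmaG_le_coordSnd μ)
    (uniform_snd (N := N) (Θ := Fin k → Equiv.Perm (Fin N)) μ (fun _ v => v) fun _ _ _ h => h)
    (fun ω => {0, ω.θ i 0, ω.θ i (ω.u (Fin.natAdd k i)).1, ω.θ i (ω.u (Fin.natAdd k i)).2})
    (fun _ _ => by simp [coordSnd, hne, -Fin.natAdd_eq_addNat]) (t := 4)
    (fun _ => Finset.card_le_four)
  have h2 := condProbLE_of_mem (sigmaG_le_coordSnd' μ)
    (uniform_snd' (N := N) (Θ := Fin k → Equiv.Perm (Fin N)) μ (fun _ v => v) fun _ _ _ h => h)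
    (fun ω => {0, ω.θ i 0, ω.θ i (ω.u (Fin.natAdd k i)).1, ω.θ i (ω.u (Fin.natAdd k i)).2})
    (fun _ _ => by simp [coordSnd']) (t := 4) (fun _ => Finset.card_le_four)
  have h3 := condProbLE_of_mem (sigmaG_le_coordFst μ)
    (uniform_fst (N := N) (Θ := Fin k → Equiv.Perm (Fin N)) μ (fun _ v => v) fun _ _ _ h => h)
    (fun ω => {0, ω.θ i 0, (ω.u μ).2, ω.θ i (ω.u (Fin.natAdd k i)).1,
      ω.θ i (ω.u (Fin.natAdd k i)).2})
    (fun _ _ => by simp [coordFst, hne, -Fin.natAdd_eq_addNat]) (t := 5)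
    (fun _ => Finset.card_le_five)
  have h4 := condProbLE_of_mem (sigmaG_le_coordFst' μ)
    (uniform_fst' (N := N) (Θ := Fin k → Equiv.Perm (Fin N)) μ (fun _ v => v) fun _ _ _ h => h)
    (fun ω => {0, ω.θ i 0, (ω.u' μ).2, ω.θ i (ω.u (Fin.natAdd k i)).1,
      ω.θ i (ω.u (Fin.natAdd k i)).2})
    (fun _ _ => by simp [coordFst']) (t := 5) (fun _ => Finset.card_le_five)
  refine ((h1.union h2).union (h3.union h4)).subset ?_ (le_of_eq (by push_cast; ring))
  intro ω hω
  simp only [outBad, OutTypical, Set.mem_ofPred_eq] at hω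
  simp only [Set.mem_union, Set.mem_ofPred_eq]
  tauto

open Classical in
-- The entangled contribution is written with a case distinction inside the vertices, so that the
-- number of edges is deterministic: in the other case the last two pairs cancel.
theorem permMatrix_permSwitch_sub {σ : Equiv.Perm (Fin N)} {z w z' : Fin N × Fin N}
    (h : OutTypical σ z' z) (hw : OutTypical σ z' w) :
    permMatrix (permSwitch w z' σ) - permMatrix (permSwitch z z' σ) =
      (edgeMatrix 0 w.1 - edgeMatrix 0 z.1) +
      ((edgeMatrix (σ⁻¹ w.1) w.2 - edgeMatrix (σ⁻¹ z.1) z.2) +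
      (edgeMatrix (σ⁻¹ w.2) (σ 0) - edgeMatrix (σ⁻¹ z.2) (σ 0)) +
      (edgeMatrix (σ⁻¹ z.1) z.1 - edgeMatrix (σ⁻¹ w.1) w.1) +
      (edgeMatrix (σ⁻¹ z.2) z.2 - edgeMatrix (σ⁻¹ w.2) w.2) +
      (edgeMatrix (σ z'.2) (if Entangled σ z' then σ⁻¹ w.2 else σ⁻¹ z.2) -
        edgeMatrix (σ z'.2) (σ⁻¹ z.2)) +
      (edgeMatrix 0 (σ⁻¹ z.2) -
        edgeMatrix 0 (if Entangled σ z' then σ⁻¹ w.2 else σ⁻¹ z.2))) := by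
  have h1 := permMatrix_outSwitch h.generic
  have h2 := permMatrix_outSwitch hw.generic
  have h3 := permMatrix_inSwitch_outSwitch h hw
  have : permMatrix (permSwitch w z' σ) - permMatrix (permSwitch z z' σ) =
      (permMatrix (outSwitch w σ) - permMatrix σ) - (permMatrix (outSwitch z σ) - permMatrix σ) +
      ((permMatrix (inSwitch z' (outSwitch w σ)) - permMatrix (outSwitch w σ)) -
        (permMatrix (inSwitch z' (outSwitch z σ)) - permMatrix (outSwitch z σ))) := by
    unfold permSwitch
    abel
  rw [this, h1, h2, h3]
  split_ifs <;> abel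

/-- The vertex of slot `μ` that the resampling makes a neighbour of `0`. -/
def permutationNeighbour (μ : Fin (k + k)) (ω : (permutationParam k N).Augmented) : Fin N :=
  Fin.addCases (fun i => permutationFinal ω i 0) (fun i => (permutationFinal ω i)⁻¹ 0) μ

open Classical in
theorem permutation_localResampling_castAdd (i : Fin k) : Nonempty (LocalResampling
    (permutationParam k N) (fun ω => permutationAdjacency (permutationFinal ω))
    (fun ω => (ω.u (Fin.castAdd k i)).1) (permutationNeighbour (Fin.castAdd k i))
    (Fin.castAdd k i) (18 / N) 20) := by
  set μ := Fin.castAdd k i with hμ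
  have hinj : ∀ θ : Fin k → Equiv.Perm (Fin N), Function.Injective (θ i) := fun θ => (θ i).injective
  have hinj' : ∀ θ : Fin k → Equiv.Perm (Fin N), Function.Injective ⇑(θ i)⁻¹ :=
    fun θ => (θ i)⁻¹.injective
  have fp := uniform_fst (N := N) (Θ := Fin k → Equiv.Perm (Fin N)) μ (fun _ v => v)
    fun _ _ _ h => h
  have fp' := uniform_fst' (N := N) (Θ := Fin k → Equiv.Perm (Fin N)) μ (fun _ v => v)
    fun _ _ _ h => h
  have fq := uniform_snd (N := N) (Θ := Fin k → Equiv.Perm (Fin N)) μ (fun _ v => v)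
    fun _ _ _ h => h
  have fq' := uniform_snd' (N := N) (Θ := Fin k → Equiv.Perm (Fin N)) μ (fun _ v => v)
    fun _ _ _ h => h
  have sp := uniform_fst (N := N) μ (fun (θ : Fin k → Equiv.Perm (Fin N)) v => (θ i)⁻¹ v) hinj'
  have sp' := uniform_fst' (N := N) μ (fun (θ : Fin k → Equiv.Perm (Fin N)) v => (θ i)⁻¹ v) hinj'
  have sq := (uniform_snd (N := N) μ (fun (θ : Fin k → Equiv.Perm (Fin N)) v => (θ i)⁻¹ v)
    hinj').mono (sigmaGWith_le_coordSnd μ (b := fun ω => (ω.u μ).1) id fun _ => rfl)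
  have sq' := (uniform_snd' (N := N) μ (fun (θ : Fin k → Equiv.Perm (Fin N)) v => (θ i)⁻¹ v)
    hinj').mono (sigmaGWith_le_coordSnd' μ (b := fun ω => (ω.u μ).1) id fun _ => rfl)
  have hle : (permutationParam k N).sigmaG μ ≤
      sigmaGWith (permutationParam k N) μ (fun ω => (ω.u μ).1) :=
    le_sup_of_le_left le_sup_left
  have hE : MeasurableSet[(permutationParam k N).sigmaG μ]
      {ω : (permutationParam k N).Augmented | Entangled (ω.θ i) (ω.u (Fin.natAdd k i))} :=
    measurableSet_sigmaG_of_factor _ fun ω ω' h h' hω => by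
      rw [Set.mem_ofPred_eq, ← h, ← h' _ (castAdd_ne_natAdd i i).symm]
      exact hω
  -- Entanglement is decided by `𝒢_μ`, so the vertex chosen according to it is still uniform.
  have hq := sq'.ite sq (hle _ hE)
  exact ⟨
    { B := outBad i
      g := Set.univ
      m := 6
      b' := fun ω => (ω.u' μ).1
      x := ![fun ω => (ω.θ i)⁻¹ (ω.u' μ).1, fun ω => (ω.θ i)⁻¹ (ω.u' μ).2,
        fun ω => (ω.θ i)⁻¹ (ω.u μ).1, fun ω => (ω.θ i)⁻¹ (ω.u μ).2,
        fun ω => ω.θ i (ω.u (Fin.natAdd k i)).2, fun ω => 0]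
      y := ![fun ω => (ω.u' μ).2, fun ω => ω.θ i 0, fun ω => (ω.u μ).1, fun ω => (ω.u μ).2,
        fun ω => if Entangled (ω.θ i) (ω.u (Fin.natAdd k i)) then (ω.θ i)⁻¹ (ω.u' μ).2
          else (ω.θ i)⁻¹ (ω.u μ).2, fun ω => (ω.θ i)⁻¹ (ω.u μ).2]
      z := ![fun ω => (ω.θ i)⁻¹ (ω.u μ).1, fun ω => (ω.θ i)⁻¹ (ω.u μ).2,
        fun ω => (ω.θ i)⁻¹ (ω.u' μ).1, fun ω => (ω.θ i)⁻¹ (ω.u' μ).2,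
        fun ω => ω.θ i (ω.u (Fin.natAdd k i)).2, fun ω => 0]
      w := ![fun ω => (ω.u μ).2, fun ω => ω.θ i 0, fun ω => (ω.u' μ).1, fun ω => (ω.u' μ).2,
        fun ω => (ω.θ i)⁻¹ (ω.u μ).2,
        fun ω => if Entangled (ω.θ i) (ω.u (Fin.natAdd k i)) then (ω.θ i)⁻¹ (ω.u' μ).2
          else (ω.θ i)⁻¹ (ω.u μ).2]
      m_lt := by norm_num
      prob_B := outBad_prob i
      prob_g := (CondProbLE.of_null (by simp)).subset subset_rfl (by positivity)
      uniform_b := fp.mono (sigmaG_le_coordFst μ)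
      uniform_b' := fp'.mono (sigmaG_le_coordFst' μ)
      uniform_xy := fun j => by
        fin_cases j
        · exact Or.inl ⟨sp'.mono (sigmaG_le_coordFst' μ), fq'.mono (sigmaG_le_coordSnd' μ)⟩
        · exact Or.inr (Or.inl sq')
        · exact Or.inl ⟨sp.mono (sigmaG_le_coordFst μ), fp.mono (sigmaG_le_coordFst μ)⟩
        · exact Or.inl ⟨sq.mono hle, fq.mono (sigmaG_le_coordSnd μ)⟩
        · exact Or.inr (Or.inr hq)
        · exact Or.inr (Or.inr sq)
      uniform_zw := fun j => by
        fin_cases j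
        · exact Or.inl ⟨sp.mono (sigmaG_le_coordFst μ), fq.mono (sigmaG_le_coordSnd μ)⟩
        · exact Or.inr (Or.inl sq)
        · exact Or.inl ⟨sp'.mono (sigmaG_le_coordFst' μ), fp'.mono (sigmaG_le_coordFst' μ)⟩
        · exact Or.inl ⟨sq'.mono hle, fq'.mono (sigmaG_le_coordSnd' μ)⟩
        · exact Or.inr (Or.inr sq)
        · exact Or.inr (Or.inr hq)
      difference := fun ω hω => by
        simp only [outBad, Set.mem_ofPred_eq, not_not] at hω
        rw [permutationFinal_resample_castAdd, permMatrix_permSwitch_sub hω.1 hω.2]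
        simp only [Fin.sum_univ_six, Matrix.cons_val]
        rfl
      typical := fun ω hω _ => by
        simp only [outBad, Set.mem_ofPred_eq, not_not] at hω
        refine ⟨by simp [Parametrization.resample, exchange_u_self], ?_⟩
        rw [permutationNeighbour, hμ, Fin.addCases_left, permutationFinal, permSwitch,
          inSwitch_zero, outSwitch_zero hω.1.generic]
      bounded := Filter.Eventually.of_forall fun ω => by
        rw [permutationFinal_resample_castAdd, ← sub_sub_sub_cancel_right _ _ (permMatrix (ω.θ i))]
        exact ((permSwitch_isEdgeDifference _ _ _).sub
          (permSwitch_isEdgeDifference _ _ _)).mono (by norm_num) }⟩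

end PermutationModel

/-! ### Resampling of incoming edges and conclusion for the permutation model -/

section PermutationModelIn

variable {N k : ℕ} [NeZero N]

/-! #### Resampling the edge that enters the vertex `0` -/

/-- The conditions on `z` under which the switch of `ρ` at the edge entering `0` involves three
distinct edges off the vertex `0`. -/
def InTypical (ρ : Equiv.Perm (Fin N)) (z : Fin N × Fin N) : Prop :=
  z.1 ∉ ({0, ρ⁻¹ 0, z.2} : Finset (Fin N)) ∧ z.2 ∉ ({0, ρ⁻¹ 0} : Finset (Fin N))

theorem InTypical.generic {ρ : Equiv.Perm (Fin N)} {z : Fin N × Fin N} (h : InTypical ρ z)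
    (h0 : ρ 0 ≠ 0) : InGeneric ρ z := by
  simp only [InTypical, Finset.mem_insert, Finset.mem_singleton, not_or] at h
  exact ⟨⟨h.1.1, h.2.1, h0⟩, h.1.2.2, fun e => h.1.2.1 e.symm, fun e => h.2.2 e.symm⟩

/-- The permutation `i` after its first switch. -/
def permutationMiddle (i : Fin k) (ω : (permutationParam k N).Augmented) : Equiv.Perm (Fin N) :=
  outSwitch (ω.u (Fin.castAdd k i)) (ω.θ i)

/-- The event that the switch or the resampled switch at the edge entering `0` is not typical. -/
def inBad (i : Fin k) : Set (permutationParam k N).Augmented :=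
  {ω | ¬ (InTypical (permutationMiddle i ω) (ω.u (Fin.natAdd k i)) ∧
    InTypical (permutationMiddle i ω) (ω.u' (Fin.natAdd k i)))}

/-- The union bound gives `2 · (2 + 3) = 10` forbidden values; `18` is taken to match the outgoing
edges. -/
theorem inBad_prob (i : Fin k) : CondProbLE (permutationParam k N).prob
    ((permutationParam k N).sigmaG (Fin.natAdd k i)) (18 / N) (inBad i) := by
  set μ := Fin.natAdd k i with hμ
  have hne : Fin.castAdd k i ≠ μ := castAdd_ne_natAdd i i
  have h1 := condProbLE_of_mem (sigmaG_le_coordSnd μ)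
    (uniform_snd (N := N) (Θ := Fin k → Equiv.Perm (Fin N)) μ (fun _ v => v) fun _ _ _ h => h)
    (fun ω => {0, (permutationMiddle i ω)⁻¹ 0})
    (fun _ _ => by simp [coordSnd, permutationMiddle, hne]) (t := 2) (fun _ => Finset.card_le_two)
  have h2 := condProbLE_of_mem (sigmaG_le_coordSnd' μ)
    (uniform_snd' (N := N) (Θ := Fin k → Equiv.Perm (Fin N)) μ (fun _ v => v) fun _ _ _ h => h)
    (fun ω => {0, (permutationMiddle i ω)⁻¹ 0})
    (fun _ _ => by simp [coordSnd', permutationMiddle]) (t := 2) (fun _ => Finset.card_le_two)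
  have h3 := condProbLE_of_mem (sigmaG_le_coordFst μ)
    (uniform_fst (N := N) (Θ := Fin k → Equiv.Perm (Fin N)) μ (fun _ v => v) fun _ _ _ h => h)
    (fun ω => {0, (permutationMiddle i ω)⁻¹ 0, (ω.u μ).2})
    (fun _ _ => by simp [coordFst, permutationMiddle, hne]) (t := 3)
    (fun _ => Finset.card_le_three)
  have h4 := condProbLE_of_mem (sigmaG_le_coordFst' μ)
    (uniform_fst' (N := N) (Θ := Fin k → Equiv.Perm (Fin N)) μ (fun _ v => v) fun _ _ _ h => h)
    (fun ω => {0, (permutationMiddle i ω)⁻¹ 0, (ω.u' μ).2})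
    (fun _ _ => by simp [coordFst', permutationMiddle]) (t := 3) (fun _ => Finset.card_le_three)
  refine ((h1.union h2).union (h3.union h4)).subset ?_ ?_
  · intro ω hω
    simp only [inBad, InTypical, Set.mem_ofPred_eq] at hω
    simp only [Set.mem_union, Set.mem_ofPred_eq]
    tauto
  · rw [← add_div, ← add_div, ← add_div]
    exact div_le_div_of_nonneg_right (by norm_num) (Nat.cast_nonneg N)

/-- A typical first switch sends `0` to `z.1`, which is not `0`. A loop at `0` after the first
switch is therefore rare given `ℱ_0`, although it is determined by `𝒢_μ` for the incoming slot. -/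
theorem outBad_sigmaF_prob (i : Fin k) : CondProbLE (permutationParam k N).prob
    ((permutationParam k N).sigmaF 0) (18 / N)
    {ω : (permutationParam k N).Augmented | permutationMiddle i ω 0 = 0} := by
  refine ((outBad_prob i).mono (sigmaF_zero_le_sigmaG _ _)).subset (fun ω hω => ?_) le_rfl
  intro h
  exact h.1.outSwitch_zero_ne hω

open Classical in
theorem permutation_localResampling_natAdd (i : Fin k) : Nonempty (LocalResampling
    (permutationParam k N) (fun ω => permutationAdjacency (permutationFinal ω))
    (fun ω => (ω.u (Fin.natAdd k i)).1) (permutationNeighbour (Fin.natAdd k i))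
    (Fin.natAdd k i) (18 / N) 20) := by
  set μ := Fin.natAdd k i with hμ
  have hne : Fin.castAdd k i ≠ μ := castAdd_ne_natAdd i i
  have fp := uniform_fst (N := N) (Θ := Fin k → Equiv.Perm (Fin N)) μ (fun _ v => v)
    fun _ _ _ h => h
  have fp' := uniform_fst' (N := N) (Θ := Fin k → Equiv.Perm (Fin N)) μ (fun _ v => v)
    fun _ _ _ h => h
  have fq := uniform_snd (N := N) (Θ := Fin k → Equiv.Perm (Fin N)) μ (fun _ v => v)
    fun _ _ _ h => h
  have fq' := uniform_snd' (N := N) (Θ := Fin k → Equiv.Perm (Fin N)) μ (fun _ v => v)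
    fun _ _ _ h => h
  have sp : CondUniform (permutationParam k N).prob
      (invSigma (coordFst univ_nonempty_fin μ).put)
      (fun ω => permutationMiddle i ω (ω.u μ).1) := vertexParam_condUniform _ fun ω v v' h => by
    simpa [permutationMiddle, coordFst, hne] using h
  have sp' : CondUniform (permutationParam k N).prob
      (invSigma (coordFst' univ_nonempty_fin μ).put)
      (fun ω => permutationMiddle i ω (ω.u' μ).1) := vertexParam_condUniform _ fun ω v v' h => by
    simpa [permutationMiddle, coordFst'] using h
  have sq : CondUniform (permutationParam k N).prob
      (invSigma (coordSnd univ_nonempty_fin μ).put)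
      (fun ω => permutationMiddle i ω (ω.u μ).2) := vertexParam_condUniform _ fun ω v v' h => by
    simpa [permutationMiddle, coordSnd, hne] using h
  have sq' : CondUniform (permutationParam k N).prob
      (invSigma (coordSnd' univ_nonempty_fin μ).put)
      (fun ω => permutationMiddle i ω (ω.u' μ).2) := vertexParam_condUniform _ fun ω v v' h => by
    simpa [permutationMiddle, coordSnd'] using h
  have tq := sq.mono (sigmaGWith_le_coordSnd μ (b := fun ω => (ω.u μ).1) id fun _ => rfl)
  have tq' := sq'.mono (sigmaGWith_le_coordSnd' μ (b := fun ω => (ω.u μ).1) id fun _ => rfl)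
  have hle : (permutationParam k N).sigmaG μ ≤
      sigmaGWith (permutationParam k N) μ (fun ω => (ω.u μ).1) :=
    le_sup_of_le_left le_sup_left
  obtain ⟨E, hmem⟩ : ∃ E : Set (permutationParam k N).Augmented,
      ∀ ω, ω ∈ E ↔ permutationMiddle i ω 0 ≠ 0 :=
    ⟨{ω | permutationMiddle i ω 0 ≠ 0}, fun _ => Iff.rfl⟩
  have hE : MeasurableSet[(permutationParam k N).sigmaG μ] E :=
    measurableSet_sigmaG_of_factor _ fun ω ω' h h' hω => by
      rw [hmem, permutationMiddle] at hω ⊢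
      rw [← h, ← h' _ hne]
      exact hω
  -- If the middle permutation fixes `0`, no second switch takes place and `A` does not react to
  -- resampling. The resampled vertices are then replaced by the original ones, so that all terms
  -- cancel; the choice is `𝒢_μ`-measurable and keeps uniformity.
  have hp := (fp'.mono (sigmaG_le_coordFst' μ)).ite (fp.mono (sigmaG_le_coordFst μ)) hE
  have hq := (fq'.mono (sigmaG_le_coordSnd' μ)).ite (fq.mono (sigmaG_le_coordSnd μ)) hE
  have hsp := (sp'.mono (sigmaG_le_coordFst' μ)).ite (sp.mono (sigmaG_le_coordFst μ)) hE
  have hsq := (sq'.mono (sigmaG_le_coordSnd' μ)).ite (sq.mono (sigmaG_le_coordSnd μ)) hE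
  have htq := tq'.ite tq (hle _ hE)
  exact ⟨
    { B := inBad i
      g := E
      m := 4
      b' := fun ω => if ω ∈ E then (ω.u' μ).1 else (ω.u μ).1
      x := ![fun ω => if ω ∈ E then permutationMiddle i ω (ω.u' μ).1
          else permutationMiddle i ω (ω.u μ).1,
        fun ω => if ω ∈ E then permutationMiddle i ω (ω.u' μ).2
          else permutationMiddle i ω (ω.u μ).2,
        fun ω => permutationMiddle i ω (ω.u μ).1, fun ω => permutationMiddle i ω (ω.u μ).2]
      y := ![fun ω => if ω ∈ E then (ω.u' μ).2 else (ω.u μ).2,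
        fun ω => (permutationMiddle i ω)⁻¹ 0, fun ω => (ω.u μ).1, fun ω => (ω.u μ).2]
      z := ![fun ω => permutationMiddle i ω (ω.u μ).1, fun ω => permutationMiddle i ω (ω.u μ).2,
        fun ω => if ω ∈ E then permutationMiddle i ω (ω.u' μ).1
          else permutationMiddle i ω (ω.u μ).1,
        fun ω => if ω ∈ E then permutationMiddle i ω (ω.u' μ).2
          else permutationMiddle i ω (ω.u μ).2]
      w := ![fun ω => (ω.u μ).2, fun ω => (permutationMiddle i ω)⁻¹ 0,
        fun ω => if ω ∈ E then (ω.u' μ).1 else (ω.u μ).1,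
        fun ω => if ω ∈ E then (ω.u' μ).2 else (ω.u μ).2]
      m_lt := by norm_num
      prob_B := inBad_prob i
      prob_g := (outBad_sigmaF_prob i).subset (by simp [hmem, Set.subset_def]) le_rfl
      uniform_b := fp.mono (sigmaG_le_coordFst μ)
      uniform_b' := hp
      uniform_xy := fun j => by
        fin_cases j
        · exact Or.inl ⟨hsp, hq⟩
        · exact Or.inr (Or.inl htq)
        · exact Or.inl ⟨sp.mono (sigmaG_le_coordFst μ), fp.mono (sigmaG_le_coordFst μ)⟩
        · exact Or.inl ⟨sq.mono (sigmaG_le_coordSnd μ), fq.mono (sigmaG_le_coordSnd μ)⟩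
      uniform_zw := fun j => by
        fin_cases j
        · exact Or.inl ⟨sp.mono (sigmaG_le_coordFst μ), fq.mono (sigmaG_le_coordSnd μ)⟩
        · exact Or.inr (Or.inl tq)
        · exact Or.inl ⟨hsp, hp⟩
        · exact Or.inl ⟨hsq, hq⟩
      difference := fun ω hω => by
        simp only [inBad, Set.mem_ofPred_eq, not_not] at hω
        rw [permutationFinal_resample_natAdd, permSwitch, permSwitch]
        simp only [Fin.sum_univ_four, Matrix.cons_val]
        by_cases hωE : ω ∈ E
        · have h1 := permMatrix_inSwitch (hω.1.generic ((hmem ω).1 hωE))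
          have h2 := permMatrix_inSwitch (hω.2.generic ((hmem ω).1 hωE))
          simp only [if_pos hωE]
          rw [← sub_sub_sub_cancel_right _ _ (permMatrix (permutationMiddle i ω)),
            permutationMiddle]
          rw [permutationMiddle] at h1 h2
          rw [h1, h2]
          abel
        · have h0 : ∀ z, inSwitch z (permutationMiddle i ω) = permutationMiddle i ω := fun z =>
            if_neg fun h => hωE ((hmem ω).2 h.1.2.2)
          simp only [if_neg hωE]
          rw [permutationMiddle] at h0 ⊢
          rw [h0, h0]
          abel
      typical := fun ω hω hωE => by
        simp only [inBad, Set.mem_ofPred_eq, not_not] at hω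
        refine ⟨by simp [Parametrization.resample, exchange_u_self, hωE], ?_⟩
        rw [permutationNeighbour, hμ, Fin.addCases_right, permutationFinal, permSwitch]
        exact inSwitch_inv_zero (hω.1.generic ((hmem ω).1 hωE))
      bounded := Filter.Eventually.of_forall fun ω => by
        rw [permutationFinal_resample_natAdd, ← sub_sub_sub_cancel_right _ _ (permMatrix (ω.θ i))]
        exact ((permSwitch_isEdgeDifference _ _ _).sub
          (permSwitch_isEdgeDifference _ _ _)).mono (by norm_num) }⟩

theorem permutation_hasLocalResampling {d : ℕ} (hd : Even d) :
    HasLocalResampling .permutation N d (18 / N) 20 := by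
  obtain ⟨k, rfl⟩ := hd
  refine ⟨permutationParam k N, fun μ ω => (ω.u μ).1, permutationNeighbour,
    fun ω => permutationAdjacency (permutationFinal ω), fun μ => ?_, fun μ => ?_, ?_,
    permutationFinal_law, ?_, fun μ => ?_⟩
  · exact measurable_sigmaF_of_factor _ fun ω ω' _ h => by beta_reduce; rw [h]
  · exact measurable_sigmaF_of_factor _ fun ω ω' h h' => by
      unfold permutationNeighbour permutationFinal; rw [h, h']
  · exact measurable_sigmaF_of_factor _ fun ω ω' h h' => by
      unfold permutationFinal; rw [h, h']
  · refine Filter.Eventually.of_forall fun ω i => ?_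
    simp only [permutationAdjacency, Matrix.of_apply]
    rw [Fin.sum_univ_add, ← Finset.sum_add_distrib]
    refine Finset.sum_congr rfl fun j _ => ?_
    simp only [permutationNeighbour, Fin.addCases_left, Fin.addCases_right]
    congr 1
    refine if_congr ?_ rfl rfl
    rw [Equiv.Perm.eq_inv_iff_eq, eq_comm]
  · refine Fin.addCases (fun i => ?_) (fun i => ?_) μ
    · exact permutation_localResampling_castAdd i
    · exact permutation_localResampling_natAdd i

end PermutationModelIn

/-! ### Simultaneous switchings of simple regular graphs -/

/-- The vertices of the three edges `{0, a}`, `{p, p'}`, `{q, q'}`, to be replaced by `{0, p}`,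
`{a, q}`, `{p', q'}`. -/
structure SwitchData (N : ℕ) where
  a : Fin N
  p : Fin N
  p' : Fin N
  q : Fin N
  q' : Fin N

namespace SwitchData

set_option linter.unusedSectionVars false

variable {N : ℕ} [NeZero N]

/-- The vertices other than `0`. -/
def block (t : SwitchData N) : Finset (Fin N) := {t.a, t.p, t.p', t.q, t.q'}

/-- The change of the adjacency matrix. -/
def change (t : SwitchData N) : Matrix (Fin N) (Fin N) ℤ :=
  edgeMatrix 0 t.p + edgeMatrix t.a t.q + edgeMatrix t.p' t.q'
    - edgeMatrix 0 t.a - edgeMatrix t.p t.p' - edgeMatrix t.q t.q'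

/-- The data of the reverse switch. -/
def flip (t : SwitchData N) : SwitchData N := ⟨t.p, t.a, t.q, t.p', t.q'⟩

/-- The six vertices are distinct. -/
def Distinct (t : SwitchData N) : Prop := [0, t.a, t.p, t.p', t.q, t.q'].Nodup

/-- The switch produces a simple graph. -/
def Admissible (E : Matrix (Fin N) (Fin N) ℤ) (t : SwitchData N) : Prop :=
  t.Distinct ∧ E 0 t.p = 0 ∧ E t.a t.q = 0 ∧ E t.p' t.q' = 0

/-- The three edges to be removed are present. -/
def Present (E : Matrix (Fin N) (Fin N) ℤ) (t : SwitchData N) : Prop :=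
  E 0 t.a = 1 ∧ E t.p t.p' = 1 ∧ E t.q t.q' = 1

variable {t : SwitchData N} {E : Matrix (Fin N) (Fin N) ℤ}

theorem flip_flip (t : SwitchData N) : t.flip.flip = t := rfl

theorem block_flip (t : SwitchData N) : t.flip.block = t.block := by
  ext i
  simp only [block, flip, Finset.mem_insert, Finset.mem_singleton]
  tauto

theorem change_flip (t : SwitchData N) : t.flip.change = -t.change := by
  simp only [change, flip]
  abel

theorem distinct_flip (h : t.Distinct) : t.flip.Distinct := by
  simp only [Distinct, flip, List.nodup_cons, List.mem_cons, List.not_mem_nil, or_false,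
    not_or, not_false_eq_true, List.nodup_nil, and_true] at h ⊢
  simp only [eq_comm] at h ⊢
  tauto

theorem card_block_le (t : SwitchData N) : t.block.card ≤ 5 := Finset.card_le_five

theorem Distinct.zero_notMem (h : t.Distinct) : (0 : Fin N) ∉ t.block := by
  simp only [Distinct, List.nodup_cons, List.mem_cons, List.not_mem_nil, or_false, not_or] at h
  simp only [block, Finset.mem_insert, Finset.mem_singleton]
  tauto

theorem edgeMatrix_symm (x y k l : Fin N) : edgeMatrix x y k l = edgeMatrix x y l k := by
  simp only [edgeMatrix, Matrix.of_apply]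
  ring

theorem change_symm (t : SwitchData N) (k l : Fin N) : t.change k l = t.change l k := by
  simp only [change, Matrix.sub_apply, Matrix.add_apply, edgeMatrix_symm _ _ k l]

theorem edgeMatrix_eq_zero {x y k l : Fin N} (hx : k ≠ x) (hy : k ≠ y) :
    edgeMatrix x y k l = 0 := by
  simp [edgeMatrix, hx.symm, hy.symm]

theorem change_eq_zero {k l : Fin N} (hk : k ∉ t.block) (hk0 : k ≠ 0) : t.change k l = 0 := by
  simp only [block, Finset.mem_insert, Finset.mem_singleton, not_or] at hk
  obtain ⟨h1, h2, h3, h4, h5⟩ := hk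
  simp only [change, Matrix.sub_apply, Matrix.add_apply]
  rw [edgeMatrix_eq_zero hk0 h2, edgeMatrix_eq_zero h1 h4, edgeMatrix_eq_zero h3 h5,
    edgeMatrix_eq_zero hk0 h1, edgeMatrix_eq_zero h2 h3, edgeMatrix_eq_zero h4 h5]
  rfl

theorem change_zero_zero (h : (0 : Fin N) ∉ t.block) : t.change 0 0 = 0 := by
  simp only [block, Finset.mem_insert, Finset.mem_singleton, not_or] at h
  obtain ⟨h1, h2, h3, h4, h5⟩ := h
  simp only [change, Matrix.sub_apply, Matrix.add_apply]
  rw [edgeMatrix_eq_zero h1 h4, edgeMatrix_eq_zero h3 h5, edgeMatrix_eq_zero h2 h3,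
    edgeMatrix_eq_zero h4 h5]
  simp [edgeMatrix, Ne.symm h1, Ne.symm h2]

theorem sum_edgeMatrix (x y k : Fin N) :
    ∑ l, edgeMatrix x y k l = (if x = k then 1 else 0) + (if y = k then 1 else 0) := by
  simp only [edgeMatrix, Matrix.of_apply, Finset.sum_add_distrib, ← Finset.mul_sum,
    ← Finset.sum_mul, Finset.sum_ite_eq, Finset.mem_univ, if_true]
  ring

theorem sum_change (t : SwitchData N) (k : Fin N) : ∑ l, t.change k l = 0 := by
  simp only [change, Matrix.sub_apply, Matrix.add_apply, Finset.sum_add_distrib,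
    Finset.sum_sub_distrib, sum_edgeMatrix]
  ring

/-- In the row of each of the six vertices, one entry is raised and one is lowered. -/
def IsRow (E X : Matrix (Fin N) (Fin N) ℤ) (k n o : Fin N) : Prop :=
  E k n = 0 ∧ E k o = 1 ∧ k ≠ n ∧ k ≠ o ∧
    ∀ l, X k l = (if l = n then 1 else 0) - (if l = o then 1 else 0)

/-- Each of the five vertices loses one edge, present by `Present`, and gains one, absent by
`Admissible`. The row of `0` is left out since every performed switch alters it. -/
theorem isRow (hE : ∀ i j, E i j = E j i) (h : Admissible E t) (h' : Present E t) :
    IsRow E t.change t.a t.q 0 ∧ IsRow E t.change t.p 0 t.p' ∧ IsRow E t.change t.p' t.q' t.p ∧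
      IsRow E t.change t.q t.a t.q' ∧ IsRow E t.change t.q' t.p' t.q := by
  obtain ⟨h0, e1, e2, e3⟩ := h
  obtain ⟨e4, e5, e6⟩ := h'
  simp only [Distinct, List.nodup_cons, List.mem_cons, List.not_mem_nil, or_false,
    not_or, not_false_eq_true, List.nodup_nil, and_true] at h0
  obtain ⟨⟨n1, n2, n3, n4, n5⟩, ⟨n6, n7, n8, n9⟩, ⟨n10, n11, n12⟩, ⟨n13, n14⟩, n15⟩ := h0
  refine ⟨⟨e2, by rw [hE]; exact e4, n8, Ne.symm n1, fun l => ?_⟩,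
    ⟨by rw [hE]; exact e1, e5, Ne.symm n2, n10, fun l => ?_⟩,
    ⟨e3, by rw [hE]; exact e5, n14, Ne.symm n10, fun l => ?_⟩,
    ⟨by rw [hE]; exact e2, e6, Ne.symm n8, n15, fun l => ?_⟩,
    ⟨by rw [hE]; exact e3, by rw [hE]; exact e6, Ne.symm n14, Ne.symm n15, fun l => ?_⟩⟩ <;>
  · simp only [change, Matrix.sub_apply, Matrix.add_apply, edgeMatrix, Matrix.of_apply,
      if_neg n1, if_neg n2, if_neg n3, if_neg n4, if_neg n5, if_neg n6, if_neg n7, if_neg n8,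
      if_neg n9, if_neg n10, if_neg n11, if_neg n12, if_neg n13, if_neg n14, if_neg n15,
      if_neg (Ne.symm n6), if_neg (Ne.symm n7), if_neg (Ne.symm n8),
      if_neg (Ne.symm n9), if_neg (Ne.symm n10), if_neg (Ne.symm n11), if_neg (Ne.symm n12),
      if_neg (Ne.symm n13), if_neg (Ne.symm n14), if_neg (Ne.symm n15), if_true, eq_comm (a := l)]
    ring

theorem isRow_of_mem (hE : ∀ i j, E i j = E j i) (h : Admissible E t) (h' : Present E t)
    {k : Fin N} (hk : k ∈ t.block) : ∃ n o, IsRow E t.change k n o := by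
  obtain ⟨h1, h2, h3, h4, h5⟩ := isRow hE h h'
  simp only [block, Finset.mem_insert, Finset.mem_singleton] at hk
  rcases hk with rfl | rfl | rfl | rfl | rfl
  exacts [⟨_, _, h1⟩, ⟨_, _, h2⟩, ⟨_, _, h3⟩, ⟨_, _, h4⟩, ⟨_, _, h5⟩]

theorem IsRow.raised {X : Matrix (Fin N) (Fin N) ℤ} {k n o : Fin N} (h : IsRow E X k n o) :
    E k n + X k n = 1 := by
  have : n ≠ o := fun e => by
    have h1 := h.1
    rw [e, h.2.1] at h1
    exact one_ne_zero h1
  rw [h.2.2.2.2, h.1]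
  simp [this]

theorem IsRow.lowered {X : Matrix (Fin N) (Fin N) ℤ} {k n o : Fin N} (h : IsRow E X k n o) :
    E k o + X k o = 0 := by
  have : o ≠ n := fun e => by
    have h1 := h.1
    rw [← e, h.2.1] at h1
    exact one_ne_zero h1
  rw [h.2.2.2.2, h.2.1]
  simp [this]

theorem IsRow.add_mem {X : Matrix (Fin N) (Fin N) ℤ} {k n o : Fin N} (h : IsRow E X k n o)
    (hE : ∀ i j, E i j = 0 ∨ E i j = 1) (l : Fin N) :
    E k l + X k l = 0 ∨ E k l + X k l = 1 := by
  by_cases h1 : l = n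
  · rw [h1]; exact Or.inr h.raised
  by_cases h2 : l = o
  · rw [h2]; exact Or.inl h.lowered
  rw [h.2.2.2.2, if_neg h1, if_neg h2]
  simpa using hE k l

theorem IsRow.diag {X : Matrix (Fin N) (Fin N) ℤ} {k n o : Fin N} (h : IsRow E X k n o) :
    X k k = 0 := by
  rw [h.2.2.2.2, if_neg h.2.2.1, if_neg h.2.2.2.1, sub_zero]

theorem change_isEdgeDifference (t : SwitchData N) : IsEdgeDifference 3 t.change := by
  convert ((IsEdgeDifference.single 0 t.p 0 t.a).add (IsEdgeDifference.single t.a t.q t.p t.p')).add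
    (IsEdgeDifference.single t.p' t.q' t.q t.q') using 1
  simp only [change]
  abel

end SwitchData

/-! ### Performing several switches at once -/

section Switching

open SwitchData

variable {N d : ℕ} [NeZero N] (E : Matrix (Fin N) (Fin N) ℤ) (t : Fin d → SwitchData N)

open Classical in
/-- The indices whose switch is performed: it is admissible and its vertices belong to no other
switch. -/
def switchSet : Finset (Fin d) := Finset.univ.filter fun μ =>
  Admissible E (t μ) ∧ ∀ ν, ν ≠ μ → Disjoint (t μ).block (t ν).block

theorem mem_switchSet {μ : Fin d} : μ ∈ switchSet E t ↔
    Admissible E (t μ) ∧ ∀ ν, ν ≠ μ → Disjoint (t μ).block (t ν).block := by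
  simp [switchSet]

/-- The adjacency matrix after the simultaneous switch. -/
def switchedMatrix : Matrix (Fin N) (Fin N) ℤ := E + ∑ μ ∈ switchSet E t, (t μ).change

open Classical in
/-- The data of the reverse simultaneous switch. -/
def switchedData (μ : Fin d) : SwitchData N := if μ ∈ switchSet E t then (t μ).flip else t μ

variable {E t}

theorem switchedMatrix_apply (k l : Fin N) :
    switchedMatrix E t k l = E k l + ∑ μ ∈ switchSet E t, (t μ).change k l := by
  simp [switchedMatrix, Matrix.sum_apply]

/-- The block of a performed switch meets no other block, so no other switch acts on its rows. -/
theorem switchedMatrix_of_mem {μ : Fin d} (hμ : μ ∈ switchSet E t) {k : Fin N}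
    (hk : k ∈ (t μ).block) (l : Fin N) :
    switchedMatrix E t k l = E k l + (t μ).change k l := by
  rw [switchedMatrix_apply, Finset.sum_eq_single μ]
  · intro ν _ hν
    rw [mem_switchSet] at hμ
    refine change_eq_zero (fun h => ?_) fun h => ?_
    · exact Finset.disjoint_left.1 (hμ.2 ν hν) hk h
    · exact hμ.1.1.zero_notMem (h ▸ hk)
  · exact fun h => absurd hμ h

theorem switchedMatrix_of_notMem {k : Fin N} (hk0 : k ≠ 0)
    (hk : ∀ μ ∈ switchSet E t, k ∉ (t μ).block) (l : Fin N) :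
    switchedMatrix E t k l = E k l := by
  rw [switchedMatrix_apply, Finset.sum_eq_zero fun μ hμ => change_eq_zero (hk μ hμ) hk0, add_zero]

theorem switchedMatrix_zero_zero : switchedMatrix E t 0 0 = E 0 0 := by
  rw [switchedMatrix_apply, Finset.sum_eq_zero, add_zero]
  exact fun μ hμ => change_zero_zero ((mem_switchSet E t).1 hμ).1.1.zero_notMem

theorem switchedMatrix_symm (hE : ∀ i j, E i j = E j i) (k l : Fin N) :
    switchedMatrix E t k l = switchedMatrix E t l k := by
  rw [switchedMatrix_apply, switchedMatrix_apply, hE k l]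
  congr 1
  exact Finset.sum_congr rfl fun μ _ => change_symm _ k l

/-- The graph is simple and `d`-regular, the `a_μ` enumerate the neighbours of `0` and all the
edges to be switched are present. -/
structure ValidData (E : Matrix (Fin N) (Fin N) ℤ) (t : Fin d → SwitchData N) : Prop where
  mem : E ∈ simpleRegularMatrices N d
  injective : Function.Injective fun μ => (t μ).a
  present : ∀ μ, Present E (t μ)

theorem ValidData.symm (h : ValidData E t) (i j : Fin N) : E i j = E j i := h.mem.1.apply j i

end Switching

/-! ### The simultaneous switch is an involution of the valid data -/

section SwitchingInvolution

set_option linter.unusedSectionVars false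

open SwitchData

variable {N d : ℕ} [NeZero N] {E : Matrix (Fin N) (Fin N) ℤ} {t : Fin d → SwitchData N}

theorem switchedData_of_mem {μ : Fin d} (h : μ ∈ switchSet E t) :
    switchedData E t μ = (t μ).flip := by simp [switchedData, h]

theorem switchedData_of_notMem {μ : Fin d} (h : μ ∉ switchSet E t) :
    switchedData E t μ = t μ := by simp [switchedData, h]

theorem block_switchedData (μ : Fin d) : (switchedData E t μ).block = (t μ).block := by
  by_cases h : μ ∈ switchSet E t
  · rw [switchedData_of_mem h, block_flip]
  · rw [switchedData_of_notMem h]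

theorem disjoint_block {μ ν : Fin d} (hμ : μ ∈ switchSet E t) (h : ν ≠ μ) :
    Disjoint (t μ).block (t ν).block := ((mem_switchSet E t).1 hμ).2 ν h

theorem switchedMatrix_eq_of_mem_block {μ : Fin d} (hμ : μ ∉ switchSet E t) {k : Fin N}
    (hk : k ∈ (t μ).block) (hk0 : k ≠ 0) (l : Fin N) : switchedMatrix E t k l = E k l :=
  switchedMatrix_of_notMem hk0 (fun ν hν h => Finset.disjoint_left.1
    (disjoint_block hν fun e => hμ (by rw [e]; exact hν)) h hk) l

theorem switchedMatrix_eq_of_mem_insert (hE : ∀ i j, E i j = E j i) {μ : Fin d}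
    (hμ : μ ∉ switchSet E t) {k l : Fin N} (hk : k ∈ insert 0 (t μ).block)
    (hl : l ∈ insert 0 (t μ).block) : switchedMatrix E t k l = E k l := by
  by_cases hk0 : k = 0
  · by_cases hl0 : l = 0
    · rw [hk0, hl0, switchedMatrix_zero_zero]
    · rw [switchedMatrix_symm hE, hE k,
        switchedMatrix_eq_of_mem_block hμ ((Finset.mem_insert.1 hl).resolve_left hl0) hl0]
  · exact switchedMatrix_eq_of_mem_block hμ ((Finset.mem_insert.1 hk).resolve_left hk0) hk0 l

namespace ValidData

theorem isRow_or (h : ValidData E t) {k : Fin N} (hk : k ≠ 0) :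
    (∃ μ ∈ switchSet E t, (∃ n o, IsRow E (t μ).change k n o) ∧
      ∀ l, switchedMatrix E t k l = E k l + (t μ).change k l) ∨
    ∀ l, switchedMatrix E t k l = E k l := by
  by_cases hμ : ∃ μ ∈ switchSet E t, k ∈ (t μ).block
  · obtain ⟨μ, hμ, hkμ⟩ := hμ
    exact Or.inl ⟨μ, hμ, isRow_of_mem h.symm ((mem_switchSet E t).1 hμ).1 (h.present μ) hkμ,
      switchedMatrix_of_mem hμ hkμ⟩
  · exact Or.inr (switchedMatrix_of_notMem hk fun μ hm hk => hμ ⟨μ, hm, hk⟩)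

/-- Rows other than that of `0` are changed by at most one switch and stay in `{0, 1}`. The row of
`0` is read off from its column by symmetry, and its diagonal entry never changes. -/
theorem switchedMatrix_mem (h : ValidData E t) :
    switchedMatrix E t ∈ simpleRegularMatrices N d := by
  have h01 : ∀ k l, k ≠ 0 → switchedMatrix E t k l = 0 ∨ switchedMatrix E t k l = 1 :=
    fun k l hk => by
      rcases h.isRow_or hk with ⟨μ, _, ⟨n, o, hr⟩, he⟩ | he
      · rw [he]; exact hr.add_mem h.mem.2.1 l
      · rw [he]; exact h.mem.2.1 k l
  refine ⟨Matrix.IsSymm.ext fun i j => switchedMatrix_symm h.symm j i, fun k l => ?_,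
    fun k => ?_, fun k => ?_⟩
  · by_cases hk : k = 0
    · by_cases hl : l = 0
      · rw [hk, hl, switchedMatrix_zero_zero]; exact h.mem.2.1 0 0
      · rw [switchedMatrix_symm h.symm]; exact h01 l k hl
    · exact h01 k l hk
  · by_cases hk : k = 0
    · rw [hk, switchedMatrix_zero_zero]; exact h.mem.2.2.1 0
    · rcases h.isRow_or hk with ⟨μ, _, ⟨n, o, hr⟩, he⟩ | he
      · rw [he, hr.diag, h.mem.2.2.1 k, add_zero]
      · rw [he]; exact h.mem.2.2.1 k
  · simp only [switchedMatrix_apply, Finset.sum_add_distrib]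
    rw [Finset.sum_comm]
    simp only [sum_change, Finset.sum_const_zero, add_zero]
    exact h.mem.2.2.2 k

theorem neighbour_ne (h : ValidData E t) (μ : Fin d) : (t μ).a ≠ 0 := fun e => by
  have h1 := (h.present μ).1
  rw [e, h.mem.2.2.1 0] at h1
  exact zero_ne_one h1

theorem _root_.SwitchData.a_mem_block (s : SwitchData N) : s.a ∈ s.block := by simp [block]

/-- A flip moves the neighbour inside its own block, and the block of a performed switch is disjoint
from all others. -/
theorem injective_switched (h : ValidData E t) :
    Function.Injective fun μ => (switchedData E t μ).a := by
  have key : ∀ μ ν, μ ∈ switchSet E t → (switchedData E t μ).a = (switchedData E t ν).a → μ = ν :=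
    fun μ ν hμ he => by
      by_contra hne
      have h1 := a_mem_block (switchedData E t μ)
      have h2 := a_mem_block (switchedData E t ν)
      rw [block_switchedData] at h1 h2
      rw [he] at h1
      exact Finset.disjoint_left.1 (disjoint_block hμ (Ne.symm hne)) h1 h2
  intro μ ν he
  by_cases hμ : μ ∈ switchSet E t
  · exact key μ ν hμ he
  by_cases hν : ν ∈ switchSet E t
  · exact (key ν μ hν he.symm).symm
  exact h.injective (by simpa [switchedData_of_notMem, hμ, hν] using he)

theorem present_switched (h : ValidData E t) (μ : Fin d) :
    Present (switchedMatrix E t) (switchedData E t μ) := by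
  have hs := switchedMatrix_symm (t := t) h.symm
  by_cases hμ : μ ∈ switchSet E t
  · obtain ⟨h1, h2, h3, h4, h5⟩ := isRow h.symm ((mem_switchSet E t).1 hμ).1 (h.present μ)
    rw [switchedData_of_mem hμ]
    refine ⟨?_, ?_, ?_⟩
    · change switchedMatrix E t 0 (t μ).p = 1
      rw [hs, switchedMatrix_of_mem hμ (by simp [block]), h2.raised]
    · change switchedMatrix E t (t μ).a (t μ).q = 1
      rw [switchedMatrix_of_mem hμ (by simp [block]), h1.raised]
    · change switchedMatrix E t (t μ).p' (t μ).q' = 1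
      rw [switchedMatrix_of_mem hμ (by simp [block]), h3.raised]
  · rw [switchedData_of_notMem hμ]
    refine ⟨?_, ?_, ?_⟩ <;> rw [switchedMatrix_eq_of_mem_insert h.symm hμ (by simp [block])
      (by simp [block])]
    exacts [(h.present μ).1, (h.present μ).2.1, (h.present μ).2.2]

theorem switched (h : ValidData E t) : ValidData (switchedMatrix E t) (switchedData E t) :=
  ⟨h.switchedMatrix_mem, h.injective_switched, h.present_switched⟩

/-- The edges which a reverse switch has to create were just removed. For a switch that is not
performed, no entry among its six vertices has changed. -/
theorem admissible_switched (h : ValidData E t) (μ : Fin d) :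
    SwitchData.Admissible (switchedMatrix E t) (switchedData E t μ) ↔
      SwitchData.Admissible E (t μ) := by
  have hs := switchedMatrix_symm (t := t) h.symm
  by_cases hm : μ ∈ switchSet E t
  · have hadm := ((mem_switchSet E t).1 hm).1
    obtain ⟨h1, h2, h3, h4, h5⟩ := isRow h.symm hadm (h.present μ)
    refine iff_of_true ?_ hadm
    rw [switchedData_of_mem hm]
    refine ⟨distinct_flip hadm.1, ?_, ?_, ?_⟩
    · change switchedMatrix E t 0 (t μ).a = 0
      rw [hs, switchedMatrix_of_mem hm (by simp [block]), h1.lowered]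
    · change switchedMatrix E t (t μ).p (t μ).p' = 0
      rw [switchedMatrix_of_mem hm (by simp [block]), h2.lowered]
    · change switchedMatrix E t (t μ).q (t μ).q' = 0
      rw [switchedMatrix_of_mem hm (by simp [block]), h4.lowered]
  · rw [switchedData_of_notMem hm]
    unfold SwitchData.Admissible
    rw [switchedMatrix_eq_of_mem_insert h.symm hm (by simp [block]) (by simp [block]),
      switchedMatrix_eq_of_mem_insert h.symm hm (by simp [block]) (by simp [block]),
      switchedMatrix_eq_of_mem_insert h.symm hm (by simp [block]) (by simp [block])]

/-- The criterion compares the blocks of all indices, performed or not, and flips preserve blocks.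
Hence the same switches are performed in reverse, which makes the simultaneous switch an involution.
-/
theorem switchSet_switched (h : ValidData E t) :
    switchSet (switchedMatrix E t) (switchedData E t) = switchSet E t := by
  ext μ
  simp only [mem_switchSet, block_switchedData]
  exact and_congr_left fun _ => h.admissible_switched μ

theorem switchedData_switched (h : ValidData E t) :
    switchedData (switchedMatrix E t) (switchedData E t) = t := by
  funext μ
  by_cases hμ : μ ∈ switchSet E t
  · rw [switchedData_of_mem (by rwa [h.switchSet_switched]), switchedData_of_mem hμ,
      SwitchData.flip_flip]
  · rw [switchedData_of_notMem (by rwa [h.switchSet_switched]), switchedData_of_notMem hμ]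

theorem switchedMatrix_switched (h : ValidData E t) :
    switchedMatrix (switchedMatrix E t) (switchedData E t) = E := by
  rw [switchedMatrix, h.switchSet_switched, switchedMatrix, add_assoc, ← Finset.sum_add_distrib,
    Finset.sum_eq_zero, add_zero]
  intro μ hμ
  rw [switchedData_of_mem hμ, change_flip, add_neg_cancel]

/-- The data enumerate the neighbours of the vertex `0`. -/
theorem row_zero (h : ValidData E t) (i : Fin N) : E 0 i = ∑ μ, if i = (t μ).a then 1 else 0 := by
  have hle : ∀ i ∈ Finset.univ, (∑ μ, if i = (t μ).a then (1 : ℤ) else 0) ≤ E 0 i := fun i _ => by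
    by_cases hi : ∃ μ, i = (t μ).a
    · obtain ⟨μ, rfl⟩ := hi
      rw [(h.present μ).1]
      simp only [h.injective.eq_iff]
      simp
    · rw [Finset.sum_eq_zero fun μ _ => if_neg fun e => hi ⟨μ, e⟩]
      rcases h.mem.2.1 0 i with h' | h' <;> simp [h']
  -- The inequality holds entrywise and both sides have total `d`, so it is an equality.
  refine ((Finset.sum_eq_sum_iff_of_le hle).1 ?_ i (Finset.mem_univ i)).symm
  rw [h.mem.2.2.2 0, Finset.sum_comm]
  simp

end ValidData

/-! ### The effect of changing one switch -/

variable {t' : Fin d → SwitchData N}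

theorem meets_block_of_mem_switchSet {μ ν : Fin d} (ht : ∀ ν, ν ≠ μ → t' ν = t ν) (hν : ν ≠ μ)
    (h : ν ∈ switchSet E t) (h' : ν ∉ switchSet E t') :
    ∃ k ∈ (t' μ).block, k ∈ (t ν).block := by
  by_contra! hcon
  refine h' ((mem_switchSet _ _).2 ⟨?_, fun l hl => ?_⟩)
  · rw [ht ν hν]; exact ((mem_switchSet _ _).1 h).1
  · rw [ht ν hν]
    by_cases hlμ : l = μ
    · rw [hlμ]
      exact Finset.disjoint_right.2 hcon
    · rw [ht l hlμ]
      exact disjoint_block h hl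

open Classical in
-- A switch that is lost must meet the new block of `μ`. The lost ones have pairwise disjoint
-- blocks, so they inject into the at most five vertices of that block.
theorem card_switchSet_sdiff_le {μ : Fin d} (ht : ∀ ν, ν ≠ μ → t' ν = t ν) :
    ((switchSet E t \ switchSet E t').erase μ).card ≤ 5 := by
  have hex : ∀ ν : Fin d, ∃ k, ν ∈ (switchSet E t \ switchSet E t').erase μ →
      k ∈ (t' μ).block ∧ k ∈ (t ν).block := fun ν => by
    by_cases hν : ν ∈ (switchSet E t \ switchSet E t').erase μ
    · simp only [Finset.mem_erase, Finset.mem_sdiff] at hν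
      obtain ⟨k, hk⟩ := meets_block_of_mem_switchSet ht hν.1 hν.2.1 hν.2.2
      exact ⟨k, fun _ => hk⟩
    · exact ⟨0, fun h => absurd h hν⟩
  choose f hf using hex
  refine (Finset.card_le_card_of_injOn f (fun ν hν => (hf ν hν).1) fun ν hν l hl e => ?_).trans
    (card_block_le (t' μ))
  by_contra hne
  have h1 := (hf ν hν).2
  rw [e] at h1
  refine Finset.disjoint_left.1 (disjoint_block (E := E) ?_ (Ne.symm hne)) h1 (hf l hl).2
  exact (Finset.mem_sdiff.1 (Finset.mem_of_mem_erase (Finset.mem_coe.1 hν))).1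

open Classical in
-- Switch `μ` accounts for `3` pairs of edges before and `3` after. At most five switches are lost
-- and five gained, `15` pairs each; together `36`.
theorem switchedMatrix_sub_isEdgeDifference {μ : Fin d} (ht : ∀ ν, ν ≠ μ → t' ν = t ν) :
    IsEdgeDifference 36 (switchedMatrix E t' - switchedMatrix E t) := by
  have hsplit : ∀ (t : Fin d → SwitchData N) (W : Finset (Fin d)), switchedMatrix E t = E +
      ((if μ ∈ switchSet E t then (t μ).change else 0) +
        (∑ ν ∈ (switchSet E t \ W).erase μ, (t ν).change +
          ∑ ν ∈ (switchSet E t ∩ W).erase μ, (t ν).change)) := fun t W => by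
    have h1 : ∑ ν ∈ (switchSet E t \ W).erase μ, (t ν).change +
        ∑ ν ∈ (switchSet E t ∩ W).erase μ, (t ν).change =
        ∑ ν ∈ (switchSet E t).erase μ, (t ν).change := by
      rw [← Finset.sum_union]
      · rw [← Finset.erase_union_distrib, Finset.sdiff_union_inter]
      · exact (Finset.disjoint_sdiff_inter _ _).mono (Finset.erase_subset _ _)
          (Finset.erase_subset _ _)
    rw [h1, switchedMatrix]
    congr 1
    split_ifs with h
    · rw [Finset.add_sum_erase _ (fun ν => (t ν).change) h]
    · rw [Finset.erase_eq_of_notMem h, zero_add]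
  have hcommon : ∑ ν ∈ (switchSet E t' ∩ switchSet E t).erase μ, (t' ν).change =
      ∑ ν ∈ (switchSet E t ∩ switchSet E t').erase μ, (t ν).change := by
    rw [Finset.inter_comm]
    exact Finset.sum_congr rfl fun ν hν => by rw [ht ν (Finset.ne_of_mem_erase hν)]
  have hsum : ∀ {t t' : Fin d → SwitchData N}, (∀ ν, ν ≠ μ → t' ν = t ν) → IsEdgeDifference 15
      (∑ ν ∈ (switchSet E t \ switchSet E t').erase μ, (t ν).change) := fun {t t'} ht =>
    (IsEdgeDifference.sum _ _ fun ν _ => change_isEdgeDifference (t ν)).mono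
      (by have := card_switchSet_sdiff_le (E := E) ht; omega)
  have hite : ∀ t : Fin d → SwitchData N,
      IsEdgeDifference 3 (if μ ∈ switchSet E t then (t μ).change else 0) := fun t => by
    split_ifs
    · exact change_isEdgeDifference _
    · exact IsEdgeDifference.zero 3
  rw [hsplit t (switchSet E t'), hsplit t' (switchSet E t), hcommon]
  convert ((hite t').sub (hite t)).add
    ((hsum (fun ν hν => (ht ν hν).symm)).sub (hsum ht)) using 1
  abel

/-- The vertices that a typical switch `μ` avoids, apart from `(t μ).a`. -/
def occupied (t : Fin d → SwitchData N) (μ : Fin d) : Finset (Fin N) :=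
  insert 0 (insert (t μ).a ((Finset.univ.erase μ).biUnion fun ν => (t ν).block))

/-- The switch `μ` is admissible and its vertices other than `(t μ).a` belong to no other switch. -/
def TypicalSwitch (E : Matrix (Fin N) (Fin N) ℤ) (t : Fin d → SwitchData N) (μ : Fin d) : Prop :=
  SwitchData.Admissible E (t μ) ∧ (t μ).p ∉ occupied t μ ∧ (t μ).p' ∉ occupied t μ ∧
    (t μ).q ∉ occupied t μ ∧ (t μ).q' ∉ occupied t μ

/-- The neighbour to be switched belongs to no other switch. -/
def FreeNeighbour (t : Fin d → SwitchData N) (μ : Fin d) : Prop :=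
  ∀ ν, ν ≠ μ → (t μ).a ∉ (t ν).block

theorem card_occupied_le (hd : 0 < d) (μ : Fin d) : (occupied t μ).card ≤ 5 * d := by
  have h1 : ((Finset.univ.erase μ).biUnion fun ν => (t ν).block).card ≤ (d - 1) * 5 := by
    refine (Finset.card_biUnion_le_card_mul _ _ 5 fun ν _ => card_block_le _).trans ?_
    simp
  have h2 := Finset.card_insert_le (t μ).a ((Finset.univ.erase μ).biUnion fun ν => (t ν).block)
  have h3 := Finset.card_insert_le 0
    (insert (t μ).a ((Finset.univ.erase μ).biUnion fun ν => (t ν).block))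
  unfold occupied
  omega

theorem TypicalSwitch.disjoint_iff {μ ν : Fin d} (h : TypicalSwitch E t μ) (hν : ν ≠ μ) :
    Disjoint (t μ).block (t ν).block ↔ (t μ).a ∉ (t ν).block := by
  have hocc : ∀ k, k ∉ occupied t μ → k ∉ (t ν).block := fun k hk hm => hk <|
    Finset.mem_insert_of_mem <| Finset.mem_insert_of_mem <|
      Finset.mem_biUnion.2 ⟨ν, Finset.mem_erase.2 ⟨hν, Finset.mem_univ ν⟩, hm⟩
  constructor
  · exact fun hd => Finset.disjoint_left.1 hd (SwitchData.a_mem_block _)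
  · intro ha
    rw [Finset.disjoint_left]
    intro k hk
    simp only [block, Finset.mem_insert, Finset.mem_singleton] at hk
    obtain ⟨-, h1, h2, h3, h4⟩ := h
    rcases hk with rfl | rfl | rfl | rfl | rfl
    exacts [ha, hocc _ h1, hocc _ h2, hocc _ h3, hocc _ h4]

/-- Once the four drawn vertices avoid all other blocks, only the neighbour fixed by `θ` can
collide. That collision does not involve `u_μ`, so it is decided by `𝒢_μ`. -/
theorem TypicalSwitch.mem_switchSet_iff {μ : Fin d} (h : TypicalSwitch E t μ) :
    μ ∈ switchSet E t ↔ FreeNeighbour t μ := by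
  rw [mem_switchSet]
  exact ⟨fun h' ν hν => (h.disjoint_iff hν).1 (h'.2 ν hν),
    fun h' => ⟨h.1, fun ν hν => (h.disjoint_iff hν).2 (h' ν hν)⟩⟩

theorem TypicalSwitch.mem_switchSet_congr {μ ν : Fin d} (h : TypicalSwitch E t μ)
    (h' : TypicalSwitch E t' μ) (ht : ∀ ν, ν ≠ μ → t' ν = t ν) (ha : (t' μ).a = (t μ).a)
    (hν : ν ≠ μ) : ν ∈ switchSet E t' ↔ ν ∈ switchSet E t := by
  rw [mem_switchSet, mem_switchSet, ht ν hν]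
  refine and_congr_right fun _ => forall_congr' fun l => imp_congr_right fun hl => ?_
  by_cases hlμ : l = μ
  · rw [hlμ, disjoint_comm, disjoint_comm (a := (t ν).block), h.disjoint_iff hν, ← ht ν hν,
      h'.disjoint_iff hν, ha]
  · rw [ht l hlμ]

open Classical in
-- Between two typical choices with the same neighbour, every disjointness test has the same
-- outcome. The set of performed switches is unchanged, and only the term `μ` can differ.
theorem TypicalSwitch.switchedMatrix_sub {μ : Fin d} (h : TypicalSwitch E t μ)
    (h' : TypicalSwitch E t' μ) (ht : ∀ ν, ν ≠ μ → t' ν = t ν) (ha : (t' μ).a = (t μ).a) :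
    switchedMatrix E t' - switchedMatrix E t =
      if FreeNeighbour t μ then (t' μ).change - (t μ).change else 0 := by
  have hfree : FreeNeighbour t' μ ↔ FreeNeighbour t μ :=
    forall_congr' fun ν => imp_congr_right fun hν => by rw [ht ν hν, ha]
  have hset : switchSet E t' = switchSet E t := by
    ext ν
    by_cases hν : ν = μ
    · rw [hν, h.mem_switchSet_iff, h'.mem_switchSet_iff, hfree]
    · exact h.mem_switchSet_congr h' ht ha hν
  rw [switchedMatrix, switchedMatrix, hset, add_sub_add_left_eq_sub, ← Finset.sum_sub_distrib]
  have hz : ∀ ν, ν ≠ μ → (t' ν).change - (t ν).change = 0 := fun ν hν => by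
    rw [ht ν hν, sub_self]
  split_ifs with hg
  · exact Finset.sum_eq_single_of_mem μ (h.mem_switchSet_iff.2 hg) fun ν _ hν => hz ν hν
  · exact Finset.sum_eq_zero fun ν hν => hz ν fun e => hg (h.mem_switchSet_iff.1 (e ▸ hν))

theorem TypicalSwitch.switchedData_a {μ : Fin d} (h : TypicalSwitch E t μ)
    (hg : FreeNeighbour t μ) : (switchedData E t μ).a = (t μ).p := by
  rw [switchedData_of_mem (h.mem_switchSet_iff.2 hg)]
  rfl

end SwitchingInvolution

/-! ### Simple regular graphs -/

section RegularGraphs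

set_option linter.unusedSectionVars false

variable {N d : ℕ} [NeZero N]

theorem circulant_mem_simpleRegularMatrices (S : Finset (Fin N)) (h0 : (0 : Fin N) ∉ S)
    (hneg : ∀ x ∈ S, -x ∈ S) (hcard : S.card = d) :
    Matrix.of (fun i j : Fin N => if j - i ∈ S then (1 : ℤ) else 0) ∈
      simpleRegularMatrices N d := by
  refine ⟨Matrix.IsSymm.ext fun i j => ?_, fun i j => ?_, fun i => ?_, fun i => ?_⟩
  · simp only [Matrix.of_apply]
    refine if_congr ⟨fun h => ?_, fun h => ?_⟩ rfl rfl <;> simpa using hneg _ h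
  · simp only [Matrix.of_apply]
    split_ifs <;> simp
  · simp [h0]
  · simp only [Matrix.of_apply]
    refine ((Equiv.subRight i).sum_comp fun j => if j ∈ S then (1 : ℤ) else 0).trans ?_
    simp [hcard]

/-- Take the circulant graph with steps `±1, …, ±⌊d/2⌋`, together with the antipodal step `N/2` when
`d` is odd and hence `N` even. -/
theorem simpleRegularMatrices_nonempty (hd : d < N) (h : Even (N * d)) :
    (simpleRegularMatrices N d).Nonempty := by
  have key : ∀ T : Finset ℕ, (∀ x ∈ T, 0 < x ∧ x < N ∧ N - x ∈ T) → T.card = d →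
      (simpleRegularMatrices N d).Nonempty := fun T hT hcard => by
    refine ⟨_, circulant_mem_simpleRegularMatrices (T.attachFin fun x hx => (hT x hx).2.1) ?_ ?_
      (by simpa using hcard)⟩
    · rw [Finset.mem_attachFin]
      exact fun h0 => (hT _ h0).1.ne' (by simp)
    · intro x hx
      rw [Finset.mem_attachFin] at hx ⊢
      obtain ⟨h1, h2, h3⟩ := hT _ hx
      rw [Fin.val_neg', Nat.mod_eq_of_lt (by omega)]
      exact h3
  rcases Nat.even_or_odd' d with ⟨k, hk | hk⟩
  · refine key (Finset.Icc 1 k ∪ Finset.Icc (N - k) (N - 1)) ?_ ?_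
    · intro x hx
      simp only [Finset.mem_union, Finset.mem_Icc] at hx ⊢
      omega
    · rw [Finset.card_union_of_disjoint, Nat.card_Icc, Nat.card_Icc]
      · omega
      · rw [Finset.disjoint_left]
        intro x hx hx'
        simp only [Finset.mem_Icc] at hx hx'
        omega
  · have hN : Even N := by
      rcases Nat.even_mul.1 h with h | h
      · exact h
      · exact absurd h (by rw [hk, Nat.not_even_iff_odd]; exact odd_two_mul_add_one k)
    obtain ⟨m, hm⟩ := hN
    refine key (insert m (Finset.Icc 1 k ∪ Finset.Icc (N - k) (N - 1))) ?_ ?_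
    · intro x hx
      simp only [Finset.mem_union, Finset.mem_Icc, Finset.mem_insert] at hx ⊢
      omega
    · rw [Finset.card_insert_of_notMem, Finset.card_union_of_disjoint, Nat.card_Icc, Nat.card_Icc]
      · omega
      · rw [Finset.disjoint_left]
        intro x hx hx'
        simp only [Finset.mem_Icc] at hx hx'
        omega
      · simp only [Finset.mem_union, Finset.mem_Icc]
        omega

instance finite_simpleRegularMatrices : Finite (simpleRegularMatrices N d) := by
  refine (Set.Finite.subset (Set.Finite.pi' (t := fun _ : Fin N => {v : Fin N → ℤ | ∀ j, v j ∈
    ({0, 1} : Set ℤ)}) fun _ => Set.Finite.pi' fun _ => Set.toFinite _) ?_).to_subtype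
  intro B hB i j
  simpa using hB.2.1 i j

theorem card_row {E : Matrix (Fin N) (Fin N) ℤ} (hE : E ∈ simpleRegularMatrices N d) (i : Fin N) :
    (Finset.univ.filter fun j => E i j = 1).card = d := by
  have h : ∀ j, E i j = if E i j = 1 then 1 else 0 := fun j => by
    rcases hE.2.1 i j with h | h <;> simp [h]
  have h1 := hE.2.2.2 i
  rw [Finset.sum_congr rfl fun j _ => h j, Finset.sum_boole] at h1
  exact_mod_cast h1

/-- The pairs of adjacent vertices. -/
def directedEdges (E : Matrix (Fin N) (Fin N) ℤ) : Finset (Fin N × Fin N) :=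
  Finset.univ.filter fun e => E e.1 e.2 = 1

theorem mem_directedEdges {E : Matrix (Fin N) (Fin N) ℤ} {e : Fin N × Fin N} :
    e ∈ directedEdges E ↔ E e.1 e.2 = 1 := by simp [directedEdges]

/-- By regularity each end of a uniform directed edge is an exactly uniform vertex. -/
theorem card_directedEdges_fst {E : Matrix (Fin N) (Fin N) ℤ} (hE : E ∈ simpleRegularMatrices N d)
    (i : Fin N) : ((directedEdges E).filter fun e => e.1 = i).card = d := by
  rw [← card_row hE i]
  refine (Finset.card_bij (fun j _ => (i, j)) ?_ ?_ ?_).symm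
  · intro j hj
    simpa [mem_directedEdges] using hj
  · intro j _ j' _ h
    simpa using h
  · rintro ⟨x, y⟩ h
    simp only [Finset.mem_filter, mem_directedEdges] at h
    exact ⟨y, by simpa [← h.2] using h.1, by simp [h.2]⟩

theorem card_directedEdges_snd {E : Matrix (Fin N) (Fin N) ℤ} (hE : E ∈ simpleRegularMatrices N d)
    (i : Fin N) : ((directedEdges E).filter fun e => e.2 = i).card = d := by
  rw [← card_row hE i]
  refine (Finset.card_bij (fun j _ => (j, i)) ?_ ?_ ?_).symm
  · intro j hj
    rw [Finset.mem_filter] at hj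
    simpa [mem_directedEdges, hE.1.apply i j] using hj.2
  · intro j _ j' _ h
    simpa using h
  · rintro ⟨x, y⟩ h
    simp only [Finset.mem_filter, mem_directedEdges] at h
    exact ⟨x, by simpa [← h.2, hE.1.apply x y] using h.1, by simp [h.2]⟩

theorem card_directedEdges {E : Matrix (Fin N) (Fin N) ℤ} (hE : E ∈ simpleRegularMatrices N d) :
    (directedEdges E).card = N * d := by
  rw [Finset.card_eq_sum_card_fiberwise (f := Prod.fst) (t := Finset.univ) (by simp [Set.MapsTo])]
  simp [card_directedEdges_fst hE]

end RegularGraphs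

theorem uniformOn_real {X : Type*} [MeasurableSpace X] [DiscreteMeasurableSpace X] (s : Set X)
    [Fintype s] (S : Set X) : (uniformOn s).real S =
      (Fintype.card s : ℝ)⁻¹ * ∑ E : s, S.indicator (fun _ => (1 : ℝ)) E.1 := by
  classical
  have hs : s.Finite := Set.toFinite s
  rw [measureReal_def, uniformOn, cond_apply (MeasurableSet.of_discrete),
    Measure.count_apply_finite _ hs, Measure.count_apply_finite _ (hs.inter_of_left S),
    ENNReal.toReal_mul, ENNReal.toReal_inv, ENNReal.toReal_natCast, ENNReal.toReal_natCast]
  congr 2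
  · rw [← Set.ncard_eq_toFinset_card _ hs, Set.ncard_eq_toFinset_card', Set.toFinset_card]
  · simp only [Set.indicator, Finset.sum_boole, Nat.cast_inj]
    symm
    refine Finset.card_bij (fun E _ => E.1) ?_ ?_ ?_
    · intro E hE
      simpa using hE
    · intro E _ E' _ h
      exact Subtype.ext h
    · intro E hE
      simp only [Set.Finite.mem_toFinset] at hE
      exact ⟨⟨E, hE.1⟩, by simpa using hE.2, rfl⟩

/-! ### The uniform model -/

section UniformModel

set_option linter.unusedSectionVars false

variable {N d : ℕ} [NeZero N] [NeZero d]

/-- A simple regular graph with an enumeration of the neighbours of the vertex `0`. -/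
abbrev EnumeratedGraph (N d : ℕ) [NeZero N] : Type :=
  Σ E : simpleRegularMatrices N d, Fin d ↪ {i : Fin N // E.1 0 i = 1}

instance : Fintype (simpleRegularMatrices N d) := Fintype.ofFinite _

theorem card_enumeration (E : simpleRegularMatrices N d) :
    Fintype.card (Fin d ↪ {i : Fin N // E.1 0 i = 1}) = d.factorial := by
  rw [Fintype.card_embedding_eq, Fintype.card_subtype, card_row E.2, Fintype.card_fin,
    Nat.descFactorial_self]

theorem enumeratedGraph_nonempty (h : (simpleRegularMatrices N d).Nonempty) :
    Nonempty (EnumeratedGraph N d) := by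
  obtain ⟨E, hE⟩ := h
  have : 0 < Fintype.card (Fin d ↪ {i : Fin N // E 0 i = 1}) := by
    rw [card_enumeration ⟨E, hE⟩]
    exact d.factorial_pos
  obtain ⟨f⟩ := Fintype.card_pos_iff.1 this
  exact ⟨⟨⟨E, hE⟩, f⟩⟩

/-- Every graph has `d!` enumerations, so forgetting the enumeration leaves the uniform law. -/
theorem enumeratedGraph_sum (f : Matrix (Fin N) (Fin N) ℤ → ℝ) :
    (Fintype.card (EnumeratedGraph N d) : ℝ)⁻¹ * ∑ θ : EnumeratedGraph N d, f θ.1.1 =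
      (Fintype.card (simpleRegularMatrices N d) : ℝ)⁻¹ *
        ∑ E : simpleRegularMatrices N d, f E.1 := by
  rw [Fintype.sum_sigma, Fintype.card_sigma]
  simp only [card_enumeration, Finset.sum_const, Finset.card_univ, nsmul_eq_mul, smul_eq_mul,
    ← Finset.mul_sum, Nat.cast_mul]
  have : (d.factorial : ℝ) ≠ 0 := by exact_mod_cast d.factorial_ne_zero
  field_simp

/-- The edges that may be switched. -/
abbrev graphEdges (θ : EnumeratedGraph N d) : Finset (Fin N × Fin N) := directedEdges θ.1.1

theorem card_graphEdges (θ : EnumeratedGraph N d) : (graphEdges θ).card = N * d :=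
  card_directedEdges θ.1.2

theorem graphEdges_nonempty (θ : EnumeratedGraph N d) : (graphEdges θ).Nonempty := by
  rw [← Finset.card_pos, card_graphEdges]
  exact Nat.mul_pos (NeZero.pos N) (NeZero.pos d)

/-- The switches given by pairs of edges. -/
def switchData (θ : EnumeratedGraph N d) (u : Fin d → (Fin N × Fin N) × (Fin N × Fin N))
    (μ : Fin d) : SwitchData N :=
  ⟨(θ.2 μ).1, (u μ).1.1, (u μ).1.2, (u μ).2.1, (u μ).2.2⟩

theorem validData_switchData {θ : EnumeratedGraph N d}
    {u : Fin d → (Fin N × Fin N) × (Fin N × Fin N)} (h : Supported graphEdges θ u) :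
    ValidData θ.1.1 (switchData θ u) :=
  ⟨θ.1.2, fun _ _ e => θ.2.injective (Subtype.ext e), fun μ =>
    ⟨(θ.2 μ).2, mem_directedEdges.1 (h μ).1, mem_directedEdges.1 (h μ).2⟩⟩

/-- Valid data are the same as points of the support. -/
def validDataEquiv :
    {y : Matrix (Fin N) (Fin N) ℤ × (Fin d → SwitchData N) // ValidData y.1 y.2} ≃
      {x : EnumeratedGraph N d × (Fin d → (Fin N × Fin N) × (Fin N × Fin N)) //
        Supported graphEdges x.1 x.2} where
  toFun y := ⟨(⟨⟨y.1.1, y.2.mem⟩, ⟨fun μ => ⟨(y.1.2 μ).a, (y.2.present μ).1⟩, fun _ _ e =>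
      y.2.injective (congrArg Subtype.val e)⟩⟩,
      fun μ => (((y.1.2 μ).p, (y.1.2 μ).p'), ((y.1.2 μ).q, (y.1.2 μ).q'))),
    fun μ => ⟨mem_directedEdges.2 (y.2.present μ).2.1, mem_directedEdges.2 (y.2.present μ).2.2⟩⟩
  invFun x := ⟨(x.1.1.1.1, switchData x.1.1 x.1.2), validData_switchData x.2⟩
  left_inv _ := rfl
  right_inv _ := rfl

/-- The simultaneous switch is an involution of the valid data. -/
def switchPerm :
    Equiv.Perm {y : Matrix (Fin N) (Fin N) ℤ × (Fin d → SwitchData N) // ValidData y.1 y.2} :=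
  Function.Involutive.toPerm
    (fun y => ⟨(switchedMatrix y.1.1 y.1.2, switchedData y.1.1 y.1.2), y.2.switched⟩) fun y =>
    Subtype.ext (Prod.ext y.2.switchedMatrix_switched y.2.switchedData_switched)

variable [Nonempty (EnumeratedGraph N d)]

/-- The parametrization of the uniform model. -/
abbrev edgeParam (d N : ℕ) [NeZero N] [NeZero d] [Nonempty (EnumeratedGraph N d)] :
    Parametrization d := pairParam d (graphEdges (N := N) (d := d)) graphEdges_nonempty

/-- The switches. -/
def edgeData (ω : (edgeParam d N).Augmented) : Fin d → SwitchData N := switchData ω.θ ω.u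

/-- The adjacency matrix after the simultaneous switch. -/
def uniformFinal (ω : (edgeParam d N).Augmented) : Matrix (Fin N) (Fin N) ℤ :=
  switchedMatrix ω.θ.1.1 (edgeData ω)

/-- The involution lives on the valid data only, that is on the support, and is extended by the
identity. All graphs have `N * d` directed edges, as the invariance of the law requires. -/
theorem uniformFinal_law :
    (edgeParam d N).prob.map uniformFinal = RegularGraphModel.uniform.law N d := by
  classical
  have : IsProbabilityMeasure (uniformOn (simpleRegularMatrices N d)) := by
    refine isProbabilityMeasure_uniformOn (Set.toFinite _) ?_
    obtain ⟨θ⟩ := ‹Nonempty (EnumeratedGraph N d)›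
    exact ⟨θ.1.1, θ.1.2⟩
  have : IsFiniteMeasure (RegularGraphModel.uniform.law N d) := by
    unfold RegularGraphModel.law; infer_instance
  refine prob_map_eq (hκ := graphEdges_nonempty) _ _ fun S => ?_
  rw [prob_real_preimage_of_equiv (fun θ θ' => by rw [card_graphEdges, card_graphEdges])
    (Equiv.Perm.ofSubtype (validDataEquiv.permCongr switchPerm))
    (fun x => Equiv.Perm.ofSubtype_apply_mem_iff_mem (p := fun x : EnumeratedGraph N d × _ =>
      Supported graphEdges x.1 x.2) _ x) (fun θ => θ.1.1)]
  · rw [enumeratedGraph_sum]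
    simp only [RegularGraphModel.law]
    rw [uniformOn_real]
  · intro ω hω
    have h := Equiv.Perm.ofSubtype_apply_of_mem (p := fun x : EnumeratedGraph N d × _ =>
      Supported graphEdges x.1 x.2) (validDataEquiv.permCongr switchPerm) (a := (ω.θ, ω.u)) hω
    exact (congrArg (fun x => x.1.1.1) h).symm

end UniformModel

/-! ### Resampling in the uniform model -/

section UniformResampling

set_option linter.unusedSectionVars false

open SwitchData

variable {N d : ℕ} [NeZero N] [NeZero d] [Nonempty (EnumeratedGraph N d)]

theorem edgeParam_condUniform_fst (c : UniformCoordinate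
      (fun ω : (edgeParam d N).Augmented => ((edgeParam d N).weight ω).toReal)
      (fun ω => graphEdges ω.θ)) {x : (edgeParam d N).Augmented → Fin N}
    (hx : ∀ v ω, x (c.put v ω) = v.1) : CondUniform (edgeParam d N).prob (invSigma c.put) x :=
  pairParam_condUniform c fun ω i => by
    simp only [hx]
    rw [card_directedEdges_fst ω.θ.1.2, card_graphEdges]

theorem edgeParam_condUniform_snd (c : UniformCoordinate
      (fun ω : (edgeParam d N).Augmented => ((edgeParam d N).weight ω).toReal)
      (fun ω => graphEdges ω.θ)) {x : (edgeParam d N).Augmented → Fin N}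
    (hx : ∀ v ω, x (c.put v ω) = v.2) : CondUniform (edgeParam d N).prob (invSigma c.put) x :=
  pairParam_condUniform c fun ω i => by
    simp only [hx]
    rw [card_directedEdges_snd ω.θ.1.2, card_graphEdges]

theorem occupied_congr {t t' : Fin d → SwitchData N} {μ : Fin d} (ht : ∀ ν, ν ≠ μ → t' ν = t ν)
    (ha : (t' μ).a = (t μ).a) : occupied t' μ = occupied t μ := by
  rw [occupied, occupied, ha]
  congr 2
  exact Finset.biUnion_congr rfl fun ν hν => by rw [ht ν (Finset.ne_of_mem_erase hν)]

/-- The neighbours of a vertex. -/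
def neighbours (E : Matrix (Fin N) (Fin N) ℤ) (i : Fin N) : Finset (Fin N) :=
  Finset.univ.filter fun j => E i j = 1

/-- The vertices that the first vertex of the first edge avoids in a typical switch. -/
def avoidFirst (E : Matrix (Fin N) (Fin N) ℤ) (O : Finset (Fin N)) : Finset (Fin N) :=
  O ∪ neighbours E 0

/-- The vertices that the vertices of the second edge avoid in a typical switch. -/
def avoidSecond (E : Matrix (Fin N) (Fin N) ℤ) (O : Finset (Fin N)) (e : Fin N × Fin N)
    (i : Fin N) : Finset (Fin N) :=
  O ∪ ({e.1, e.2} ∪ neighbours E i)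

theorem card_avoidFirst_le {E : Matrix (Fin N) (Fin N) ℤ} (hE : E ∈ simpleRegularMatrices N d)
    (t : Fin d → SwitchData N) (μ : Fin d) : (avoidFirst E (occupied t μ)).card ≤ 6 * d := by
  have h1 := Finset.card_union_le (occupied t μ) (neighbours E 0)
  have h2 := card_occupied_le (t := t) (NeZero.pos d) μ
  have h3 : (neighbours E 0).card = d := card_row hE 0
  unfold avoidFirst
  omega

theorem card_avoidSecond_le {E : Matrix (Fin N) (Fin N) ℤ} (hE : E ∈ simpleRegularMatrices N d)
    (t : Fin d → SwitchData N) (μ : Fin d) (e : Fin N × Fin N) (i : Fin N) :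
    (avoidSecond E (occupied t μ) e i).card ≤ 8 * d := by
  have h1 := Finset.card_union_le (occupied t μ) ({e.1, e.2} ∪ neighbours E i)
  have h4 := Finset.card_union_le {e.1, e.2} (neighbours E i)
  have h5 : ({e.1, e.2} : Finset (Fin N)).card ≤ 2 := Finset.card_le_two
  have h2 := card_occupied_le (t := t) (NeZero.pos d) μ
  have h3 : (neighbours E i).card = d := card_row hE i
  have h6 := NeZero.pos d
  unfold avoidSecond
  omega

/-- Distinctness within each of the three given edges follows from simplicity; the avoided sets
supply the other inequalities and the absence of the edges to be created. -/
theorem typicalSwitch_of_notMem {E : Matrix (Fin N) (Fin N) ℤ} {t : Fin d → SwitchData N}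
    (h : ValidData E t) {μ : Fin d} (h1 : (t μ).p ∉ avoidFirst E (occupied t μ))
    (h2 : (t μ).p' ∉ occupied t μ)
    (h3 : (t μ).q ∉ avoidSecond E (occupied t μ) ((t μ).p, (t μ).p') (t μ).a)
    (h4 : (t μ).q' ∉ avoidSecond E (occupied t μ) ((t μ).p, (t μ).p') (t μ).p') :
    TypicalSwitch E t μ := by
  have h0 : ∀ i j, E i j ≠ 1 → E i j = 0 := fun i j hij => (h.mem.2.1 i j).resolve_right hij
  have hne : ∀ i j, E i j = 1 → i ≠ j := fun i j hij e => by
    rw [e, h.mem.2.2.1 j] at hij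
    exact zero_ne_one hij
  have ha := h.neighbour_ne μ
  have hp := hne _ _ (h.present μ).2.1
  have hq := hne _ _ (h.present μ).2.2
  simp only [avoidFirst, avoidSecond, neighbours, Finset.mem_union, not_or, Finset.mem_filter,
    Finset.mem_univ, true_and, Finset.mem_insert, Finset.mem_singleton] at h1 h3 h4
  have hO : ∀ i, i ∉ occupied t μ → i ≠ 0 ∧ i ≠ (t μ).a := fun i hi => by
    simp only [occupied, Finset.mem_insert, not_or] at hi
    exact ⟨hi.1, hi.2.1⟩
  have g1 := hO _ h1.1
  have g2 := hO _ h2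
  have g3 := hO _ h3.1
  have g4 := hO _ h4.1
  refine ⟨⟨?_, h0 _ _ h1.2, h0 _ _ h3.2.2, h0 _ _ h4.2.2⟩, h1.1, h2, h3.1, h4.1⟩
  simp only [Distinct, List.nodup_cons, List.mem_cons, List.not_mem_nil, or_false, not_or,
    not_false_eq_true, List.nodup_nil, and_true]
  exact ⟨⟨ha.symm, g1.1.symm, g2.1.symm, g3.1.symm, g4.1.symm⟩,
    ⟨g1.2.symm, g2.2.symm, g3.2.symm, g4.2.symm⟩,
    ⟨hp, Ne.symm h3.2.1.1, Ne.symm h4.2.1.1⟩, ⟨Ne.symm h3.2.1.2, Ne.symm h4.2.1.2⟩, hq⟩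

/-- The data after resampling `u_μ`. -/
def edgeData' (μ : Fin d) (ω : (edgeParam d N).Augmented) : Fin d → SwitchData N :=
  edgeData ((edgeParam d N).exchange μ ω)

theorem edgeData'_of_ne {μ ν : Fin d} (h : ν ≠ μ) (ω : (edgeParam d N).Augmented) :
    edgeData' μ ω ν = edgeData ω ν := by
  simp only [edgeData', edgeData, switchData, exchange_u_of_ne _ h]
  rfl

theorem edgeData'_self (μ : Fin d) (ω : (edgeParam d N).Augmented) :
    edgeData' μ ω μ = ⟨(ω.θ.2 μ).1, (ω.u' μ).1.1, (ω.u' μ).1.2, (ω.u' μ).2.1, (ω.u' μ).2.2⟩ := by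
  simp only [edgeData', edgeData, switchData, exchange_u_self]
  rfl

theorem occupied_edgeData' (μ : Fin d) (ω : (edgeParam d N).Augmented) :
    occupied (edgeData' μ ω) μ = occupied (edgeData ω) μ :=
  occupied_congr (fun _ h => edgeData'_of_ne h ω) (by rw [edgeData'_self]; rfl)

/-- The event that the switch or the resampled switch is not typical, or of probability zero. -/
def uniformBad (μ : Fin d) : Set (edgeParam d N).Augmented :=
  {ω | ¬ (TypicalSwitch ω.θ.1.1 (edgeData ω) μ ∧ TypicalSwitch ω.θ.1.1 (edgeData' μ ω) μ)}

theorem occupied_edgeData_congr (μ : Fin d) {ω ω' : (edgeParam d N).Augmented} (hθ : ω'.θ = ω.θ)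
    (hu : ∀ ν, ν ≠ μ → ω'.u ν = ω.u ν) :
    occupied (edgeData ω') μ = occupied (edgeData ω) μ := by
  obtain ⟨θ, u, u'⟩ := ω
  obtain ⟨θ₂, u₂, u₂'⟩ := ω'
  obtain rfl : θ₂ = θ := hθ
  exact occupied_congr (fun ν h => congrArg (fun z : (Fin N × Fin N) × (Fin N × Fin N) =>
    (⟨(θ₂.2 ν).1, z.1.1, z.1.2, z.2.1, z.2.2⟩ : SwitchData N)) (hu ν h)) rfl

/-- The vertices `p`, `p'`, `q`, `q'` avoid at most `6d`, `5d`, `8d`, `8d` values, in both versions: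
`54 = 2 · 27`. The second edge is drawn independently of the first, so it can be asked to avoid it.
-/
theorem uniformBad_prob (μ : Fin d) : CondProbLE (edgeParam d N).prob
    ((edgeParam d N).sigmaG μ) (54 * d / N) (uniformBad μ) := by
  have occ1 : ∀ v (ω : (edgeParam d N).Augmented),
      occupied (edgeData ((coordFst graphEdges_nonempty μ).put v ω)) μ =
      occupied (edgeData ω) μ := fun v ω => occupied_edgeData_congr μ rfl fun ν h => by
    simp [coordFst, h]
  have occ2 : ∀ v (ω : (edgeParam d N).Augmented),
      occupied (edgeData ((coordSnd graphEdges_nonempty μ).put v ω)) μ =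
      occupied (edgeData ω) μ := fun v ω => occupied_edgeData_congr μ rfl fun ν h => by
    simp [coordSnd, h]
  have a1 := condProbLE_of_mem (sigmaG_le_coordFst μ) (edgeParam_condUniform_fst (N := N)
    (coordFst graphEdges_nonempty μ) (x := fun ω => (ω.u μ).1.1) (fun _ _ => by simp [coordFst]))
    (fun ω => avoidFirst ω.θ.1.1 (occupied (edgeData ω) μ)) (fun v ω => by rw [occ1]; rfl)
    (t := 6 * d) (fun ω => card_avoidFirst_le ω.θ.1.2 _ _)
  have a2 := condProbLE_of_mem (sigmaG_le_coordFst μ) (edgeParam_condUniform_snd (N := N)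
    (coordFst graphEdges_nonempty μ) (x := fun ω => (ω.u μ).1.2) (fun _ _ => by simp [coordFst]))
    (fun ω => occupied (edgeData ω) μ) occ1 (t := 5 * d)
    (fun ω => card_occupied_le (NeZero.pos d) _)
  have a3 := condProbLE_of_mem (sigmaG_le_coordSnd μ) (edgeParam_condUniform_fst (N := N)
    (coordSnd graphEdges_nonempty μ) (x := fun ω => (ω.u μ).2.1) (fun _ _ => by simp [coordSnd]))
    (fun ω => avoidSecond ω.θ.1.1 (occupied (edgeData ω) μ) (ω.u μ).1 (ω.θ.2 μ).1)
    (fun v ω => by rw [occ2]; simp [coordSnd]; rfl)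
    (t := 8 * d) (fun ω => card_avoidSecond_le ω.θ.1.2 _ _ _ _)
  have a4 := condProbLE_of_mem (sigmaG_le_coordSnd μ) (edgeParam_condUniform_snd (N := N)
    (coordSnd graphEdges_nonempty μ) (x := fun ω => (ω.u μ).2.2) (fun _ _ => by simp [coordSnd]))
    (fun ω => avoidSecond ω.θ.1.1 (occupied (edgeData ω) μ) (ω.u μ).1 (ω.u μ).1.2)
    (fun v ω => by rw [occ2]; simp [coordSnd])
    (t := 8 * d) (fun ω => card_avoidSecond_le ω.θ.1.2 _ _ _ _)
  have b1 := condProbLE_of_mem (sigmaG_le_coordFst' μ) (edgeParam_condUniform_fst (N := N)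
    (coordFst' graphEdges_nonempty μ) (x := fun ω => (ω.u' μ).1.1) (fun _ _ => by simp [coordFst']))
    (fun ω => avoidFirst ω.θ.1.1 (occupied (edgeData ω) μ)) (fun v ω => rfl)
    (t := 6 * d) (fun ω => card_avoidFirst_le ω.θ.1.2 _ _)
  have b2 := condProbLE_of_mem (sigmaG_le_coordFst' μ) (edgeParam_condUniform_snd (N := N)
    (coordFst' graphEdges_nonempty μ) (x := fun ω => (ω.u' μ).1.2) (fun _ _ => by simp [coordFst']))
    (fun ω => occupied (edgeData ω) μ) (fun _ _ => rfl) (t := 5 * d)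
    (fun ω => card_occupied_le (NeZero.pos d) _)
  have b3 := condProbLE_of_mem (sigmaG_le_coordSnd' μ) (edgeParam_condUniform_fst (N := N)
    (coordSnd' graphEdges_nonempty μ) (x := fun ω => (ω.u' μ).2.1) (fun _ _ => by simp [coordSnd']))
    (fun ω => avoidSecond ω.θ.1.1 (occupied (edgeData ω) μ) (ω.u' μ).1 (ω.θ.2 μ).1)
    (fun v ω => by simp [coordSnd', edgeData]; rfl)
    (t := 8 * d) (fun ω => card_avoidSecond_le ω.θ.1.2 _ _ _ _)
  have b4 := condProbLE_of_mem (sigmaG_le_coordSnd' μ) (edgeParam_condUniform_snd (N := N)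
    (coordSnd' graphEdges_nonempty μ) (x := fun ω => (ω.u' μ).2.2) (fun _ _ => by simp [coordSnd']))
    (fun ω => avoidSecond ω.θ.1.1 (occupied (edgeData ω) μ) (ω.u' μ).1 (ω.u' μ).1.2)
    (fun v ω => by simp [coordSnd', edgeData])
    (t := 8 * d) (fun ω => card_avoidSecond_le ω.θ.1.2 _ _ _ _)
  -- Off the support `u` need not consist of edges of the graph, and the data need not be valid.
  have hnull := CondProbLE.of_null (𝒢 := (edgeParam d N).sigmaG μ)
    (B := {ω | ¬ (Supported graphEdges ω.θ ω.u ∧ Supported graphEdges ω.θ ω.u')})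
    ((ae_supported (hκ := graphEdges_nonempty (N := N) (d := d))).mono fun ω h => not_not.2 h)
  refine (((((a1.union a2).union (a3.union a4)).union
    ((b1.union b2).union (b3.union b4))).union hnull)).subset ?_ ?_
  · intro ω hω
    by_contra hcon
    simp only [Set.mem_union, Set.mem_ofPred_eq, not_or, not_not] at hcon
    obtain ⟨⟨⟨⟨a1, a2⟩, a3, a4⟩, ⟨b1, b2⟩, b3, b4⟩, hs, hs'⟩ := hcon
    refine hω ⟨typicalSwitch_of_notMem (validData_switchData hs) a1 a2 a3 a4, ?_⟩
    have hs2 : Supported graphEdges ω.θ ((edgeParam d N).exchange μ ω).u := fun ν => by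
      by_cases hν : ν = μ
      · rw [hν, exchange_u_self]; exact hs' μ
      · rw [exchange_u_of_ne _ hν]; exact hs ν
    have hv : ValidData ω.θ.1.1 (edgeData' μ ω) := validData_switchData hs2
    refine typicalSwitch_of_notMem hv ?_ ?_ ?_ ?_ <;> rw [occupied_edgeData', edgeData'_self]
    exacts [b1, b2, b3, b4]
  · push_cast
    apply le_of_eq
    ring

/-- The enumerated neighbours are distinct, so only the four drawn vertices of each other switch can
hit the `μ`-th neighbour. The union bound gives `4d/N`, enlarged to the common error. -/
theorem freeNeighbour_prob (μ : Fin d) : CondProbLE (edgeParam d N).prob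
    ((edgeParam d N).sigmaF 0) (54 * d / N) {ω | FreeNeighbour (edgeData ω) μ}ᶜ := by
  classical
  have key : ∀ ν : Fin d, CondProbLE (edgeParam d N).prob ((edgeParam d N).sigmaF 0) (4 / N)
      {ω | (ω.θ.2 μ).1 ∈ ({(ω.u ν).1.1, (ω.u ν).1.2, (ω.u ν).2.1, (ω.u ν).2.2} :
        Finset (Fin N))} := fun ν => by
    have a1 := condProbLE_of_mem (sigmaG_le_coordFst ν) (edgeParam_condUniform_fst (N := N)
      (coordFst graphEdges_nonempty ν) (x := fun ω => (ω.u ν).1.1) (fun _ _ => by simp [coordFst]))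
      (fun ω => {(ω.θ.2 μ).1}) (fun _ _ => rfl) (t := 1) (fun _ => by simp)
    have a2 := condProbLE_of_mem (sigmaG_le_coordFst ν) (edgeParam_condUniform_snd (N := N)
      (coordFst graphEdges_nonempty ν) (x := fun ω => (ω.u ν).1.2) (fun _ _ => by simp [coordFst]))
      (fun ω => {(ω.θ.2 μ).1}) (fun _ _ => rfl) (t := 1) (fun _ => by simp)
    have a3 := condProbLE_of_mem (sigmaG_le_coordSnd ν) (edgeParam_condUniform_fst (N := N)
      (coordSnd graphEdges_nonempty ν) (x := fun ω => (ω.u ν).2.1) (fun _ _ => by simp [coordSnd]))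
      (fun ω => {(ω.θ.2 μ).1}) (fun _ _ => rfl) (t := 1) (fun _ => by simp)
    have a4 := condProbLE_of_mem (sigmaG_le_coordSnd ν) (edgeParam_condUniform_snd (N := N)
      (coordSnd graphEdges_nonempty ν) (x := fun ω => (ω.u ν).2.2) (fun _ _ => by simp [coordSnd]))
      (fun ω => {(ω.θ.2 μ).1}) (fun _ _ => rfl) (t := 1) (fun _ => by simp)
    refine (((a1.union a2).union (a3.union a4)).mono (sigmaF_zero_le_sigmaG _ ν)).subset ?_ ?_
    · intro ω hω
      simp only [Set.mem_ofPred_eq, Finset.mem_insert, Finset.mem_singleton] at hω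
      simp only [Set.mem_union, Set.mem_ofPred_eq, Finset.mem_singleton,
        eq_comm (b := (ω.θ.2 μ).1)]
      tauto
    · push_cast
      apply le_of_eq
      ring
  refine (CondProbLE.biUnion Finset.univ fun ν _ => key ν).subset ?_ ?_
  · intro ω hω
    simp only [FreeNeighbour, Set.mem_compl_iff, Set.mem_ofPred_eq, not_forall, not_not] at hω
    obtain ⟨ν, hν, hb⟩ := hω
    refine ⟨ν, Finset.mem_univ ν, ?_⟩
    rw [block, Finset.mem_insert] at hb
    exact hb.resolve_left fun e => hν (ω.θ.2.injective (Subtype.ext e)).symm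
  · rw [Finset.card_univ, Fintype.card_fin, ← mul_div_assoc, mul_comm (d : ℝ)]
    gcongr
    norm_num

theorem uniformFinal_resample (μ : Fin d) (ω : (edgeParam d N).Augmented) :
    (edgeParam d N).resample μ uniformFinal ω - uniformFinal ω =
      switchedMatrix ω.θ.1.1 (edgeData' μ ω) - switchedMatrix ω.θ.1.1 (edgeData ω) := rfl

open Classical in
theorem uniform_localResampling (μ : Fin d) : Nonempty (LocalResampling (edgeParam d N)
    uniformFinal (fun ω => (ω.u μ).1.1)
    (fun ω => (switchedData ω.θ.1.1 (edgeData ω) μ).a) μ (54 * d / N) 40) := by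
  have fp := edgeParam_condUniform_fst (N := N) (coordFst graphEdges_nonempty μ)
    (x := fun ω => (ω.u μ).1.1) (fun _ _ => by simp [coordFst])
  have sp := edgeParam_condUniform_snd (N := N) (coordFst graphEdges_nonempty μ)
    (x := fun ω => (ω.u μ).1.2) (fun _ _ => by simp [coordFst])
  have fq := edgeParam_condUniform_fst (N := N) (coordSnd graphEdges_nonempty μ)
    (x := fun ω => (ω.u μ).2.1) (fun _ _ => by simp [coordSnd])
  have sq := edgeParam_condUniform_snd (N := N) (coordSnd graphEdges_nonempty μ)
    (x := fun ω => (ω.u μ).2.2) (fun _ _ => by simp [coordSnd])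
  have fp' := edgeParam_condUniform_fst (N := N) (coordFst' graphEdges_nonempty μ)
    (x := fun ω => (ω.u' μ).1.1) (fun _ _ => by simp [coordFst'])
  have sp' := edgeParam_condUniform_snd (N := N) (coordFst' graphEdges_nonempty μ)
    (x := fun ω => (ω.u' μ).1.2) (fun _ _ => by simp [coordFst'])
  have fq' := edgeParam_condUniform_fst (N := N) (coordSnd' graphEdges_nonempty μ)
    (x := fun ω => (ω.u' μ).2.1) (fun _ _ => by simp [coordSnd'])
  have sq' := edgeParam_condUniform_snd (N := N) (coordSnd' graphEdges_nonempty μ)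
    (x := fun ω => (ω.u' μ).2.2) (fun _ _ => by simp [coordSnd'])
  have tq := fq.mono (sigmaGWith_le_coordSnd μ (b := fun ω => (ω.u μ).1.1) Prod.fst fun _ => rfl)
  have tq' := fq'.mono
    (sigmaGWith_le_coordSnd' μ (b := fun ω => (ω.u μ).1.1) Prod.fst fun _ => rfl)
  have hle : (edgeParam d N).sigmaG μ ≤ sigmaGWith (edgeParam d N) μ (fun ω => (ω.u μ).1.1) :=
    le_sup_of_le_left le_sup_left
  obtain ⟨E, hmem⟩ : ∃ E : Set (edgeParam d N).Augmented,
      ∀ ω, ω ∈ E ↔ FreeNeighbour (edgeData ω) μ :=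
    ⟨{ω | FreeNeighbour (edgeData ω) μ}, fun _ => Iff.rfl⟩
  have hE : MeasurableSet[(edgeParam d N).sigmaG μ] E :=
    measurableSet_sigmaG_of_factor _ fun ω ω' h h' hω => by
      rw [hmem] at hω ⊢
      intro ν hν
      have := hω ν hν
      simp only [edgeData, switchData] at this ⊢
      rw [← h, ← h' ν hν]
      exact this
  -- If the neighbour is not free, neither version of a typical switch is performed; keeping the
  -- original vertices makes all terms cancel.
  have hp := (fp'.mono (sigmaG_le_coordFst' μ)).ite (fp.mono (sigmaG_le_coordFst μ)) hE
  have hsp := (sp'.mono (sigmaG_le_coordFst' μ)).ite (sp.mono (sigmaG_le_coordFst μ)) hE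
  have hq := (fq'.mono (sigmaG_le_coordSnd' μ)).ite (fq.mono (sigmaG_le_coordSnd μ)) hE
  have hsq := (sq'.mono (sigmaG_le_coordSnd' μ)).ite (sq.mono (sigmaG_le_coordSnd μ)) hE
  have htq := tq'.ite tq (hle _ hE)
  exact ⟨
    { B := uniformBad μ
      g := E
      m := 4
      b' := fun ω => if ω ∈ E then (ω.u' μ).1.1 else (ω.u μ).1.1
      x := ![fun ω => (ω.θ.2 μ).1, fun ω => if ω ∈ E then (ω.u' μ).1.2 else (ω.u μ).1.2,
        fun ω => (ω.u μ).1.1, fun ω => (ω.u μ).2.1]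
      y := ![fun ω => if ω ∈ E then (ω.u' μ).2.1 else (ω.u μ).2.1,
        fun ω => if ω ∈ E then (ω.u' μ).2.2 else (ω.u μ).2.2,
        fun ω => (ω.u μ).1.2, fun ω => (ω.u μ).2.2]
      z := ![fun ω => (ω.θ.2 μ).1, fun ω => (ω.u μ).1.2,
        fun ω => if ω ∈ E then (ω.u' μ).1.1 else (ω.u μ).1.1,
        fun ω => if ω ∈ E then (ω.u' μ).2.1 else (ω.u μ).2.1]
      w := ![fun ω => (ω.u μ).2.1, fun ω => (ω.u μ).2.2,
        fun ω => if ω ∈ E then (ω.u' μ).1.2 else (ω.u μ).1.2,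
        fun ω => if ω ∈ E then (ω.u' μ).2.2 else (ω.u μ).2.2]
      m_lt := by norm_num
      prob_B := uniformBad_prob μ
      prob_g := (freeNeighbour_prob μ).subset (by simp [hmem, Set.subset_def]) le_rfl
      uniform_b := fp.mono (sigmaG_le_coordFst μ)
      uniform_b' := hp
      uniform_xy := fun j => by
        fin_cases j
        -- The old neighbour is fixed by `θ`; the end from the second edge is free given `a_μ` and
        -- `ã_μ`, which come from first edges.
        · exact Or.inr (Or.inr htq)
        · exact Or.inl ⟨hsp, hsq⟩
        · exact Or.inl ⟨fp.mono (sigmaG_le_coordFst μ), sp.mono (sigmaG_le_coordFst μ)⟩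
        · exact Or.inl ⟨fq.mono (sigmaG_le_coordSnd μ), sq.mono (sigmaG_le_coordSnd μ)⟩
      uniform_zw := fun j => by
        fin_cases j
        · exact Or.inr (Or.inr tq)
        · exact Or.inl ⟨sp.mono (sigmaG_le_coordFst μ), sq.mono (sigmaG_le_coordSnd μ)⟩
        · exact Or.inl ⟨hp, hsp⟩
        · exact Or.inl ⟨hq, hsq⟩
      difference := fun ω hω => by
        simp only [uniformBad, Set.mem_ofPred_eq, not_not] at hω
        rw [uniformFinal_resample, hω.1.switchedMatrix_sub hω.2 (fun _ h => edgeData'_of_ne h ω)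
          (by rw [edgeData'_self]; rfl), edgeData'_self]
        simp only [Fin.sum_univ_four, Matrix.cons_val]
        by_cases hωE : ω ∈ E
        · rw [if_pos ((hmem ω).1 hωE)]
          simp only [if_pos hωE, change, edgeData, switchData]
          abel
        · rw [if_neg fun h => hωE ((hmem ω).2 h)]
          simp only [if_neg hωE]
          abel
      typical := fun ω hω hωE => by
        simp only [uniformBad, Set.mem_ofPred_eq, not_not] at hω
        exact ⟨by simp [Parametrization.resample, exchange_u_self, hωE],
          hω.1.switchedData_a ((hmem ω).1 hωE)⟩
      bounded := Filter.Eventually.of_forall fun ω => by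
        rw [uniformFinal_resample]
        exact (switchedMatrix_sub_isEdgeDifference fun _ h => edgeData'_of_ne h ω).mono
          (by norm_num) }⟩

theorem edgeParam_hasLocalResampling :
    HasLocalResampling .uniform N d (54 * d / N) 40 := by
  refine ⟨edgeParam d N, fun μ ω => (ω.u μ).1.1,
    fun μ ω => (switchedData ω.θ.1.1 (edgeData ω) μ).a, uniformFinal, fun μ => ?_, fun μ => ?_, ?_,
    uniformFinal_law, ?_, fun μ => uniform_localResampling μ⟩
  · exact measurable_sigmaF_of_factor _ fun ω ω' _ h => by beta_reduce; rw [h]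
  · exact measurable_sigmaF_of_factor _ fun ω ω' h h' => by
      obtain ⟨θ, u, u'⟩ := ω
      obtain ⟨θ₂, u₂, u₂'⟩ := ω'
      obtain rfl : θ = θ₂ := h
      obtain rfl : u = u₂ := h'
      rfl
  · exact measurable_sigmaF_of_factor _ fun ω ω' h h' => by
      obtain ⟨θ, u, u'⟩ := ω
      obtain ⟨θ₂, u₂, u₂'⟩ := ω'
      obtain rfl : θ = θ₂ := h
      obtain rfl : u = u₂ := h'
      rfl
  · filter_upwards [ae_supported (hκ := graphEdges_nonempty (N := N) (d := d))] with ω hω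
    exact (validData_switchData hω.1).switched.row_zero

end UniformResampling

theorem uniform_hasLocalResampling {N d : ℕ} [NeZero N] (hd : 0 < d) (hdN : d < N)
    (h : Even (N * d)) : HasLocalResampling .uniform N d (54 * d / N) 40 := by
  have : NeZero d := ⟨hd.ne'⟩
  have := enumeratedGraph_nonempty (simpleRegularMatrices_nonempty hdN h)
  exact edgeParam_hasLocalResampling

/-! ### Comparison of the errors with `1/√(dD)` and conclusion -/

section Combination

variable {N d : ℕ} [NeZero N]

theorem LocalResampling.mono {P : Parametrization d}
    {A : P.Augmented → Matrix (Fin N) (Fin N) ℤ} {b c : P.Augmented → Fin N} {μ : Fin d}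
    {ε ε' : ℝ} {L L' : ℕ} (h : LocalResampling P A b c μ ε L) (hε : ε ≤ ε') (hL : L ≤ L') :
    Nonempty (LocalResampling P A b c μ ε' L') :=
  ⟨{ h with
    m_lt := h.m_lt.trans_le hL
    prob_B := h.prob_B.subset subset_rfl hε
    prob_g := h.prob_g.subset subset_rfl hε
    bounded := h.bounded.mono fun _ hω => hω.mono hL }⟩

theorem HasLocalResampling.mono {M : RegularGraphModel} {ε ε' : ℝ} {L L' : ℕ}
    (h : HasLocalResampling M N d ε L) (hε : ε ≤ ε') (hL : L ≤ L') :
    HasLocalResampling M N d ε' L' := by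
  obtain ⟨P, a, α, A, h1, h2, h3, h4, h5, h6⟩ := h
  exact ⟨P, a, α, A, h1, h2, h3, h4, h5, fun μ => (h6 μ).elim fun h => h.mono hε hL⟩

theorem div_le_inv_sqrt {x r n : ℝ} (hx : 0 < x) (hr : 0 < r) (hn : 0 < n)
    (h : x ≤ n ^ 2 / r ^ 2) : r / n ≤ 1 / √x := by
  have h1 : √x ≤ n / r := by
    rw [← div_pow] at h
    exact (Real.sqrt_le_left (by positivity)).2 h
  rw [div_le_div_iff₀ hn (Real.sqrt_pos.2 hx), one_mul]
  rwa [le_div_iff₀ hr, mul_comm] at h1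

theorem mul_min_div_le {r n : ℝ} (hr : 0 < r) : r * min r (n ^ 2 / r) ≤ n ^ 2 / 1 ^ 2 := by
  calc r * min r (n ^ 2 / r) ≤ r * (n ^ 2 / r) :=
        mul_le_mul_of_nonneg_left (min_le_right _ _) hr.le
    _ = n ^ 2 / 1 ^ 2 := by field_simp

/-- The second argument of the minimum in `D` is chosen for this: `dD ≤ N²/d²` bounds `d/N` in the
uniform model, and `dD ≤ N²` bounds `1/N` in the other two. -/
theorem hasLocalResampling (M : RegularGraphModel) (hN : 2 ≤ N) (hd : 0 < d)
    (hM : M.Admissible N d) (hD : 1 ≤ M.D N d) :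
    HasLocalResampling M N d (54 / √(d * M.D N d)) 40 := by
  have hN0 : (0 : ℝ) < N := by exact_mod_cast (by omega : 0 < N)
  have hd0 : (0 : ℝ) < d := by exact_mod_cast hd
  have hpos : 0 < (d : ℝ) * M.D N d := mul_pos hd0 (zero_lt_one.trans_le hD)
  cases M with
  | uniform =>
    -- From `D ≥ 1` one gets `d³ ≤ N² < N³`, so that regular graphs exist.
    have hdN : d < N := by
      by_contra! hcon
      have h1 : (1 : ℝ) ≤ (N : ℝ) ^ 2 / (d : ℝ) ^ 3 := hD.trans (min_le_right _ _)
      rw [le_div_iff₀ (by positivity), one_mul] at h1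
      have h2 : d ^ 3 ≤ N ^ 2 := by exact_mod_cast h1
      have h3 : N ^ 3 ≤ d ^ 3 := Nat.pow_le_pow_left hcon 3
      have h4 : N ^ 2 < N ^ 3 := Nat.pow_lt_pow_right (by omega) (by norm_num)
      omega
    refine (uniform_hasLocalResampling hd hdN hM).mono ?_ le_rfl
    have h1 : (d : ℝ) * RegularGraphModel.uniform.D N d ≤ (N : ℝ) ^ 2 / (d : ℝ) ^ 2 := by
      calc (d : ℝ) * RegularGraphModel.uniform.D N d
          ≤ (d : ℝ) * ((N : ℝ) ^ 2 / (d : ℝ) ^ 3) :=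
            mul_le_mul_of_nonneg_left (min_le_right _ _) hd0.le
        _ = (N : ℝ) ^ 2 / (d : ℝ) ^ 2 := by field_simp
    have h2 := div_le_inv_sqrt hpos hd0 hN0 h1
    rw [mul_div_assoc, div_eq_mul_one_div 54]
    exact mul_le_mul_of_nonneg_left h2 (by norm_num)
  | permutation =>
    refine (permutation_hasLocalResampling hM).mono ?_ (by norm_num)
    have h2 := div_le_inv_sqrt hpos one_pos hN0 (mul_min_div_le hd0)
    rw [div_eq_mul_one_div 18, div_eq_mul_one_div 54]
    exact mul_le_mul (by norm_num) h2 (by positivity) (by norm_num)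
  | matching =>
    refine (matching_hasLocalResampling hM).mono ?_ (by norm_num)
    have h2 := div_le_inv_sqrt hpos one_pos hN0 (mul_min_div_le hd0)
    rw [div_eq_mul_one_div 10, div_eq_mul_one_div 54]
    exact mul_le_mul (by norm_num) h2 (by positivity) (by norm_num)

end Combination

end
theorem mainTheorem5 :
    ∃ (C : ℝ) (K N₀ : ℕ), ∀ (M : RegularGraphModel) (N d : ℕ) [NeZero N],
      N₀ ≤ N → 0 < d → M.Admissible N d → 1 ≤ M.D N d →
      ∃ (P : Parametrization d) (a α : Fin d → P.Augmented → Fin N)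
        (A : P.Augmented → Matrix (Fin N) (Fin N) ℤ),
        -- the random variables are measurable with respect to `ℱ_d`
        (∀ μ, Measurable[P.sigmaF d] (a μ)) ∧
        (∀ μ, Measurable[P.sigmaF d] (α μ)) ∧
        Measurable[P.sigmaF d] A ∧
        -- (i)
        P.prob.map A = M.law N d ∧
        (∀ᵐ ω ∂P.prob, ∀ i, A ω 0 i = ∑ μ, if i = α μ ω then 1 else 0) ∧
        ∀ μ : Fin d,
          -- (ii)(1)
          CondApproxUniform P.prob (P.sigmaG μ) (C / √(d * M.D N d)) (a μ) ∧
          -- (ii)(2)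
          HoldsWithCondProb P.prob (P.sigmaF 0) (1 - C / √(d * M.D N d))
            {ω | α μ ω = a μ ω} ∧
          -- (iii)(1)
          (∃ (s : Fin K → ℤˣ) (x y : Fin K → P.Augmented → Fin N) (n : P.Augmented → ℕ),
            (∀ ω, n ω ≤ K) ∧
            (∀ᵐ ω ∂P.prob, P.resample μ A ω - A ω =
              ∑ k : Fin K, if (k : ℕ) < n ω then (s k : ℤ) • edgeMatrix (x k ω) (y k ω) else 0) ∧
            (∃ n₀ : P.Augmented → ℕ, Measurable[P.sigmaG μ] n₀ ∧
              HoldsWithCondProb P.prob (P.sigmaG μ) (1 - C / √(d * M.D N d))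
                {ω | n ω = n₀ ω}) ∧
            ∀ k,
              CondApproxUniform P.prob (P.sigmaG μ) (C / √(d * M.D N d)) (x k) ∨
              CondApproxUniform P.prob (P.sigmaG μ) (C / √(d * M.D N d)) (y k)) ∧
          -- (iii)(2)
          ∃ (m : ℕ) (s : Fin m → ℤˣ) (x y : Fin m → P.Augmented → Fin N),
            m ≤ K ∧
            HoldsWithCondProb P.prob (P.sigmaF 0) (1 - C / √(d * M.D N d))
              {ω | P.resample μ A ω - A ω =
                edgeMatrix 0 (P.resample μ (a μ) ω) - edgeMatrix 0 (a μ ω) +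
                  ∑ k, (s k : ℤ) • edgeMatrix (x k ω) (y k ω)} ∧
            ∀ k,
              (CondApproxUniform P.prob (P.sigmaG μ) (C / √(d * M.D N d)) (x k) ∧
                CondApproxUniform P.prob (P.sigmaG μ) (C / √(d * M.D N d)) (y k)) ∨
              (CondApproxUniform P.prob
                  (P.sigmaG μ ⊔ MeasurableSpace.comap (a μ) ⊤ ⊔
                    MeasurableSpace.comap (P.resample μ (a μ)) ⊤)
                  (C / √(d * M.D N d)) (x k) ∨
                CondApproxUniform P.prob
                  (P.sigmaG μ ⊔ MeasurableSpace.comap (a μ) ⊤ ⊔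
                    MeasurableSpace.comap (P.resample μ (a μ)) ⊤)
                  (C / √(d * M.D N d)) (y k)) := by
  -- The error `54` is doubled by `LocalResampling.conclusion`, and the `40` positive and `40`
  -- negative edges make up one list.
  refine ⟨108, 40 + 40, 2, fun M N d _ hN hd hM hD => ?_⟩
  obtain ⟨P, a, α, A, h1, h2, h3, h4, h5, h6⟩ := hasLocalResampling M hN hd hM hD
  refine ⟨P, a, α, A, h1, h2, h3, h4, h5, fun μ => ?_⟩
  obtain ⟨h⟩ := h6 μ
  exact h.conclusion (div_nonneg (by norm_num) (Real.sqrt_nonneg _)) (le_of_eq (by ring))
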